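/- For $\underline a=(a_1,a_2)\in\mathbb C^2$ consider, on the universal covering of $\mathbb C^*$ (whose points $x$ carry an argument $\arg x\in\mathbb R$), the equation $$(\mathfrak E_2)\qquad x^2\,\Phi''(x)=(x^2+a_1x+a_2)\,\Phi(x).$$ There is exactly one family $\Phi_0(x,\underline a)$ of solutions, analytic in $x$ on the universal covering, for which there is a formal series $\phi_0\in\mathbb C[a_1,a_2][[x^{-1}]]$ with constant term $1$ such that $\Phi_0(x,\underline a)\sim x^{-a_1/2}e^{-x}\phi_0(x,\underline a)$ as $x\to\infty$ in every strict subsector of $|\arg x|<\frac{3\pi}{2}$, uniformly for $\underline a$ in compact sets. Put $\omega=e^{i\pi}$ and, for $k\in\mathbb Z$, $\Phi_k(x;a_1,a_2)=\Phi_0(\omega^kx;\omega^ka_1,\omega^{2k}a_2)$. Let $\underline a\in\mathbb C^2$ and let $p$ be either determination of $(1+4a_2)^{1/2}$. Then the Stokes-Sibuya connection matrix, i.e. the unique matrix of the form $\mathfrak S_0(\underline a)=\begin{pmatrix}C_0&\tilde C_0\\1&0\end{pmatrix}$ with $\Phi_{-1}=C_0\Phi_0+\tilde C_0\Phi_1$,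 exists and is $$\mathfrak S_0(\underline a)=\begin{pmatrix}-2i\,e^{-i\pi a_1/2}\,2^{-a_1}\,\dfrac{\Gamma(\frac p2+\frac{a_1}2+\frac12)}{\Gamma(\frac p2-\frac{a_1}2+\frac12)}\cos\!\Big(\big(\tfrac p2+\tfrac{a_1}2\big)\pi\Big)&e^{-i\pi a_1}\\[2mm]1&0\end{pmatrix},$$ where $\Gamma(s+\frac12)\cos(s\pi)$ denotes the entire function of $s$ obtained by removing its singularities at $s+\frac12=0,-1,-2,\dots$, and $1/\Gamma$ is zero at the poles of $\Gamma$. Moreover, suppose $p\notin\mathbb Z$. Then $(\mathfrak E_2)$ has unique solutions $f_1=x^{(1+p)/2}g_1(x)$ and $f_2=x^{(1-p)/2}g_2(x)$ with $g_1,g_2$ entire and $g_1(0)=g_2(0)=1$, and the $0\infty$ connection matrix, i.e. the unique matrix $M_0$ with $\begin{pmatrix}\Phi_{-1}\\\Phi_0\end{pmatrix}=M_0\begin{pmatrix}f_1\\f_2\end{pmatrix}$, exists and is (again with $1/\Gamma=0$ at the poles of $\Gamma$) $$M_0=\begin{pmatrix}-ie^{-i\pi\frac p2}\dfrac{2^{-\frac{a_1}2+\frac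 p2+1}\Gamma(-p)}{\sqrt2\,\Gamma(-\frac p2-\frac{a_1}2+\frac12)}&-ie^{i\pi\frac p2}\dfrac{2^{-\frac{a_1}2-\frac p2+1}\Gamma(p)}{\sqrt2\,\Gamma(\frac p2-\frac{a_1}2+\frac12)}\\[4mm]\dfrac{2^{\frac{a_1}2+\frac p2+1}\Gamma(-p)}{\sqrt2\,\Gamma(-\frac p2+\frac{a_1}2+\frac12)}&\dfrac{2^{\frac{a_1}2-\frac p2+1}\Gamma(p)}{\sqrt2\,\Gamma(\frac p2+\frac{a_1}2+\frac12)}\end{pmatrix}.$$ -/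

import Mathlib

open Complex Filter Topology

/-! The equation is `x ^ 2 Φ'' = (x ^ 2 + a₁ x + a₂) Φ`, with parameter `a : Fin 2 → ℂ`,
`a 0 = a₁` and `a 1 = a₂`.  Its solutions live on the universal covering of `ℂ \ {0}`, which is
identified with `ℂ` through the projection `t ↦ x = exp t`.  Thus `arg x = im t`, `ln x = t`, and
`x ^ α = exp (α * t)`. -/

namespace StokesSibuya

/-- The derivative `d/dx` of a function on the universal covering, in the coordinate
`t = ln x`. -/
noncomputable def ddx (F : ℂ → ℂ) (t : ℂ) : ℂ := exp (-t) * deriv F t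

/-- `F` is an analytic solution, on the whole universal covering, of
`d²F/dx² = ((x ^ 2 + a₁ x + a₂) / x ^ 2) F`. -/
def IsSolution (a : Fin 2 → ℂ) (F : ℂ → ℂ) : Prop :=
  Differentiable ℂ F ∧
    ∀ t, ddx (ddx F) t = ((exp t ^ 2 + a 0 * exp t + a 1) / exp t ^ 2) * F t

/-- The prefactor `x ^ r(a) * e ^ (-S(x, a))` of the asymptotic expansion.  Here `S(x, a) = x` and
`r(a) = -a₁ / 2`, since `√(x ^ 2 + a₁ x + a₂) / x = 1 + (a₁ / 2) x⁻¹ + O(x⁻²)`. -/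
noncomputable def prefactor (a : Fin 2 → ℂ) (t : ℂ) : ℂ :=
  exp (-(a 0) / 2 * t) * exp (-exp t)

/-- The family `Φ` admits, at infinity in every strict subsector `|arg x| ≤ θ < 3π/2` and uniformly
for `a` in compact sets, the (Poincaré) asymptotic expansion `x ^ r(a) e ^ (-S(x, a)) φ(x, a)`,
where `φ = ∑ cₙ(a) x ^ (-n)` has polynomial coefficients in `a`. -/
def HasExpansion (Φ : ℂ → (Fin 2 → ℂ) → ℂ) (φ : PowerSeries (MvPolynomial (Fin 2) ℂ)) : Prop :=
  ∀ θ : ℝ, θ < 3 * Real.pi / 2 → ∀ K : Set (Fin 2 → ℂ), IsCompact K → ∀ N : ℕ,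
    ∃ C R : ℝ, ∀ a ∈ K, ∀ t : ℂ, |t.im| ≤ θ → R ≤ ‖exp t‖ →
      ‖Φ t a - prefactor a t *
          ∑ n ∈ Finset.range N, MvPolynomial.eval a (PowerSeries.coeff n φ) * (exp t)⁻¹ ^ n‖
        ≤ C * ‖prefactor a t * (exp t)⁻¹ ^ N‖

/-- The solution `Φ₀(x, a)`, subdominant along the positive real axis, normalised by its asymptotic
expansion at infinity in the sector `|arg x| < 3π/2`, and continued to the universal covering. -/
def IsPhi0 (Φ : ℂ → (Fin 2 → ℂ) → ℂ) : Prop :=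
  (∀ a, IsSolution a (fun t => Φ t a)) ∧
    ∃ φ : PowerSeries (MvPolynomial (Fin 2) ℂ), PowerSeries.constantCoeff φ = 1 ∧ HasExpansion Φ φ

/-- `Φ_k(x, a) = Φ₀(ω ^ k x, ω ^ k • a)` with `ω = e ^ (iπ)` (of argument `π`) and
`λ • a = (λ a₁, λ ^ 2 a₂)`. -/
noncomputable def Phi (Φ₀ : ℂ → (Fin 2 → ℂ) → ℂ) (k : ℤ) (t : ℂ) (a : Fin 2 → ℂ) : ℂ :=
  Φ₀ (k * (Real.pi * I) + t)
    ![exp (k * (Real.pi * I)) * a 0, exp (k * (Real.pi * I)) ^ 2 * a 1]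

/-- `S` is the Stokes-Sibuya connection matrix `((C, C'), (1, 0))` at the index `k` and the
parameter `a`, where `Φ_{k-1} = C Φ_k + C' Φ_{k+1}`. -/
def IsStokesSibuyaMatrix (Φ₀ : ℂ → (Fin 2 → ℂ) → ℂ) (k : ℤ) (a : Fin 2 → ℂ)
    (S : Matrix (Fin 2) (Fin 2) ℂ) : Prop :=
  ∃ C C' : ℂ, S = !![C, C'; 1, 0] ∧
    ∀ t, Phi Φ₀ (k - 1) t a = C * Phi Φ₀ k t a + C' * Phi Φ₀ (k + 1) t a

/-- `f` is a normalised Frobenius solution at the origin,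
`f(x) = x ^ ((1 + p) / 2) * g(x)` with `g` entire and `g(0) = 1`. -/
def IsFrobenius (a : Fin 2 → ℂ) (p : ℂ) (f : ℂ → ℂ) : Prop :=
  IsSolution a f ∧
    ∃ g : ℂ → ℂ, Differentiable ℂ g ∧ g 0 = 1 ∧ ∀ t, f t = exp ((1 + p) / 2 * t) * g (exp t)

/-- `M` is the `0∞` connection matrix at the index `k` for the solutions `f₁`, `f₂`. -/
def IsZeroInftyMatrix (Φ₀ : ℂ → (Fin 2 → ℂ) → ℂ) (k : ℤ) (a : Fin 2 → ℂ) (f₁ f₂ : ℂ → ℂ)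
    (M : Matrix (Fin 2) (Fin 2) ℂ) : Prop :=
  ∀ t, ![Phi Φ₀ (k - 1) t a, Phi Φ₀ k t a] = M.mulVec ![f₁ t, f₂ t]

/-- The entire function `Γ(s + 1/2) cos(s π)`: the product with its removable singularities at
`s + 1/2 = 0, -1, -2, …` removed. -/
noncomputable def gammaCos (s : ℂ) : ℂ :=
  limUnder (𝓝[≠] s) (fun u : ℂ => Gamma (u + 1 / 2) * cos (u * Real.pi))

theorem gamma_mul_cos (u : ℂ) (h : ∀ j : ℕ, u + 1 / 2 ≠ -(j : ℂ)) :
    Gamma (u + 1 / 2) * cos (u * Real.pi) = Real.pi * (Gamma (1 / 2 - u))⁻¹ := by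
  have hπ : (Real.pi : ℂ) ≠ 0 := by exact_mod_cast Real.pi_ne_zero
  have key := Complex.Gamma_mul_Gamma_one_sub (u + 1 / 2)
  have e1 : (1 : ℂ) - (u + 1 / 2) = 1 / 2 - u := by ring
  have e2 : (Real.pi : ℂ) * (u + 1 / 2) = u * Real.pi + Real.pi / 2 := by ring
  rw [e1, e2, Complex.sin_add_pi_div_two] at key
  have hG : Gamma (u + 1 / 2) ≠ 0 := Complex.Gamma_ne_zero h
  by_cases hc : cos (u * Real.pi) = 0
  · rw [hc, div_zero] at key
    rcases mul_eq_zero.mp key with h0 | h0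
    · exact absurd h0 hG
    · rw [hc, h0]; simp
  · have hG2 : Gamma (1 / 2 - u) ≠ 0 := by
      intro h0
      rw [h0, mul_zero] at key
      exact (div_ne_zero hπ hc) key.symm
    rw [eq_div_iff hc] at key
    rw [eq_mul_inv_iff_mul_eq₀ hG2]
    linear_combination key

theorem tendsto_gammaCos (s : ℂ) :
    Tendsto (fun u : ℂ => Gamma (u + 1 / 2) * cos (u * Real.pi)) (𝓝[≠] s)
      (𝓝 (Real.pi * (Gamma (1 / 2 - s))⁻¹)) := by
  have hcont : Continuous fun u : ℂ => (Real.pi : ℂ) * (Gamma (1 / 2 - u))⁻¹ :=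
    continuous_const.mul
      (Complex.differentiable_one_div_Gamma.continuous.comp (continuous_const.sub continuous_id))
  refine Tendsto.congr' ?_ (hcont.continuousAt.tendsto.mono_left nhdsWithin_le_nhds)
  have hd : HasDerivAt (fun u : ℂ => sin ((u + 1 / 2) * Real.pi))
      (cos ((s + 1 / 2) * Real.pi) * (1 * Real.pi)) s :=
    (((hasDerivAt_id s).add_const (1 / 2 : ℂ)).mul_const (Real.pi : ℂ)).csin
  have hπ : (Real.pi : ℂ) ≠ 0 := by exact_mod_cast Real.pi_ne_zero
  have hne : ∀ᶠ u in 𝓝[≠] s, sin ((u + 1 / 2) * Real.pi) ≠ 0 := by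
    by_cases h0 : sin ((s + 1 / 2) * Real.pi) = 0
    · refine hd.eventually_ne ?_
      have h1 := Complex.sin_sq_add_cos_sq ((s + 1 / 2) * Real.pi)
      have hc : cos ((s + 1 / 2) * Real.pi) ≠ 0 := by
        intro hc
        rw [h0, hc] at h1
        norm_num at h1
      exact mul_ne_zero hc (mul_ne_zero one_ne_zero hπ)
    · exact (hd.continuousAt.eventually_ne h0).filter_mono nhdsWithin_le_nhds
  filter_upwards [hne] with u hu
  refine (gamma_mul_cos u fun j hj => hu ?_).symm
  rw [hj, neg_mul, Complex.sin_neg, Complex.sin_nat_mul_pi, neg_zero]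

theorem gammaCos_eq (s : ℂ) : gammaCos s = Real.pi * (Gamma (1 / 2 - s))⁻¹ :=
  (tendsto_gammaCos s).limUnder_eq

/-- Away from the poles of the Gamma function, `gammaCos` is the literal product. -/
theorem gammaCos_eq_mul (s : ℂ) (h : ∀ j : ℕ, s + 1 / 2 ≠ -(j : ℂ)) :
    gammaCos s = Gamma (s + 1 / 2) * cos (s * Real.pi) := by
  rw [gammaCos_eq, gamma_mul_cos s h]

/-- The matrix of the Stokes-Sibuya coefficients. -/
noncomputable def stokesFormula (a₁ p : ℂ) : Matrix (Fin 2) (Fin 2) ℂ :=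
  !![-2 * I * exp (-(I * Real.pi * (a₁ / 2))) * (2 : ℂ) ^ (-a₁) *
      (gammaCos (p / 2 + a₁ / 2) / Gamma (p / 2 - a₁ / 2 + 1 / 2)),
      exp (-(I * Real.pi * a₁));
    1, 0]

/-- The explicit `0∞` connection matrix (`1 / Γ` is zero at the poles of `Γ`). -/
noncomputable def zeroInftyFormula (a₁ p : ℂ) : Matrix (Fin 2) (Fin 2) ℂ :=
  !![-I * exp (-(I * Real.pi * (p / 2))) *
        ((2 : ℂ) ^ (-a₁ / 2 + p / 2 + 1) * Gamma (-p) /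
          ((Real.sqrt 2 : ℂ) * Gamma (-p / 2 - a₁ / 2 + 1 / 2))),
      -I * exp (I * Real.pi * (p / 2)) *
        ((2 : ℂ) ^ (-a₁ / 2 - p / 2 + 1) * Gamma p /
          ((Real.sqrt 2 : ℂ) * Gamma (p / 2 - a₁ / 2 + 1 / 2)));
    (2 : ℂ) ^ (a₁ / 2 + p / 2 + 1) * Gamma (-p) /
          ((Real.sqrt 2 : ℂ) * Gamma (-p / 2 + a₁ / 2 + 1 / 2)),
      (2 : ℂ) ^ (a₁ / 2 - p / 2 + 1) * Gamma p /
          ((Real.sqrt 2 : ℂ) * Gamma (p / 2 + a₁ / 2 + 1 / 2))]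

end StokesSibuya

namespace StokesSibuya

/-! ### Power series with rapidly decreasing coefficients -/

/-! In the coordinate `t = ln x` the equation reads `F'' = F' + (x² + a₁x + a₂)F`. The Wronskian of
two solutions is a multiple of `x`, and every local solution extends to an entire function of `t`.
Two solutions that tend to zero along a common half-strip are proportional, because Cauchy's
estimate makes their derivatives, and hence the Wronskian, tend to zero as well
(`SolPair.proportional_of_recessive`). On `|arg x| < π/2` the prescribed asymptotics forces decay
and fixes the constant, so `Φ₀` is unique.

Existence is by Borel summation: `Φ₀ = x^(1 - a₁/2) e^(-x) ∫ e^(-xs) G(s) ds` along a ray from `0`.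
The equation for `Φ₀` becomes `s(s+2)G'' + (2s + 2 + a₁s)G' + (a₁²/4 + a₁/2 - a₂)G = 0`, which is
hypergeometric with singular points `0, -2, ∞`; `G` is its solution analytic at `0` with `G(0) = 1`.
The plane cut along `(-∞, -2]` is mapped to the unit disc by `w = (q - 1)/(q + 1)`, `q = √(1 +
s/2)`. In `w` the coefficients of `G` are polynomials in the parameters, bounded by binomial
coefficients, so `G` grows polynomially in every sector that avoids the cut, locally uniformly in
the parameters. Turning the ray through `|arg s| < π` covers `|arg x| < 3π/2`, and Watson's lemma
gives the expansion (`isPhi0_subdominant`).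

For the connection with the origin put `a₂ = (p² - 1)/4`. When `re p` is large, Euler's integral
`x^((1+p)/2) e^(-x) ∫ e^(-xr) r^(α-1) (2+r)^(-β) dr`, with `α, β = (1 ± p + a₁)/2`, is another
recessive solution, hence a multiple of `Φ₀`. Its behaviour at infinity gives the multiple, and its
behaviour at `0` gives the coefficient of `x^((1-p)/2)` (`subdominant_eq_of_large`). Analytic
continuation in `p` over the connected set `ℂ ∖ ℤ` removes the restriction
(`subdominant_monodromy`), and the symmetry `p ↦ -p` gives the other coefficient
(`subdominant_eq_frob`). The substitution `x ↦ -x`, `a₁ ↦ -a₁` multiplies Frobenius solutions by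
constants, which yields `M₀`.

In the Frobenius basis the Stokes relation is Euler's reflection formula for `Γ`
(`connCoeff_stokes`). Both of its sides are entire in `p` because `1/Γ` is entire, so it persists at
integers `p` (`stokes_relation`). The two matrices are unique because the solutions paired with them
are linearly independent. -/

/-- The sum of the power series with coefficients `b`. -/
noncomputable def psum (b : ℕ → ℂ) (w : ℂ) : ℂ := ∑' n, b n * w ^ n

/-- The power series with coefficients `b` converges absolutely on the disc of radius `R`. -/
def ConvOn (b : ℕ → ℂ) (R : ℝ) : Prop := ∀ r : ℝ, 0 ≤ r → r < R → Summable fun n => ‖b n‖ * r ^ n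

theorem ConvOn.summable_norm {b : ℕ → ℂ} {R : ℝ} (h : ConvOn b R) {w : ℂ} (hw : ‖w‖ < R) :
    Summable fun n => ‖b n * w ^ n‖ := by
  simpa [norm_mul, norm_pow] using h ‖w‖ (norm_nonneg _) hw

theorem ConvOn.summable {b : ℕ → ℂ} {R : ℝ} (h : ConvOn b R) {w : ℂ} (hw : ‖w‖ < R) :
    Summable fun n => b n * w ^ n := (h.summable_norm hw).of_norm

theorem ConvOn.hasSum_deriv {b : ℕ → ℂ} {R : ℝ} (h : ConvOn b R) {w : ℂ} (hw : ‖w‖ < R) :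
    DifferentiableAt ℂ (psum b) w ∧
      HasSum (fun n => b n * (n * w ^ (n - 1))) (deriv (psum b) w) := by
  obtain ⟨r, hr1, hr2⟩ := exists_between hw
  have hr0 : 0 ≤ r := (norm_nonneg w).trans hr1.le
  have hU : IsOpen (Metric.ball (0 : ℂ) r) := Metric.isOpen_ball
  have hwU : w ∈ Metric.ball (0 : ℂ) r := by simpa using hr1
  have hF : ∀ n : ℕ, DifferentiableOn ℂ (fun z : ℂ => b n * z ^ n) (Metric.ball 0 r) :=
    fun n => by fun_prop
  have hle : ∀ (n : ℕ) (z : ℂ), z ∈ Metric.ball (0 : ℂ) r → ‖b n * z ^ n‖ ≤ ‖b n‖ * r ^ n := by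
    intro n z hz
    rw [norm_mul, norm_pow]
    have : ‖z‖ ≤ r := by simpa using (Metric.mem_ball.mp hz).le
    gcongr
  refine ⟨(differentiableOn_tsum_of_summable_norm (h r hr0 hr2) hF hU hle).differentiableAt
    (hU.mem_nhds hwU), ?_⟩
  have := hasSum_deriv_of_summable_norm (h r hr0 hr2) hF hU hle hwU
  refine this.congr_fun fun n => ?_
  exact (((hasDerivAt_pow n w).const_mul (b n)).deriv).symm

theorem ConvOn.nat_mul {b : ℕ → ℂ} {R : ℝ} (h : ConvOn b R) : ConvOn (fun n => n * b n) R := by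
  intro r hr0 hr
  obtain ⟨s, hs1, hs2⟩ := exists_between hr
  have hs0 : 0 < s := hr0.trans_lt hs1
  have hq : Tendsto (fun n : ℕ => (n : ℝ) * (r / s) ^ n) atTop (𝓝 0) :=
    tendsto_self_mul_const_pow_of_lt_one (by positivity) ((div_lt_one hs0).2 hs1)
  obtain ⟨C, hC⟩ := hq.bddAbove_range
  refine Summable.of_nonneg_of_le (fun n => by positivity) (fun n => ?_)
    ((h s hs0.le hs2).mul_left C)
  have h1 : (n : ℝ) * (r / s) ^ n ≤ C := hC ⟨n, rfl⟩
  have h2 : r ^ n = (r / s) ^ n * s ^ n := by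
    rw [← mul_pow, div_mul_cancel₀ _ hs0.ne']
  calc ‖(n : ℂ) * b n‖ * r ^ n = ((n : ℝ) * (r / s) ^ n) * (‖b n‖ * s ^ n) := by
        rw [norm_mul, h2]; simp; ring
    _ ≤ C * (‖b n‖ * s ^ n) := by gcongr

/-- The Euler derivative of a power series multiplies the coefficients by their index. -/
theorem ConvOn.mul_deriv {b : ℕ → ℂ} {R : ℝ} (h : ConvOn b R) {w : ℂ} (hw : ‖w‖ < R) :
    w * deriv (psum b) w = psum (fun n => n * b n) w := by
  have h1 := ((h.hasSum_deriv hw).2.mul_left w).tsum_eq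
  rw [← h1, psum]
  congr 1
  ext n
  rcases n with _ | n
  · simp
  · rw [Nat.add_sub_cancel, pow_succ]; push_cast; ring

theorem ConvOn.shift {b : ℕ → ℂ} {R : ℝ} (h : ConvOn b R) :
    ConvOn (fun n => (n + 1) * b (n + 1)) R := by
  intro r hr0 hr
  obtain ⟨s, hs1, hs2⟩ := exists_between hr
  have hs0 : 0 < s := hr0.trans_lt hs1
  have h1 := (summable_nat_add_iff 1).2 (h.nat_mul s hs0.le hs2)
  refine Summable.of_nonneg_of_le (fun n => by positivity) (fun n => ?_) (h1.mul_left s⁻¹)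
  have : s⁻¹ * (‖((n + 1 : ℕ) : ℂ) * b (n + 1)‖ * s ^ (n + 1)) =
      ‖((n + 1 : ℕ) : ℂ) * b (n + 1)‖ * s ^ n := by
    rw [pow_succ]; field_simp
  rw [this]
  push_cast
  gcongr

theorem ConvOn.hasDerivAt {b : ℕ → ℂ} {R : ℝ} (h : ConvOn b R) {w : ℂ} (hw : ‖w‖ < R) :
    HasDerivAt (psum b) (psum (fun n => (n + 1) * b (n + 1)) w) w := by
  obtain ⟨h1, h2⟩ := h.hasSum_deriv hw
  have h3 := (hasSum_nat_add_iff' 1).2 h2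
  simp only [Finset.range_one, Finset.sum_singleton, Nat.cast_zero, zero_mul, mul_zero,
    sub_zero, Nat.add_sub_cancel] at h3
  have : psum (fun n => (n + 1) * b (n + 1)) w = deriv (psum b) w := by
    rw [← h3.tsum_eq, psum]
    congr 1
    ext n
    push_cast
    ring
  rw [this]
  exact h1.hasDerivAt

theorem psum_zero (b : ℕ → ℂ) : psum b 0 = b 0 := by
  rw [psum, tsum_eq_single 0]
  · simp
  · intro n hn; simp [hn]

/-- A sequence whose terms are at most `c / n` times the maximum of the preceding ones is
bounded by an explicit constant. -/
theorem le_of_recursive_bound {x : ℕ → ℝ} {c D : ℝ} (hc : 1 ≤ c) (hD : 0 ≤ D) (h0 : x 0 ≤ D)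
    (h : ∀ n : ℕ, 1 ≤ n → ∀ B, D ≤ B → (∀ k < n, x k ≤ B) → x n ≤ c / n * B) (n : ℕ) :
    x n ≤ c ^ ⌈c⌉₊ * D := by
  -- The factor `c / n` can exceed `1` only for `n < c`, so the exponent stops growing at `⌈c⌉₊`.
  have key : ∀ n : ℕ, x n ≤ c ^ (min n ⌈c⌉₊) * D := by
    intro n
    induction n using Nat.strong_induction_on with
    | _ n ih =>
      rcases Nat.eq_zero_or_pos n with rfl | hn
      · simpa using h0
      have hn' : (0 : ℝ) < n := by exact_mod_cast hn
      rcases le_or_gt n ⌈c⌉₊ with hle | hlt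
      · have hB := h n hn (c ^ (n - 1) * D) (le_mul_of_one_le_left hD (one_le_pow₀ hc)) (by
          intro k hk
          refine (ih k hk).trans ?_
          gcongr
          exact (min_le_left _ _).trans (Nat.le_sub_one_of_lt hk))
        refine hB.trans ?_
        rw [min_eq_left hle]
        obtain ⟨m, rfl⟩ : ∃ m, n = m + 1 := ⟨n - 1, by omega⟩
        rw [Nat.add_sub_cancel, pow_succ]
        have : c / ((m + 1 : ℕ) : ℝ) ≤ c := div_le_self (by linarith) (by push_cast; linarith [m.cast_nonneg (α := ℝ)])
        calc c / ((m + 1 : ℕ) : ℝ) * (c ^ m * D) ≤ c * (c ^ m * D) := by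
              apply mul_le_mul_of_nonneg_right this
              have := one_le_pow₀ (n := m) hc
              positivity
          _ = c ^ m * c * D := by ring
      · have hB := h n hn (c ^ ⌈c⌉₊ * D) (le_mul_of_one_le_left hD (one_le_pow₀ hc)) (by
          intro k hk
          refine (ih k hk).trans ?_
          gcongr
          exact min_le_right _ _)
        refine hB.trans ?_
        rw [min_eq_right hlt.le]
        refine mul_le_of_le_one_left (by have := one_le_pow₀ (n := ⌈c⌉₊) hc; positivity) ?_
        rw [div_le_one hn']
        exact (Nat.le_ceil c).trans (by exact_mod_cast hlt.le)
  refine (key n).trans ?_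
  gcongr
  exact min_le_right _ _

theorem convOn_of_bounded {b : ℕ → ℂ} {R : ℝ}
    (h : ∀ r : ℝ, 0 < r → r < R → ∃ M, ∀ n, ‖b n‖ * r ^ n ≤ M) : ConvOn b R := by
  intro r hr0 hr
  obtain ⟨s, hs1, hs2⟩ := exists_between hr
  have hs0 : 0 < s := hr0.trans_lt hs1
  obtain ⟨M, hM⟩ := h s hs0 hs2
  refine Summable.of_nonneg_of_le (fun n => by positivity) (fun n => ?_)
    ((summable_geometric_of_lt_one (div_nonneg hr0 hs0.le) ((div_lt_one hs0).2 hs1)).mul_left M)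
  have h2 : r ^ n = (r / s) ^ n * s ^ n := by
    rw [← mul_pow, div_mul_cancel₀ _ hs0.ne']
  calc ‖b n‖ * r ^ n = (‖b n‖ * s ^ n) * (r / s) ^ n := by rw [h2]; ring
    _ ≤ M * (r / s) ^ n := by gcongr; exact hM n

/-! ### The equation in the coordinate `t` -/

/-- The coefficient of the equation `F'' = F' + pot a t * F` in the coordinate `t = ln x`. -/
noncomputable def pot (a : Fin 2 → ℂ) (t : ℂ) : ℂ := exp t ^ 2 + a 0 * exp t + a 1

/-- `F` solves the equation on `Ω`, and `F'` is its derivative with respect to `t`. -/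
structure SolPair (a : Fin 2 → ℂ) (Ω : Set ℂ) (F F' : ℂ → ℂ) : Prop where
  fst : ∀ t ∈ Ω, HasDerivAt F (F' t) t
  snd : ∀ t ∈ Ω, HasDerivAt F' (F' t + pot a t * F t) t

/-- Since `d/dx = x⁻¹ d/dt`, the operator `x² d²/dx²` is `d²/dt² - d/dt`. -/
theorem isSolution_iff (a : Fin 2 → ℂ) (F : ℂ → ℂ) :
    IsSolution a F ↔ SolPair a Set.univ F (deriv F) := by
  have key : ∀ t, Differentiable ℂ F → ddx (ddx F) t =
      exp (-t) * (exp (-t) * deriv (deriv F) t - exp (-t) * deriv F t) := by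
    intro t hF
    have hF' : DifferentiableAt ℂ (deriv F) t :=
      (hF.differentiableOn.deriv isOpen_univ).differentiableAt univ_mem
    have h1 : HasDerivAt (fun s : ℂ => exp (-s)) (exp (-t) * (-1)) t :=
      ((hasDerivAt_id t).neg).cexp
    have := (h1.mul hF'.hasDerivAt).deriv
    have e : ddx F = (fun s : ℂ => exp (-s)) * deriv F := rfl
    rw [ddx, e, this]
    ring
  have hx : ∀ t, exp (-t) * exp t = 1 := fun t => by rw [← exp_add]; simp
  constructor
  · rintro ⟨hF, h⟩
    refine ⟨fun t _ => (hF t).hasDerivAt, fun t _ => ?_⟩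
    have hF' : DifferentiableAt ℂ (deriv F) t :=
      (hF.differentiableOn.deriv isOpen_univ).differentiableAt univ_mem
    have h1 := h t
    rw [key t hF] at h1
    have h2 : deriv (deriv F) t = deriv F t + pot a t * F t := by
      have h3 : exp t ^ 2 * (exp (-t) * (exp (-t) * deriv (deriv F) t - exp (-t) * deriv F t)) =
          pot a t * F t := by
        rw [h1, pot]
        field_simp
      have h4 : exp t ^ 2 * (exp (-t) * (exp (-t) * deriv (deriv F) t - exp (-t) * deriv F t)) =
          (exp (-t) * exp t) ^ 2 * (deriv (deriv F) t - deriv F t) := by ring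
      rw [h4, hx] at h3
      linear_combination h3
    rw [← h2]
    exact hF'.hasDerivAt
  · rintro ⟨h1, h2⟩
    have hF : Differentiable ℂ F := fun t => (h1 t trivial).differentiableAt
    refine ⟨hF, fun t => ?_⟩
    rw [key t hF, (h2 t trivial).deriv, eq_comm, div_mul_eq_mul_div, div_eq_iff (by simp)]
    change pot a t * F t = _
    linear_combination (-(exp (-t) * exp t) - 1) * (pot a t * F t) * hx t

theorem SolPair.mono {a : Fin 2 → ℂ} {Ω Ω' : Set ℂ} {F F' : ℂ → ℂ} (h : SolPair a Ω F F')
    (hΩ : Ω' ⊆ Ω) : SolPair a Ω' F F' :=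
  ⟨fun t ht => h.fst t (hΩ ht), fun t ht => h.snd t (hΩ ht)⟩

theorem SolPair.deriv_eq {a : Fin 2 → ℂ} {F F' : ℂ → ℂ} (h : SolPair a Set.univ F F') :
    F' = deriv F := funext fun t => (h.fst t trivial).deriv.symm

theorem SolPair.isSolution {a : Fin 2 → ℂ} {F F' : ℂ → ℂ} (h : SolPair a Set.univ F F') :
    IsSolution a F := (isSolution_iff a F).2 (h.deriv_eq ▸ h)

theorem SolPair.lin {a : Fin 2 → ℂ} {Ω : Set ℂ} {F F' G G' : ℂ → ℂ} (hF : SolPair a Ω F F')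
    (hG : SolPair a Ω G G') (c d : ℂ) :
    SolPair a Ω (fun t => c * F t + d * G t) (fun t => c * F' t + d * G' t) := by
  refine ⟨fun t ht => ((hF.fst t ht).const_mul c).add ((hG.fst t ht).const_mul d), fun t ht => ?_⟩
  exact (((hF.snd t ht).const_mul c).add ((hG.snd t ht).const_mul d)).congr_deriv (by ring)

/-- The Wronskian of two solutions is a constant multiple of `exp t`. -/
theorem SolPair.wronskian {a : Fin 2 → ℂ} {Ω : Set ℂ} {F F' G G' : ℂ → ℂ} (hF : SolPair a Ω F F')
    (hG : SolPair a Ω G G') (hΩ : IsOpen Ω) (hc : IsPreconnected Ω) :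
    ∃ c, ∀ t ∈ Ω, F t * G' t - F' t * G t = c * exp t := by
  -- Abel's identity: the coefficient of `F'` is `1`, so `W' = W` and `W e^(-t)` is constant.
  have hd : ∀ t ∈ Ω, HasDerivAt (fun s => (F s * G' s - F' s * G s) * exp (-s)) 0 t := by
    intro t ht
    have h1 : HasDerivAt (fun s : ℂ => exp (-s)) (exp (-t) * (-1)) t :=
      ((hasDerivAt_id t).neg).cexp
    refine ((((hF.fst t ht).mul (hG.snd t ht)).sub
      ((hF.snd t ht).mul (hG.fst t ht))).mul h1).congr_deriv ?_
    simp only [Pi.mul_apply, Pi.sub_apply]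
    ring
  obtain ⟨c, hcst⟩ := hΩ.exists_is_const_of_deriv_eq_zero hc
    (fun t ht => (hd t ht).differentiableAt.differentiableWithinAt) (fun t ht => (hd t ht).deriv)
  refine ⟨c, fun t ht => ?_⟩
  rw [← hcst t ht, mul_assoc, ← exp_add]
  simp

/-- A solution on an open preconnected set is a linear combination of any two solutions whose
Wronskian does not vanish. -/
theorem SolPair.eq_lin {a : Fin 2 → ℂ} {Ω : Set ℂ} {F F' G G' H H' : ℂ → ℂ} {w : ℂ} (hw : w ≠ 0)
    (hG : SolPair a Ω G G') (hH : SolPair a Ω H H')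
    (hW : ∀ t ∈ Ω, G t * H' t - G' t * H t = w * exp t)
    (hF : SolPair a Ω F F') (hΩ : IsOpen Ω) (hc : IsPreconnected Ω) :
    ∃ c d, ∀ t ∈ Ω, F t = c * G t + d * H t ∧ F' t = c * G' t + d * H' t := by
  obtain ⟨c, h1⟩ := hF.wronskian hH hΩ hc
  obtain ⟨d, h2⟩ := hG.wronskian hF hΩ hc
  refine ⟨c / w, d / w, fun t ht => ⟨?_, ?_⟩⟩
  · have : F t * (w * exp t) = (c * G t + d * H t) * exp t := by
      linear_combination (-F t) * hW t ht + G t * h1 t ht + H t * h2 t ht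
    have h3 : F t * w = c * G t + d * H t :=
      mul_right_cancel₀ (exp_ne_zero t) (by linear_combination this)
    field_simp
    linear_combination h3
  · have : F' t * (w * exp t) = (c * G' t + d * H' t) * exp t := by
      linear_combination (-F' t) * hW t ht + G' t * h1 t ht + H' t * h2 t ht
    have h3 : F' t * w = c * G' t + d * H' t :=
      mul_right_cancel₀ (exp_ne_zero t) (by linear_combination this)
    field_simp
    linear_combination h3

end StokesSibuya

namespace StokesSibuya

/-! ### Entire solutions by Taylor series -/

/-- Cauchy product of two power series. -/
theorem ConvOn.psum_mul {b c : ℕ → ℂ} {R : ℝ} (hb : ConvOn b R) (hc : ConvOn c R) {w : ℂ}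
    (hw : ‖w‖ < R) :
    psum b w * psum c w = psum (fun n => ∑ k ∈ Finset.range (n + 1), b k * c (n - k)) w := by
  rw [psum, psum, tsum_mul_tsum_eq_tsum_sum_range_of_summable_norm (hb.summable_norm hw)
    (hc.summable_norm hw), psum]
  congr 1
  ext n
  rw [Finset.sum_mul]
  refine Finset.sum_congr rfl fun k hk => ?_
  have hk' : k + (n - k) = n := by have := Finset.mem_range.mp hk; omega
  calc b k * w ^ k * (c (n - k) * w ^ (n - k)) = b k * c (n - k) * w ^ (k + (n - k)) := by
        rw [pow_add]; ring
    _ = _ := by rw [hk']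

/-- The Taylor coefficients of `pot a` at the origin. -/
noncomputable def potCoeff (a : Fin 2 → ℂ) (k : ℕ) : ℂ :=
  (2 ^ k + a 0) / (k.factorial : ℂ) + if k = 0 then a 1 else 0

theorem hasSum_pot (a : Fin 2 → ℂ) (t : ℂ) : HasSum (fun k => potCoeff a k * t ^ k) (pot a t) := by
  have hexp : ∀ z : ℂ, HasSum (fun k : ℕ => z ^ k / (k.factorial : ℂ)) (exp z) := fun z => by
    have := NormedSpace.expSeries_div_hasSum_exp z
    rwa [← Complex.exp_eq_exp_ℂ] at this
  have h3 : HasSum (fun k : ℕ => (if k = 0 then a 1 else 0) * t ^ k) (a 1) := by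
    convert hasSum_ite_eq (0 : ℕ) (a 1) using 2 with k
    by_cases hk : k = 0 <;> simp [hk]
  have := ((hexp (2 * t)).add ((hexp t).mul_left (a 0))).add h3
  have e : exp (2 * t) + a 0 * exp t + a 1 = pot a t := by
    rw [pot, ← exp_nat_mul]; norm_num
  rw [e] at this
  refine this.congr_fun fun k => ?_
  rw [potCoeff, mul_pow]
  ring

theorem convOn_potCoeff (a : Fin 2 → ℂ) (R : ℝ) : ConvOn (potCoeff a) R := by
  intro r hr _
  have := (hasSum_pot a r).summable.norm
  simpa [norm_mul, norm_pow, abs_of_nonneg hr] using this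

/-- The Taylor coefficients at the origin of the solution with given initial values. -/
noncomputable def odeCoeff (a : Fin 2 → ℂ) (u v : ℂ) : ℕ → ℂ
  | 0 => u
  | 1 => v
  | n + 2 => ((n + 1) * odeCoeff a u v (n + 1) +
      ∑ k : Fin (n + 1), odeCoeff a u v k * potCoeff a (n - k)) / ((n + 2) * (n + 1))
  decreasing_by
  all_goals omega

theorem odeCoeff_add_two (a : Fin 2 → ℂ) (u v : ℂ) (n : ℕ) :
    ((n : ℂ) + 1) * ((n + 1 + 1) * odeCoeff a u v (n + 2)) = (n + 1) * odeCoeff a u v (n + 1) +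
      ∑ k ∈ Finset.range (n + 1), odeCoeff a u v k * potCoeff a (n - k) := by
  rw [odeCoeff, Finset.sum_range]
  have h1 : (n : ℂ) + 1 ≠ 0 := by exact_mod_cast n.succ_ne_zero
  have h2 : (n : ℂ) + 2 ≠ 0 := by exact_mod_cast (n + 1).succ_ne_zero
  field_simp
  ring

/-- After weighting by `r ^ n`, the recursion bounds each coefficient by `(1 + r + S r²) / n` times
the maximum of the earlier ones, where `S` is the sum of the weighted coefficients of the potential.
The summand `1` only ensures that the constant is at least `1`. -/
theorem convOn_odeCoeff (a : Fin 2 → ℂ) (u v : ℂ) (R : ℝ) : ConvOn (odeCoeff a u v) R := by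
  refine convOn_of_bounded fun r hr0 _ => ?_
  have hq := convOn_potCoeff a (r + 1) r hr0.le (by linarith)
  set S := ∑' k, ‖potCoeff a k‖ * r ^ k with hS
  have hS0 : 0 ≤ S := tsum_nonneg fun k => by positivity
  have hc : 1 ≤ 1 + r + S * r ^ 2 := by nlinarith [mul_nonneg hS0 (sq_nonneg r)]
  refine ⟨_, le_of_recursive_bound (x := fun n => ‖odeCoeff a u v n‖ * r ^ n) hc
    (D := ‖u‖ + ‖v‖ * r) (by positivity) ?_ ?_⟩
  · simp [odeCoeff]
    positivity
  · intro n hn B hDB hB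
    have hB0 : 0 ≤ B := le_trans (by positivity) hDB
    match n, hn, hB with
    | 1, _, _ =>
      simp only [odeCoeff, pow_one, Nat.cast_one, div_one]
      have : ‖v‖ * r ≤ B := le_trans (by linarith [norm_nonneg u]) hDB
      nlinarith
    | n + 2, _, hB =>
      have hn1 : (0 : ℝ) < (n : ℝ) + 1 := by positivity
      have hn2 : (0 : ℝ) < (n : ℝ) + 2 := by positivity
      have hrec := congrArg norm (odeCoeff_add_two a u v n)
      have h1 : ‖((n : ℂ) + 1) * ((n + 1 + 1) * odeCoeff a u v (n + 2))‖ =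
          ((n : ℝ) + 1) * ((n + 2) * ‖odeCoeff a u v (n + 2)‖) := by
        rw [norm_mul, norm_mul]
        congr 2
        · exact_mod_cast Complex.norm_natCast (n + 1)
        · exact_mod_cast Complex.norm_natCast (n + 2)
      have h2 : ‖((n : ℂ) + 1) * odeCoeff a u v (n + 1)‖ =
          ((n : ℝ) + 1) * ‖odeCoeff a u v (n + 1)‖ := by
        rw [norm_mul]
        congr 1
        exact_mod_cast Complex.norm_natCast (n + 1)
      have h3 : (∑ k ∈ Finset.range (n + 1), ‖odeCoeff a u v k * potCoeff a (n - k)‖) * r ^ n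
          ≤ B * S := by
        have hterm : ∀ k ∈ Finset.range (n + 1), ‖odeCoeff a u v k * potCoeff a (n - k)‖ * r ^ n
            ≤ B * (‖potCoeff a (n - k)‖ * r ^ (n - k)) := by
          intro k hk
          have hk' : k + (n - k) = n := by have := Finset.mem_range.mp hk; omega
          have hkB := hB k (by omega)
          calc ‖odeCoeff a u v k * potCoeff a (n - k)‖ * r ^ n
              = (‖odeCoeff a u v k‖ * r ^ k) * (‖potCoeff a (n - k)‖ * r ^ (n - k)) := by
                rw [norm_mul, ← hk', pow_add, Nat.add_sub_cancel_left]; ring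
            _ ≤ _ := by gcongr
        rw [Finset.sum_mul]
        refine (Finset.sum_le_sum hterm).trans ?_
        have hrefl := Finset.sum_range_reflect (fun k => ‖potCoeff a k‖ * r ^ k) (n + 1)
        simp only [Nat.add_sub_cancel] at hrefl
        rw [← Finset.mul_sum, hrefl]
        gcongr
        exact hq.sum_le_tsum _ fun k _ => by positivity
      have h4 : ((n : ℝ) + 1) * ((n + 2) * (‖odeCoeff a u v (n + 2)‖ * r ^ (n + 2))) ≤
          ((n : ℝ) + 1) * B * r + B * S * r ^ 2 := by
        have h5 := norm_add_le (((n : ℂ) + 1) * odeCoeff a u v (n + 1))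
          (∑ k ∈ Finset.range (n + 1), odeCoeff a u v k * potCoeff a (n - k))
        rw [← hrec, h1, h2] at h5
        have h6 := norm_sum_le (Finset.range (n + 1))
          (fun k => odeCoeff a u v k * potCoeff a (n - k))
        have h7 := hB (n + 1) (by omega)
        calc ((n : ℝ) + 1) * ((n + 2) * (‖odeCoeff a u v (n + 2)‖ * r ^ (n + 2)))
            = ((n : ℝ) + 1) * ((n + 2) * ‖odeCoeff a u v (n + 2)‖) * (r ^ n * r ^ 2) := by
              rw [pow_add]; ring
          _ ≤ (((n : ℝ) + 1) * ‖odeCoeff a u v (n + 1)‖ +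
              ∑ k ∈ Finset.range (n + 1), ‖odeCoeff a u v k * potCoeff a (n - k)‖) *
              (r ^ n * r ^ 2) := by
              gcongr
              linarith
          _ = ((n : ℝ) + 1) * (‖odeCoeff a u v (n + 1)‖ * r ^ (n + 1)) * r +
              ((∑ k ∈ Finset.range (n + 1), ‖odeCoeff a u v k * potCoeff a (n - k)‖) * r ^ n) *
              r ^ 2 := by rw [pow_succ]; ring
          _ ≤ _ := by gcongr
      have h8 : ((n : ℝ) + 1) * B * r + B * S * r ^ 2 ≤ ((n : ℝ) + 1) * ((1 + r + S * r ^ 2) * B) := by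
        have hn0 : (0 : ℝ) ≤ n := n.cast_nonneg
        have e1 : 0 ≤ B * S * r ^ 2 := by positivity
        nlinarith [mul_nonneg hn0 e1, mul_nonneg hn0 hB0]
      have h9 := le_of_mul_le_mul_left (h4.trans h8) hn1
      push_cast
      rw [div_mul_eq_mul_div, le_div_iff₀ hn2]
      linarith

/-- Existence of entire solutions with prescribed initial values. -/
theorem exists_solPair (a : Fin 2 → ℂ) (u v : ℂ) :
    ∃ F F', SolPair a Set.univ F F' ∧ F 0 = u ∧ F' 0 = v := by
  set f := odeCoeff a u v with hf
  have hR : ∀ R, ConvOn f R := convOn_odeCoeff a u v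
  refine ⟨psum f, psum fun n => (n + 1) * f (n + 1), ⟨fun t _ => ?_, fun t _ => ?_⟩, ?_, ?_⟩
  · exact (hR (‖t‖ + 1)).hasDerivAt (lt_add_one _)
  · have hlt : ‖t‖ < ‖t‖ + 1 := lt_add_one _
    have h1 := (hR (‖t‖ + 1)).shift
    have h2 := h1.hasDerivAt hlt
    refine h2.congr_deriv ?_
    have hp : pot a t = psum (potCoeff a) t := (hasSum_pot a t).tsum_eq.symm
    rw [hp, mul_comm, (hR _).psum_mul (convOn_potCoeff a _) hlt, psum, psum, psum,
      ← (h1.summable hlt).tsum_add]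
    · congr 1
      ext n
      have := odeCoeff_add_two a u v n
      rw [← hf] at this
      rw [← add_mul, ← this]
      push_cast
      ring_nf
    · have h3 := hasSum_sum_range_mul_of_summable_norm ((hR _).summable_norm hlt)
        ((convOn_potCoeff a _).summable_norm hlt)
      refine h3.summable.congr fun n => ?_
      rw [Finset.sum_mul]
      refine Finset.sum_congr rfl fun k hk => ?_
      have hk' : k + (n - k) = n := by have := Finset.mem_range.mp hk; omega
      calc f k * t ^ k * (potCoeff a (n - k) * t ^ (n - k))
          = f k * potCoeff a (n - k) * t ^ (k + (n - k)) := by rw [pow_add]; ring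
        _ = _ := by rw [hk']
  · rw [psum_zero, hf, odeCoeff]
  · rw [psum_zero, hf]; simp [odeCoeff]

/-- Two entire solutions with Wronskian `exp t`. -/
theorem exists_basis (a : Fin 2 → ℂ) : ∃ E₁ E₁' E₂ E₂', SolPair a Set.univ E₁ E₁' ∧
    SolPair a Set.univ E₂ E₂' ∧ ∀ t, E₁ t * E₂' t - E₁' t * E₂ t = 1 * exp t := by
  obtain ⟨F, F', hF, hF0, hF0'⟩ := exists_solPair a 1 0
  obtain ⟨G, G', hG, hG0, hG0'⟩ := exists_solPair a 0 1
  obtain ⟨c, hc⟩ := hF.wronskian hG isOpen_univ isPreconnected_univ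
  refine ⟨F, F', G, G', hF, hG, fun t => ?_⟩
  have h0 := hc 0 trivial
  rw [hF0, hF0', hG0, hG0', exp_zero] at h0
  rw [hc t trivial]
  linear_combination (-exp t) * h0

/-- Every solution on an open preconnected set extends to an entire solution. -/
theorem SolPair.exists_extension {a : Fin 2 → ℂ} {Ω : Set ℂ} {F F' : ℂ → ℂ} (h : SolPair a Ω F F')
    (hΩ : IsOpen Ω) (hc : IsPreconnected Ω) :
    ∃ E E', SolPair a Set.univ E E' ∧ ∀ t ∈ Ω, E t = F t ∧ E' t = F' t := by
  obtain ⟨E₁, E₁', E₂, E₂', h₁, h₂, hW⟩ := exists_basis a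
  obtain ⟨c, d, hcd⟩ := SolPair.eq_lin one_ne_zero (h₁.mono (Set.subset_univ Ω))
    (h₂.mono (Set.subset_univ Ω)) (fun t _ => hW t) h hΩ hc
  exact ⟨_, _, h₁.lin h₂ c d, fun t ht => ⟨((hcd t ht).1).symm, ((hcd t ht).2).symm⟩⟩

/-- Entire solutions with vanishing Wronskian are proportional. -/
theorem SolPair.proportional {a : Fin 2 → ℂ} {F F' G G' : ℂ → ℂ} (hF : SolPair a Set.univ F F')
    (hG : SolPair a Set.univ G G') (hW : ∀ t, F t * G' t - F' t * G t = 0)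
    {t₀ : ℂ} (hne : G t₀ ≠ 0) : ∃ c, ∀ t, F t = c * G t := by
  obtain ⟨E₁, E₁', E₂, E₂', h₁, h₂, hE⟩ := exists_basis a
  obtain ⟨c, hc⟩ := hG.wronskian h₁ isOpen_univ isPreconnected_univ
  obtain ⟨d, hd⟩ := hG.wronskian h₂ isOpen_univ isPreconnected_univ
  have key : ∀ {H H' : ℂ → ℂ} {w : ℂ}, SolPair a Set.univ H H' → w ≠ 0 →
      (∀ t ∈ Set.univ, G t * H' t - G' t * H t = w * exp t) → ∃ c, ∀ t, F t = c * G t := by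
    intro H H' w hH hw hWr
    obtain ⟨u, hu⟩ := hF.wronskian hH isOpen_univ isPreconnected_univ
    refine ⟨u / w, fun t => ?_⟩
    have h1 : F t * w * exp t = u * G t * exp t := by
      linear_combination G t * hu t trivial - F t * hWr t trivial - H t * hW t
    have h2 := mul_right_cancel₀ (exp_ne_zero t) h1
    field_simp
    linear_combination h2
  -- A solution whose Wronskians with both members of a basis vanish is zero, so one of the two can
  -- serve to compare `F` with `G`.
  by_cases hc0 : c = 0
  · by_cases hd0 : d = 0
    · exfalso
      apply hne
      have h1 := hc t₀ trivial
      have h2 := hd t₀ trivial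
      rw [hc0, zero_mul] at h1
      rw [hd0, zero_mul] at h2
      have h3 : G t₀ * exp t₀ = 0 := by
        linear_combination (-G t₀) * hE t₀ - E₂ t₀ * h1 + E₁ t₀ * h2
      exact (mul_eq_zero.mp h3).resolve_right (exp_ne_zero _)
    · exact key h₂ hd0 hd
  · exact key h₁ hc0 hc

/-! ### Recessive solutions in half-strips -/

/-- The part `re t → ∞` of the strip `|im t - y| ≤ δ`. -/
def stripEnd (y δ : ℝ) : Filter ℂ := comap re atTop ⊓ 𝓟 {t | |t.im - y| ≤ δ}

theorem eventually_stripEnd {y δ : ℝ} {P : ℂ → Prop} :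
    (∀ᶠ t in stripEnd y δ, P t) ↔ ∃ T : ℝ, ∀ t : ℂ, T ≤ t.re → |t.im - y| ≤ δ → P t := by
  rw [stripEnd, eventually_inf_principal, eventually_comap]
  simp only [eventually_atTop, Set.mem_ofPred_eq]
  constructor
  · rintro ⟨T, hT⟩
    exact ⟨T, fun t ht => hT t.re ht t rfl⟩
  · rintro ⟨T, hT⟩
    exact ⟨T, fun x hx t ht => hT t (ht ▸ hx)⟩

/-- Two entire solutions which tend to zero at the end of a common strip are proportional. -/
theorem SolPair.proportional_of_recessive {a : Fin 2 → ℂ} {F F' G G' : ℂ → ℂ}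
    (hF : SolPair a Set.univ F F') (hG : SolPair a Set.univ G G') {y δ : ℝ} (hδ : 0 < δ)
    (hF0 : Tendsto F (stripEnd y δ) (𝓝 0)) (hG0 : Tendsto G (stripEnd y δ) (𝓝 0))
    {t₀ : ℂ} (hne : G t₀ ≠ 0) : ∃ c, ∀ t, F t = c * G t := by
  have hline : Tendsto (fun x : ℝ => (x : ℂ) + y * I) atTop (stripEnd y δ) := by
    refine tendsto_inf.2 ⟨tendsto_comap_iff.2 ?_, tendsto_principal.2 (Eventually.of_forall ?_)⟩
    · have e : re ∘ (fun x : ℝ => (x : ℂ) + y * I) = id := by ext x; simp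
      rw [e]
      exact tendsto_id
    · intro x; simp [hδ.le]
  -- Cauchy's estimate on discs of radius `δ` about the centre line, which stay in the strip. This
  -- is why smallness is required on a strip of positive width and not only on a line.
  have hderiv : ∀ {H H' : ℂ → ℂ}, SolPair a Set.univ H H' → Tendsto H (stripEnd y δ) (𝓝 0) →
      Tendsto (fun x : ℝ => H' (x + y * I)) atTop (𝓝 0) := by
    intro H H' hH h0
    rw [Metric.tendsto_nhds]
    intro ε hε
    obtain ⟨T, hT⟩ := eventually_stripEnd.1 ((Metric.tendsto_nhds.1 h0) (ε * δ / 2) (by positivity))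
    filter_upwards [eventually_ge_atTop (T + δ)] with x hx
    have hd : DiffContOnCl ℂ H (Metric.ball ((x : ℂ) + y * I) δ) :=
      Differentiable.diffContOnCl fun t => (hH.fst t trivial).differentiableAt
    have := Complex.norm_deriv_le_of_forall_mem_sphere_norm_le hδ hd (C := ε * δ / 2) (by
      intro z hz
      have hz' : ‖z - (x + y * I)‖ = δ := by simpa [dist_eq_norm] using hz
      have h1 := (abs_re_le_norm (z - (x + y * I))).trans hz'.le
      have h2 := (abs_im_le_norm (z - (x + y * I))).trans hz'.le
      simp at h1 h2
      have := hT z (by linarith [neg_abs_le (z.re - x)]) h2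
      simpa [dist_eq_norm] using this.le)
    rw [(hH.fst _ trivial).deriv] at this
    rw [dist_zero_right]
    refine this.trans_lt ?_
    rw [mul_div_right_comm, mul_div_cancel_right₀ _ hδ.ne']
    linarith
  obtain ⟨c, hc⟩ := hF.wronskian hG isOpen_univ isPreconnected_univ
  have hlim : Tendsto (fun x : ℝ => c * exp ((x : ℂ) + y * I)) atTop (𝓝 0) := by
    have h1 := ((hF0.comp hline).mul (hderiv hG hG0)).sub ((hderiv hF hF0).mul (hG0.comp hline))
    simp only [mul_zero, sub_zero] at h1
    refine h1.congr fun x => ?_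
    exact hc _ trivial
  have hc0 : c = 0 := by
    by_contra hne
    have h2 := hlim.norm
    rw [norm_zero] at h2
    have h3 := h2.eventually (gt_mem_nhds (norm_pos_iff.2 hne))
    obtain ⟨x, hx1, hx2⟩ := (h3.and (eventually_ge_atTop 0)).exists
    rw [norm_mul, Complex.norm_exp] at hx1
    have : 1 ≤ Real.exp ((x : ℂ) + y * I).re := Real.one_le_exp (by simpa using hx2)
    nlinarith [norm_pos_iff.2 hne]
  refine hF.proportional hG (fun t => ?_) hne
  rw [hc t trivial, hc0, zero_mul]

end StokesSibuya

namespace StokesSibuya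

/-! ### The Borel transform of the formal solution -/

/-- The polynomials `2 + 4 a₁` and `4 (a₁ ^ 2 / 4 + a₁ / 2 - a₂)`. -/
noncomputable def parA : MvPolynomial (Fin 2) ℂ := MvPolynomial.C 2 + MvPolynomial.C 4 * MvPolynomial.X 0

noncomputable def parD : MvPolynomial (Fin 2) ℂ :=
  MvPolynomial.X 0 ^ 2 + MvPolynomial.C 2 * MvPolynomial.X 0 - MvPolynomial.C 4 * MvPolynomial.X 1

/-- Coefficients of the Borel transform in the uniformizing variable of the slit plane. -/
noncomputable def borelPoly : ℕ → MvPolynomial (Fin 2) ℂ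
  | 0 => 1
  | n + 1 => MvPolynomial.C (-1 / ((n : ℂ) + 1) ^ 2) * ∑ k : Fin (n + 1),
      (MvPolynomial.C (((k : ℕ) : ℂ) * ((1 - (-1 : ℂ) ^ (n + 1 - (k : ℕ))) / 2)) * parA +
        MvPolynomial.C (((n + 1 - k : ℕ) : ℂ)) * parD) * borelPoly k

noncomputable def borelA (a : Fin 2 → ℂ) : ℂ := 2 + 4 * a 0

noncomputable def borelD (a : Fin 2 → ℂ) : ℂ := a 0 ^ 2 + 2 * a 0 - 4 * a 1

noncomputable def borelCoeff (a : Fin 2 → ℂ) (n : ℕ) : ℂ := MvPolynomial.eval a (borelPoly n)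

theorem borelCoeff_zero (a : Fin 2 → ℂ) : borelCoeff a 0 = 1 := by
  simp [borelCoeff, borelPoly]

/-- Coefficient comparison in `(w d/dw)² G = -(A w/(1-w²)) (w d/dw) G - (D w/(1-w)²) G`: the factor
`w/(1-w²)` contributes `1` at odd exponents, and `w/(1-w)²` contributes `j` at exponent `j`. -/
theorem borelCoeff_rec (a : Fin 2 → ℂ) (n : ℕ) :
    (n : ℂ) * (n * borelCoeff a n) = -∑ k ∈ Finset.range n,
      (k * borelCoeff a k * (borelA a * ((1 - (-1) ^ (n - k)) / 2)) +
        borelCoeff a k * (borelD a * (n - k : ℕ))) := by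
  rcases n with _ | n
  · simp
  · rw [borelCoeff, borelPoly, Finset.sum_range]
    have h1 : (n : ℂ) + 1 ≠ 0 := by exact_mod_cast n.succ_ne_zero
    have hA : MvPolynomial.eval a parA = borelA a := by simp [parA, borelA]
    have hD : MvPolynomial.eval a parD = borelD a := by simp [parD, borelD]
    simp only [map_mul, map_sum, map_add, MvPolynomial.eval_C, hA, hD]
    push_cast
    rw [← mul_assoc, ← mul_assoc]
    have h2 : ((n : ℂ) + 1) * (n + 1) * (-1 / ((n : ℂ) + 1) ^ 2) = -1 := by field_simp
    rw [h2, neg_one_mul]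
    congr 1
    refine Finset.sum_congr rfl fun k _ => ?_
    simp only [borelCoeff]
    ring

/-- A bound for the parameters in terms of which the Borel transform is estimated. -/
noncomputable def parSize (a : Fin 2 → ℂ) : ℝ := ‖borelA a‖ + ‖borelD a‖

theorem continuous_parSize : Continuous parSize := by
  unfold parSize borelA borelD
  fun_prop

/-- The hockey-stick identity; it makes binomial coefficients reproduce themselves in the recursion
for the Borel coefficients. -/
theorem sum_choose_range (m n : ℕ) :
    (m + 1) * ∑ k ∈ Finset.range n, ((k + m).choose m) = n * (n + m).choose m := by
  induction n with
  | zero => simp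
  | succ n ih =>
    rw [Finset.sum_range_succ, mul_add, ih]
    have h := Nat.choose_mul_succ_eq (n + m) m
    have e : n + m + 1 - m = n + 1 := by omega
    rw [e] at h
    have e2 : n + 1 + m = n + m + 1 := by omega
    rw [e2]
    linarith

/-- By induction, `n² |bₙ|` is at most `n (m+1) ∑_{k<n} C(k+m, m) = n² C(n+m, m)`. Thus `(1 -
w)^(-(m+1))` is a majorant, with `m` depending only on a bound for the parameters; this yields both
polynomial growth and local uniformity. -/
theorem norm_borelCoeff_le {a : Fin 2 → ℂ} {m : ℕ} (hm : parSize a ≤ m + 1) (n : ℕ) :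
    ‖borelCoeff a n‖ ≤ (n + m).choose m := by
  induction n using Nat.strong_induction_on with
  | _ n ih =>
    rcases Nat.eq_zero_or_pos n with rfl | hn
    · simp [borelCoeff_zero]
    have hn' : (0 : ℝ) < n := by exact_mod_cast hn
    have hterm : ∀ k ∈ Finset.range n,
        ‖(k : ℂ) * borelCoeff a k * (borelA a * ((1 - (-1) ^ (n - k)) / 2)) +
          borelCoeff a k * (borelD a * (n - k : ℕ))‖ ≤
        (n * parSize a) * ((k + m).choose m : ℕ) := by
      intro k hk
      have hk' := Finset.mem_range.mp hk
      have h1 := ih k hk'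
      have hkn : (k : ℝ) ≤ n := by exact_mod_cast hk'.le
      have hkn2 : ((n - k : ℕ) : ℝ) ≤ n := by exact_mod_cast Nat.sub_le n k
      have hhalf : ‖(1 - (-1 : ℂ) ^ (n - k)) / 2‖ ≤ 1 := by
        rw [norm_div, Complex.norm_two, div_le_one two_pos]
        refine (norm_sub_le _ _).trans ?_
        rw [norm_pow, norm_neg, norm_one, one_pow]
        norm_num
      calc _ ≤ ‖(k : ℂ) * borelCoeff a k * (borelA a * ((1 - (-1) ^ (n - k)) / 2))‖ +
            ‖borelCoeff a k * (borelD a * (n - k : ℕ))‖ := norm_add_le _ _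
        _ = (k : ℝ) * ‖borelCoeff a k‖ * (‖borelA a‖ * ‖(1 - (-1 : ℂ) ^ (n - k)) / 2‖) +
            ‖borelCoeff a k‖ * (‖borelD a‖ * (n - k : ℕ)) := by
            simp only [norm_mul, Complex.norm_natCast]
        _ ≤ (n : ℝ) * ‖borelCoeff a k‖ * (‖borelA a‖ * 1) +
            ‖borelCoeff a k‖ * (‖borelD a‖ * n) := by gcongr
        _ = (n * parSize a) * ‖borelCoeff a k‖ := by rw [parSize]; ring
        _ ≤ _ := by
            have : 0 ≤ parSize a := by unfold parSize; positivity
            gcongr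
    have h2 : (n : ℝ) * (n * ‖borelCoeff a n‖) ≤ n * (n * (n + m).choose m) := by
      calc (n : ℝ) * (n * ‖borelCoeff a n‖) = ‖(n : ℂ) * (n * borelCoeff a n)‖ := by
            simp only [norm_mul, Complex.norm_natCast]
        _ ≤ ∑ k ∈ Finset.range n, (n * parSize a) * ((k + m).choose m : ℕ) := by
            rw [borelCoeff_rec, norm_neg]
            exact (norm_sum_le _ _).trans (Finset.sum_le_sum hterm)
        _ ≤ (n * (m + 1)) * ∑ k ∈ Finset.range n, ((k + m).choose m : ℝ) := by
            rw [← Finset.mul_sum]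
            gcongr
        _ = n * (n * (n + m).choose m) := by
            have := sum_choose_range m n
            have h3 : ((m : ℝ) + 1) * ∑ k ∈ Finset.range n, ((k + m).choose m : ℝ) =
              n * (n + m).choose m := by exact_mod_cast this
            rw [mul_assoc, h3]
    exact le_of_mul_le_mul_left (le_of_mul_le_mul_left h2 hn') hn'

theorem exists_parSize_le (a : Fin 2 → ℂ) : ∃ m : ℕ, parSize a ≤ m + 1 := by
  obtain ⟨m, hm⟩ := exists_nat_ge (parSize a)
  exact ⟨m, by linarith⟩

theorem summable_choose_mul_pow (m : ℕ) {r : ℝ} (h0 : 0 ≤ r) (h1 : r < 1) :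
    Summable fun n : ℕ => ((n + m).choose m : ℝ) * r ^ n :=
  summable_choose_mul_geometric_of_norm_lt_one m (by rwa [Real.norm_of_nonneg h0])

theorem tsum_choose_mul_pow (m : ℕ) {r : ℝ} (h0 : 0 ≤ r) (h1 : r < 1) :
    ∑' n : ℕ, ((n + m).choose m : ℝ) * r ^ n = ((1 - r) ^ (m + 1))⁻¹ := by
  rw [tsum_choose_mul_geometric_of_norm_lt_one m (by rwa [Real.norm_of_nonneg h0]), one_div]

theorem convOn_borelCoeff (a : Fin 2 → ℂ) : ConvOn (borelCoeff a) 1 := by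
  obtain ⟨m, hm⟩ := exists_parSize_le a
  intro r hr0 hr1
  refine Summable.of_nonneg_of_le (fun n => by positivity) (fun n => ?_)
    (summable_choose_mul_pow m hr0 hr1)
  gcongr
  exact norm_borelCoeff_le hm n

theorem norm_psum_le {b : ℕ → ℂ} {m : ℕ} {C : ℝ} (hb : ∀ n, ‖b n‖ ≤ C * (n + m).choose m) {w : ℂ}
    (hw : ‖w‖ < 1) : ‖psum b w‖ ≤ C * ((1 - ‖w‖) ^ (m + 1))⁻¹ := by
  rw [← tsum_choose_mul_pow m (norm_nonneg w) hw, ← tsum_mul_left]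
  refine tsum_of_norm_bounded ((summable_choose_mul_pow m (norm_nonneg w) hw).mul_left C).hasSum ?_
  intro n
  rw [norm_mul, norm_pow, ← mul_assoc]
  gcongr
  exact hb n

theorem norm_nat_mul_borelCoeff_le {a : Fin 2 → ℂ} {m : ℕ} (hm : parSize a ≤ m + 1) (n : ℕ) :
    ‖(n : ℂ) * borelCoeff a n‖ ≤ (m + 1) * (n + (m + 1)).choose (m + 1) := by
  rw [norm_mul, Complex.norm_natCast]
  have h1 := Nat.add_one_mul_choose_eq (n + m) m
  have h2 : ((n + m + 1 : ℕ) : ℝ) * (n + m).choose m = (n + m + 1).choose (m + 1) * (m + 1) := by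
    exact_mod_cast h1
  calc (n : ℝ) * ‖borelCoeff a n‖ ≤ (n + m + 1 : ℕ) * (n + m).choose m := by
        gcongr
        · omega
        · exact norm_borelCoeff_le hm n
    _ = _ := by rw [h2, mul_comm]; rfl

/-- The differential equation of the Borel transform in the uniformizing variable. -/
theorem borel_ode (a : Fin 2 → ℂ) {w : ℂ} (hw : ‖w‖ < 1) :
    w * deriv (psum fun n => n * borelCoeff a n) w =
      -(borelA a * (w / (1 - w ^ 2)) * psum (fun n => n * borelCoeff a n) w +
        borelD a * (w / (1 - w) ^ 2) * psum (borelCoeff a) w) := by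
  have hb := convOn_borelCoeff a
  -- `c` and `d` are the Taylor coefficients of the two rational functions in the equation, so that
  -- the products become Cauchy products.
  set c : ℕ → ℂ := fun j => borelA a * ((1 - (-1) ^ j) / 2) with hc
  set d : ℕ → ℂ := fun j => borelD a * j with hd
  have hne1 : 1 - w ≠ 0 := fun h => by
    have : w = 1 := (sub_eq_zero.mp h).symm
    simp [this] at hw
  have hne2 : 1 + w ≠ 0 := fun h => by
    have : w = -1 := by linear_combination h
    simp [this] at hw
  have hC : ConvOn c 1 := by
    intro r hr0 hr1
    refine Summable.of_nonneg_of_le (fun n => by positivity) (fun n => ?_)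
      ((summable_geometric_of_lt_one hr0 hr1).mul_left ‖borelA a‖)
    have hhalf : ‖(1 - (-1 : ℂ) ^ n) / 2‖ ≤ 1 := by
      rw [norm_div, Complex.norm_two, div_le_one two_pos]
      refine (norm_sub_le _ _).trans ?_
      rw [norm_pow, norm_neg, norm_one, one_pow]
      norm_num
    rw [hc, norm_mul]
    gcongr
    exact mul_le_of_le_one_right (norm_nonneg _) hhalf
  have hD : ConvOn d 1 := by
    have h1 : ConvOn (fun _ => borelD a) 1 := fun r hr0 hr1 =>
      (summable_geometric_of_lt_one hr0 hr1).mul_left _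
    have := h1.nat_mul
    simpa [hd, mul_comm] using this
  have hcs : psum c w = borelA a * (w / (1 - w ^ 2)) := by
    have h1 := hasSum_geometric_of_norm_lt_one hw
    have h2 := hasSum_geometric_of_norm_lt_one (ξ := -w) (by rwa [norm_neg])
    have h3 := ((h1.sub h2).mul_left (borelA a / 2)).tsum_eq
    have e : psum c w = ∑' n : ℕ, borelA a / 2 * (w ^ n - (-w) ^ n) := by
      rw [psum]
      congr 1
      ext n
      rw [hc, neg_pow w]
      ring
    have h4 : 1 - w ^ 2 ≠ 0 := by
      have : 1 - w ^ 2 = (1 - w) * (1 + w) := by ring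
      rw [this]
      exact mul_ne_zero hne1 hne2
    rw [e, h3, sub_neg_eq_add]
    field_simp
    ring
  have hds : psum d w = borelD a * (w / (1 - w) ^ 2) := by
    rw [← tsum_coe_mul_geometric_of_norm_lt_one hw, ← tsum_mul_left, psum]
    congr 1
    ext n
    rw [hd]
    ring
  rw [hb.nat_mul.mul_deriv hw, ← hcs, ← hds, mul_comm (psum c w), mul_comm (psum d w),
    hb.nat_mul.psum_mul hC hw, hb.psum_mul hD hw]
  have hs1 := hasSum_sum_range_mul_of_summable_norm (hb.nat_mul.summable_norm hw)
    (hC.summable_norm hw)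
  have hs2 := hasSum_sum_range_mul_of_summable_norm (hb.summable_norm hw) (hD.summable_norm hw)
  have hfix : ∀ (b c : ℕ → ℂ) (n : ℕ),
      ∑ k ∈ Finset.range (n + 1), b k * w ^ k * (c (n - k) * w ^ (n - k)) =
        (∑ k ∈ Finset.range (n + 1), b k * c (n - k)) * w ^ n := by
    intro b c n
    rw [Finset.sum_mul]
    refine Finset.sum_congr rfl fun k hk => ?_
    have hk' : k + (n - k) = n := by have := Finset.mem_range.mp hk; omega
    calc b k * w ^ k * (c (n - k) * w ^ (n - k)) = b k * c (n - k) * w ^ (k + (n - k)) := by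
          rw [pow_add]; ring
      _ = _ := by rw [hk']
  simp only [hfix] at hs1 hs2
  rw [psum, psum, psum, ← hs1.summable.tsum_add hs2.summable, ← tsum_neg]
  congr 1
  ext n
  rw [borelCoeff_rec, ← add_mul, ← Finset.sum_add_distrib, Finset.sum_range_succ]
  simp [hc, hd]

end StokesSibuya

namespace StokesSibuya

/-! ### Uniformization of the plane cut along `(-∞, -2]` -/

/-- The sector `-k |s| ≤ re s`. -/
def InSector (k : ℝ) (s : ℂ) : Prop := -(k * ‖s‖) ≤ s.re

/-- The square root of `1 + s / 2`. -/
noncomputable def slitRoot (s : ℂ) : ℂ := (1 + s / 2) ^ (1 / 2 : ℂ)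

/-- The uniformizing variable, with values in the unit disc. -/
noncomputable def slitVar (s : ℂ) : ℂ := (slitRoot s - 1) / (slitRoot s + 1)

theorem slitRoot_sq (s : ℂ) : slitRoot s ^ 2 = 1 + s / 2 := by
  rw [slitRoot, ← Complex.cpow_nat_mul]
  norm_num

/-- With `z = 1 + s/2`, the sector condition and `|s/2| ≤ |z| + 1` give `re z ≥ 1 - k(|z| + 1)`. The
quantity `|z| + re z` measures the distance from the cut, being `2 (re √z)²`. -/
theorem InSector.le_norm_add_re {k : ℝ} (hk0 : 0 ≤ k) (hk1 : k < 1) {s : ℂ} (hs : InSector k s) :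
    1 - k ≤ ‖1 + s / 2‖ + (1 + s / 2).re := by
  have h1 : ‖s / 2‖ ≤ ‖1 + s / 2‖ + 1 := by
    calc ‖s / 2‖ = ‖(1 + s / 2) - 1‖ := by congr 1; ring
      _ ≤ ‖1 + s / 2‖ + ‖(1 : ℂ)‖ := norm_sub_le _ _
      _ = _ := by simp
  have h2 : ‖s / 2‖ = ‖s‖ / 2 := by simp
  have h3 : (1 + s / 2).re = 1 + s.re / 2 := by simp
  have h4 : -(k * ‖s‖) ≤ s.re := hs
  rw [h3]
  nlinarith [norm_nonneg (1 + s / 2), mul_le_mul_of_nonneg_left h1 hk0]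

theorem InSector.mem_slitPlane {k : ℝ} (hk0 : 0 ≤ k) (hk1 : k < 1) {s : ℂ} (hs : InSector k s) :
    1 + s / 2 ∈ slitPlane := by
  have h := hs.le_norm_add_re hk0 hk1
  by_contra hn
  rw [Complex.mem_slitPlane_iff, not_or, not_lt, not_not] at hn
  have h1 : ‖1 + s / 2‖ = -(1 + s / 2).re := by
    have : (1 + s / 2) = ((1 + s / 2).re : ℂ) := by
      apply Complex.ext <;> simp_all
    rw [this, Complex.norm_real, Real.norm_eq_abs, abs_of_nonpos (by simpa using hn.1)]
    simp
  linarith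

theorem slitRoot_re_pos {s : ℂ} (hs : 1 + s / 2 ∈ slitPlane) : 0 < (slitRoot s).re := by
  have h0 : 1 + s / 2 ≠ 0 := slitPlane_ne_zero hs
  rw [slitRoot, cpow_def_of_ne_zero h0, exp_re]
  have h1 : (log (1 + s / 2) * (1 / 2)).im = arg (1 + s / 2) / 2 := by
    have : log (1 + s / 2) * (1 / 2) = log (1 + s / 2) / (2 : ℝ) := by push_cast; ring
    rw [this, Complex.div_ofReal_im, log_im]
  rw [h1]
  have h2 := (arg_le_pi (1 + s / 2)).lt_of_ne (mem_slitPlane_iff_arg.1 hs).1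
  have h3 := neg_pi_lt_arg (1 + s / 2)
  exact mul_pos (Real.exp_pos _) (Real.cos_pos_of_mem_Ioo ⟨by linarith, by linarith⟩)

theorem InSector.slitRoot_re {k : ℝ} (hk0 : 0 ≤ k) (hk1 : k < 1) {s : ℂ} (hs : InSector k s) :
    Real.sqrt ((1 - k) / 2) ≤ (slitRoot s).re := by
  have hp := slitRoot_re_pos (hs.mem_slitPlane hk0 hk1)
  have h := hs.le_norm_add_re hk0 hk1
  rw [← slitRoot_sq, norm_pow, Complex.sq_norm, Complex.normSq_apply] at h
  simp only [pow_two, Complex.mul_re] at h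
  rw [Real.sqrt_le_iff]
  exact ⟨hp.le, by nlinarith⟩

theorem one_le_norm_slitRoot_add_one {s : ℂ} (hs : 1 + s / 2 ∈ slitPlane) :
    1 ≤ ‖slitRoot s + 1‖ := by
  have h1 := slitRoot_re_pos hs
  have h2 := Complex.re_le_norm (slitRoot s + 1)
  simp at h2
  linarith

theorem slitRoot_add_one_ne_zero {s : ℂ} (hs : 1 + s / 2 ∈ slitPlane) : slitRoot s + 1 ≠ 0 :=
  norm_pos_iff.1 (one_pos.trans_le (one_le_norm_slitRoot_add_one hs))

theorem slitRoot_ne_zero {s : ℂ} (hs : 1 + s / 2 ∈ slitPlane) : slitRoot s ≠ 0 := fun h => by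
  have := slitRoot_re_pos hs
  simp [h] at this

/-- The quotient of the uniformizing variable by `s`. -/
noncomputable def slitQuot (s : ℂ) : ℂ := 1 / (2 * (slitRoot s + 1) ^ 2)

theorem slitVar_eq {s : ℂ} (hs : 1 + s / 2 ∈ slitPlane) : slitVar s = s * slitQuot s := by
  have h := slitRoot_add_one_ne_zero hs
  rw [slitVar, slitQuot]
  field_simp
  linear_combination 2 * slitRoot_sq s

theorem norm_slitVar_le {s : ℂ} (hs : 1 + s / 2 ∈ slitPlane) : ‖slitVar s‖ ≤ ‖s‖ / 2 := by
  have h := one_le_norm_slitRoot_add_one hs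
  rw [slitVar_eq hs, slitQuot, norm_mul, norm_div, norm_mul, norm_pow, norm_one, Complex.norm_two]
  rw [div_eq_mul_one_div ‖s‖]
  gcongr
  nlinarith

theorem norm_slitVar_lt_one {s : ℂ} (hs : 1 + s / 2 ∈ slitPlane) : ‖slitVar s‖ < 1 := by
  have h := slitRoot_re_pos hs
  rw [slitVar, norm_div, div_lt_one (one_pos.trans_le (one_le_norm_slitRoot_add_one hs))]
  refine lt_of_pow_lt_pow_left₀ 2 (norm_nonneg _) ?_
  rw [Complex.sq_norm, Complex.sq_norm, Complex.normSq_apply, Complex.normSq_apply]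
  simp
  nlinarith

/-- The constant in the lower bound for the distance of the uniformizing variable to the circle. -/
noncomputable def sectorConst (k : ℝ) : ℝ := Real.sqrt ((1 - k) / 2) / 2

theorem sectorConst_pos {k : ℝ} (hk1 : k < 1) : 0 < sectorConst k := by
  have : 0 < (1 - k) / 2 := by linarith
  unfold sectorConst
  positivity

/-- From `1 - |w|² = 4 re q / |q+1|²`, with `re q` bounded below in the sector and `|q+1|² ≤ 4(1 +
|s|)`. A negative power of `1 - |w|` therefore costs only a power of `1 + |s|`. -/
theorem InSector.one_sub_norm_slitVar {k : ℝ} (hk0 : 0 ≤ k) (hk1 : k < 1) {s : ℂ}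
    (hs : InSector k s) : sectorConst k / (1 + ‖s‖) ≤ 1 - ‖slitVar s‖ := by
  have hsl := hs.mem_slitPlane hk0 hk1
  have h1 := hs.slitRoot_re hk0 hk1
  have hlt := norm_slitVar_lt_one hsl
  have hq1 := one_le_norm_slitRoot_add_one hsl
  have hpos : 0 < ‖slitRoot s + 1‖ := by linarith
  have e1 : (1 - ‖slitVar s‖ ^ 2) * ‖slitRoot s + 1‖ ^ 2 = 4 * (slitRoot s).re := by
    rw [slitVar, norm_div, div_pow, sub_mul, div_mul_cancel₀ _ (by positivity), Complex.sq_norm,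
      Complex.sq_norm, Complex.normSq_apply, Complex.normSq_apply]
    simp
    ring
  have e2 : ‖slitRoot s + 1‖ ^ 2 ≤ 4 * (1 + ‖s‖) := by
    have h2 : ‖slitRoot s‖ ^ 2 ≤ 1 + ‖s‖ / 2 := by
      rw [← norm_pow, slitRoot_sq]
      refine (norm_add_le _ _).trans ?_
      simp
    have h3 : ‖slitRoot s + 1‖ ≤ ‖slitRoot s‖ + 1 := by simpa using norm_add_le (slitRoot s) 1
    have h4 : ‖slitRoot s + 1‖ ^ 2 ≤ (‖slitRoot s‖ + 1) ^ 2 := by gcongr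
    nlinarith [sq_nonneg (‖slitRoot s‖ - 1), norm_nonneg s]
  have hs0 : 0 < 1 + ‖s‖ := by positivity
  rw [div_le_iff₀ hs0, sectorConst]
  have e3 : 4 * (slitRoot s).re ≤ (1 - ‖slitVar s‖ ^ 2) * (4 * (1 + ‖s‖)) := by
    rw [← e1]
    have : 0 ≤ 1 - ‖slitVar s‖ ^ 2 := by nlinarith [norm_nonneg (slitVar s)]
    gcongr
  have e4 : 1 - ‖slitVar s‖ ^ 2 ≤ 2 * (1 - ‖slitVar s‖) := by
    nlinarith [norm_nonneg (slitVar s)]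
  nlinarith

theorem hasDerivAt_slitRoot {s : ℂ} (hs : 1 + s / 2 ∈ slitPlane) :
    HasDerivAt slitRoot (1 / (4 * slitRoot s)) s := by
  have h1 : HasDerivAt (fun s : ℂ => 1 + s / 2) (1 / 2) s :=
    ((hasDerivAt_id s).div_const 2).const_add 1
  have h2 := h1.cpow_const (c := 1 / 2) hs
  refine h2.congr_deriv ?_
  have h0 : 1 + s / 2 ≠ 0 := slitPlane_ne_zero hs
  have h3 : (1 + s / 2) ^ ((1 / 2 : ℂ) - 1) = slitRoot s / (1 + s / 2) := by
    rw [cpow_sub _ _ h0, cpow_one, slitRoot]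
  rw [h3, ← slitRoot_sq]
  have := slitRoot_ne_zero hs
  field_simp
  norm_num

theorem hasDerivAt_slitVar {s : ℂ} (hs : 1 + s / 2 ∈ slitPlane) :
    HasDerivAt slitVar (1 / (2 * slitRoot s * (slitRoot s + 1) ^ 2)) s := by
  have h := hasDerivAt_slitRoot hs
  have h0 := slitRoot_ne_zero hs
  have h1 := slitRoot_add_one_ne_zero hs
  refine ((h.sub_const 1).div (h.add_const 1) h1).congr_deriv ?_
  field_simp
  ring

/-- The Borel transform on the cut plane. -/
noncomputable def borel (a : Fin 2 → ℂ) (s : ℂ) : ℂ := psum (borelCoeff a) (slitVar s)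

/-- The Euler derivative of the Borel transform with respect to the uniformizing variable. -/
noncomputable def borelEuler (a : Fin 2 → ℂ) (s : ℂ) : ℂ :=
  psum (fun n => n * borelCoeff a n) (slitVar s)

theorem hasDerivAt_borel (a : Fin 2 → ℂ) {s : ℂ} (hs : 1 + s / 2 ∈ slitPlane) (h0 : s ≠ 0) :
    HasDerivAt (borel a) (borelEuler a s / (s * slitRoot s)) s := by
  have hw := norm_slitVar_lt_one hs
  have hb := convOn_borelCoeff a
  have h1 := (hb.hasSum_deriv hw).1.hasDerivAt.comp s (hasDerivAt_slitVar hs)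
  refine h1.congr_deriv ?_
  have h2 := slitRoot_ne_zero hs
  have h3 := slitRoot_add_one_ne_zero hs
  rw [borelEuler, ← hb.mul_deriv hw, slitVar_eq hs, slitQuot]
  field_simp

/-- Since `2q² = s + 2`, the function `2qH` is `s(s+2)G'`. In terms of `s` this is the Borel-plane
equation `(s(s+2)G')' = -a₁ s G' - (D/4) G`, with `D` the value `borelD a`. -/
theorem hasDerivAt_borelEuler (a : Fin 2 → ℂ) {s : ℂ} (hs : 1 + s / 2 ∈ slitPlane) (h0 : s ≠ 0) :
    HasDerivAt (fun s => 2 * slitRoot s * borelEuler a s)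
      (-(a 0 * borelEuler a s / slitRoot s) - borelD a / 4 * borel a s) s := by
  have hw := norm_slitVar_lt_one hs
  have hb := (convOn_borelCoeff a).nat_mul
  have h1 := (hb.hasSum_deriv hw).1.hasDerivAt.comp s (hasDerivAt_slitVar hs)
  have h2 := slitRoot_ne_zero hs
  have h3 := slitRoot_add_one_ne_zero hs
  have h4 := ((hasDerivAt_slitRoot hs).const_mul 2).mul h1
  refine h4.congr_deriv ?_
  have hode := borel_ode a hw
  have hv0 : slitVar s ≠ 0 := by
    rw [slitVar_eq hs, slitQuot]
    exact mul_ne_zero h0 (one_div_ne_zero (mul_ne_zero two_ne_zero (pow_ne_zero 2 h3)))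
  set q := slitRoot s with hq
  have e1 : 1 - slitVar s ^ 2 = 4 * q / (q + 1) ^ 2 := by
    rw [slitVar, ← hq]; field_simp; ring
  have e2 : (1 - slitVar s) ^ 2 = 4 / (q + 1) ^ 2 := by
    rw [slitVar, ← hq]; field_simp; ring
  rw [e1, e2] at hode
  have hode' : deriv (psum fun n => n * borelCoeff a n) (slitVar s) =
      -(borelA a * ((q + 1) ^ 2 / (4 * q)) * borelEuler a s +
        borelD a * ((q + 1) ^ 2 / 4) * borel a s) := by
    apply mul_left_cancel₀ hv0
    rw [hode, borelEuler, borel]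
    field_simp
  simp only [Function.comp_def]
  rw [hode', borelA]
  change 2 * (1 / (4 * q)) * borelEuler a s + _ = _
  field_simp
  ring

/-- The majorant `C (1 - |w|)^(-(m+1))` in the disc becomes polynomial growth in the sector. It is
stated for general coefficients because it also serves the Euler derivative. -/
theorem InSector.norm_borel_le {k : ℝ} (hk0 : 0 ≤ k) (hk1 : k < 1) {s : ℂ} (hs : InSector k s)
    {b : ℕ → ℂ} {m : ℕ} {C : ℝ} (hC : 0 ≤ C) (hb : ∀ n, ‖b n‖ ≤ C * (n + m).choose m) :
    ‖psum b (slitVar s)‖ ≤ C * (sectorConst k ^ (m + 1))⁻¹ * (1 + ‖s‖) ^ (m + 1) := by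
  have hc := sectorConst_pos hk1
  refine (norm_psum_le hb (norm_slitVar_lt_one (hs.mem_slitPlane hk0 hk1))).trans ?_
  rw [mul_assoc]
  gcongr
  have h1 := hs.one_sub_norm_slitVar hk0 hk1
  calc ((1 - ‖slitVar s‖) ^ (m + 1))⁻¹ ≤ ((sectorConst k / (1 + ‖s‖)) ^ (m + 1))⁻¹ := by gcongr
    _ = _ := by rw [div_pow, inv_div, div_eq_inv_mul]

end StokesSibuya

namespace StokesSibuya

/-! ### Taylor expansion of the Borel transform in `s`, uniform in the parameters -/

theorem analyticAt_slitQuot : AnalyticAt ℂ slitQuot 0 := by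
  have h0 : (1 + (0 : ℂ) / 2) ∈ slitPlane := by simp
  have h1 : AnalyticAt ℂ slitRoot 0 := by
    have : AnalyticAt ℂ (fun s : ℂ => 1 + s / 2) 0 := by fun_prop
    exact this.cpow analyticAt_const h0
  have h2 := slitRoot_add_one_ne_zero h0
  exact analyticAt_const.div (analyticAt_const.mul ((h1.add analyticAt_const).pow 2))
    (mul_ne_zero two_ne_zero (pow_ne_zero 2 h2))

/-- The Taylor coefficients at the origin of the powers of `slitQuot`. -/
noncomputable def quotCoeff (n j : ℕ) : ℂ :=
  (Classical.choose (analyticAt_slitQuot.pow n)).coeff j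

theorem quotCoeff_zero : quotCoeff 0 0 = 1 := by
  have h := Classical.choose_spec (analyticAt_slitQuot.pow 0)
  have := h.coeff_zero (fun _ => 1)
  rw [quotCoeff]
  simpa using this

theorem exists_quotCoeff_bound (n J : ℕ) : ∃ C : ℝ, ∀ᶠ s in 𝓝 (0 : ℂ),
    ‖slitQuot s ^ n - ∑ j ∈ Finset.range J, quotCoeff n j * s ^ j‖ ≤ C * ‖s‖ ^ J := by
  have h := Classical.choose_spec (analyticAt_slitQuot.pow n)
  obtain ⟨C, hC⟩ := (h.isBigO_sub_partialSum_pow J).bound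
  refine ⟨C, hC.mono fun s hs => ?_⟩
  simp only [zero_add, norm_pow, norm_norm, FormalMultilinearSeries.partialSum,
    FormalMultilinearSeries.apply_eq_pow_smul_coeff, smul_eq_mul] at hs
  simpa [quotCoeff, mul_comm] using hs

/-- The Taylor coefficients at the origin of the Borel transform, as polynomials in `a`. -/
noncomputable def taylorPoly (m : ℕ) : MvPolynomial (Fin 2) ℂ :=
  ∑ n ∈ Finset.range (m + 1), MvPolynomial.C (quotCoeff n (m - n)) * borelPoly n

theorem eval_taylorPoly (a : Fin 2 → ℂ) (m : ℕ) : MvPolynomial.eval a (taylorPoly m) =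
    ∑ n ∈ Finset.range (m + 1), quotCoeff n (m - n) * borelCoeff a n := by
  simp [taylorPoly, borelCoeff]

/-- Substituting `w = s · slitQuot s` and regrouping by total degree. The coefficients in `s` stay
polynomial in the parameters because each one involves only finitely many coefficients in `w`. -/
theorem sum_taylorPoly (a : Fin 2 → ℂ) (N : ℕ) (s : ℂ) :
    ∑ m ∈ Finset.range N, MvPolynomial.eval a (taylorPoly m) * s ^ m =
      ∑ n ∈ Finset.range N, borelCoeff a n *
        (s ^ n * ∑ j ∈ Finset.range (N - n), quotCoeff n j * s ^ j) := by
  simp only [eval_taylorPoly, Finset.sum_mul, Finset.mul_sum]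
  rw [Finset.sum_sigma', Finset.sum_sigma']
  refine Finset.sum_bij' (fun x _ => ⟨x.2, x.1 - x.2⟩) (fun x _ => ⟨x.1 + x.2, x.1⟩) ?_ ?_ ?_ ?_ ?_
  · rintro ⟨m, n⟩ h
    simp only [Finset.mem_sigma, Finset.mem_range] at h ⊢
    omega
  · rintro ⟨m, n⟩ h
    simp only [Finset.mem_sigma, Finset.mem_range] at h ⊢
    omega
  · rintro ⟨m, n⟩ h
    simp only [Finset.mem_sigma, Finset.mem_range] at h
    simp only [Sigma.mk.injEq, heq_eq_eq, and_true]
    omega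
  · rintro ⟨m, n⟩ h
    simp
  · rintro ⟨m, n⟩ h
    simp only [Finset.mem_sigma, Finset.mem_range] at h
    have : n + (m - n) = m := by omega
    calc quotCoeff n (m - n) * borelCoeff a n * s ^ m
        = quotCoeff n (m - n) * borelCoeff a n * s ^ (n + (m - n)) := by rw [this]
      _ = _ := by rw [pow_add]; ring

theorem norm_borel_tail_le (m N : ℕ) : ∃ C : ℝ, 0 ≤ C ∧ ∀ a, parSize a ≤ m + 1 → ∀ w : ℂ,
    ‖w‖ ≤ 1 / 2 →
    ‖psum (borelCoeff a) w - ∑ n ∈ Finset.range N, borelCoeff a n * w ^ n‖ ≤ C * ‖w‖ ^ N := by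
  have hs : Summable fun n : ℕ => (((n + N) + m).choose m : ℝ) * (1 / 2 : ℝ) ^ (n + N) :=
    (summable_nat_add_iff N).2 (summable_choose_mul_pow m (by norm_num) (by norm_num))
  refine ⟨2 ^ N * ∑' n : ℕ, (((n + N) + m).choose m : ℝ) * (1 / 2 : ℝ) ^ (n + N), by positivity,
    fun a ha w hw => ?_⟩
  have hw1 : ‖w‖ < 1 := by linarith
  have h1 := ((convOn_borelCoeff a).summable hw1).sum_add_tsum_nat_add N
  rw [psum, ← h1, add_sub_cancel_left, mul_comm _ (‖w‖ ^ N), ← mul_assoc, ← tsum_mul_left]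
  refine tsum_of_norm_bounded (hs.mul_left _).hasSum fun n => ?_
  rw [norm_mul, norm_pow, pow_add ‖w‖]
  calc ‖borelCoeff a (n + N)‖ * (‖w‖ ^ n * ‖w‖ ^ N)
      ≤ ((n + N) + m).choose m * ((1 / 2) ^ n * ‖w‖ ^ N) := by
        gcongr
        exact norm_borelCoeff_le ha _
    _ = _ := by
        rw [pow_add, one_div, inv_pow, inv_pow]
        field_simp

/-- Taylor's formula for the Borel transform, uniformly in a sector. -/
theorem borel_remainder {k : ℝ} (hk0 : 0 ≤ k) (hk1 : k < 1) (m N : ℕ) :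
    ∃ (C : ℝ) (M : ℕ), 0 ≤ C ∧ ∀ a, parSize a ≤ m + 1 → ∀ s, InSector k s →
      ‖borel a s - ∑ n ∈ Finset.range N, MvPolynomial.eval a (taylorPoly n) * s ^ n‖ ≤
        C * ‖s‖ ^ N * (1 + ‖s‖) ^ M := by
  obtain ⟨C₁, hC₁, htail⟩ := norm_borel_tail_le m N
  choose Q hQ using fun n => exists_quotCoeff_bound n (N - n)
  have hev : ∀ᶠ s in 𝓝 (0 : ℂ), ∀ n ∈ Finset.range N,
      ‖slitQuot s ^ n - ∑ j ∈ Finset.range (N - n), quotCoeff n j * s ^ j‖ ≤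
        Q n * ‖s‖ ^ (N - n) := (Filter.eventually_all_finset _).2 fun n _ => hQ n
  obtain ⟨δ, hδ, hball⟩ := Metric.eventually_nhds_iff.1 hev
  set T : ℝ := ∑ n ∈ Finset.range N, ((n + m).choose m : ℝ) * |Q n| with hT
  have hT0 : 0 ≤ T := Finset.sum_nonneg fun n _ => by positivity
  set D : ℝ := ∑ l ∈ Finset.range N, ∑ n ∈ Finset.range (l + 1),
    ‖quotCoeff n (l - n)‖ * (n + m).choose m with hD
  have hD0 : 0 ≤ D := Finset.sum_nonneg fun n _ => Finset.sum_nonneg fun n _ => by positivity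
  set ε := min δ 1 with hε
  have hε0 : 0 < ε := lt_min hδ one_pos
  have hc := sectorConst_pos hk1
  set S : ℝ := 1 * (sectorConst k ^ (m + 1))⁻¹ with hS
  have hS0 : 0 ≤ S := by positivity
  refine ⟨C₁ + T + (S + D) / ε ^ N, max (m + 1) N, by positivity, fun a ha s hs => ?_⟩
  have hsl := hs.mem_slitPlane hk0 hk1
  have hw := norm_slitVar_le hsl
  have hone : 1 ≤ 1 + ‖s‖ := by linarith [norm_nonneg s]
  have hpow : (1 : ℝ) ≤ (1 + ‖s‖) ^ (max (m + 1) N) := one_le_pow₀ hone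
  have hbc := fun n => norm_borelCoeff_le ha n
  -- Near `0` the tail of the series in `w` and the Taylor remainders of the powers of `slitQuot`
  -- are compared. Away from `0` both terms have polynomial growth and `‖s‖ ^ N / ε ^ N ≥ 1`.
  rcases lt_or_ge ‖s‖ ε with hlt | hge
  · have hs1 : ‖s‖ < 1 := hlt.trans_le (min_le_right _ _)
    have hsδ : dist s 0 < δ := by simpa using hlt.trans_le (min_le_left _ _)
    have h1 := htail a ha (slitVar s) (by linarith)
    have h2 : ‖∑ n ∈ Finset.range N, borelCoeff a n * slitVar s ^ n -
        ∑ n ∈ Finset.range N, MvPolynomial.eval a (taylorPoly n) * s ^ n‖ ≤ T * ‖s‖ ^ N := by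
      rw [sum_taylorPoly, ← Finset.sum_sub_distrib, hT, Finset.sum_mul]
      refine (norm_sum_le _ _).trans (Finset.sum_le_sum fun n hn => ?_)
      have hn' : n + (N - n) = N := by have := Finset.mem_range.mp hn; omega
      rw [slitVar_eq hsl, mul_pow, ← mul_sub, ← mul_sub, norm_mul, norm_mul, norm_pow]
      calc ‖borelCoeff a n‖ * (‖s‖ ^ n *
            ‖slitQuot s ^ n - ∑ j ∈ Finset.range (N - n), quotCoeff n j * s ^ j‖)
          ≤ ((n + m).choose m : ℝ) * (‖s‖ ^ n * (|Q n| * ‖s‖ ^ (N - n))) := by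
            gcongr
            · exact hbc n
            · refine (hball hsδ n hn).trans ?_
              gcongr
              exact le_abs_self _
        _ = ((n + m).choose m : ℝ) * |Q n| * ‖s‖ ^ (n + (N - n)) := by rw [pow_add]; ring
        _ = _ := by rw [hn']
    have h3 : C₁ * ‖slitVar s‖ ^ N ≤ C₁ * ‖s‖ ^ N := by
      gcongr
      linarith [norm_nonneg s]
    calc _ ≤ ‖psum (borelCoeff a) (slitVar s) -
            ∑ n ∈ Finset.range N, borelCoeff a n * slitVar s ^ n‖ +
          ‖∑ n ∈ Finset.range N, borelCoeff a n * slitVar s ^ n -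
            ∑ n ∈ Finset.range N, MvPolynomial.eval a (taylorPoly n) * s ^ n‖ :=
          norm_sub_le_norm_sub_add_norm_sub _ _ _
      _ ≤ (C₁ + T) * ‖s‖ ^ N * 1 := by linarith
      _ ≤ _ := by
          have : 0 ≤ (S + D) / ε ^ N := by positivity
          refine mul_le_mul (mul_le_mul_of_nonneg_right ?_ (by positivity)) hpow zero_le_one
            (by positivity)
          linarith
  · have h1 : ‖borel a s‖ ≤ S * (1 + ‖s‖) ^ (max (m + 1) N) := by
      refine (hs.norm_borel_le hk0 hk1 zero_le_one (b := borelCoeff a) (m := m)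
        (fun n => by simpa using hbc n)).trans ?_
      gcongr
      exact le_max_left _ _
    have h2 : ‖∑ n ∈ Finset.range N, MvPolynomial.eval a (taylorPoly n) * s ^ n‖ ≤
        D * (1 + ‖s‖) ^ (max (m + 1) N) := by
      rw [hD, Finset.sum_mul]
      refine (norm_sum_le _ _).trans (Finset.sum_le_sum fun l hl => ?_)
      rw [norm_mul, norm_pow, eval_taylorPoly]
      gcongr ?_ * ?_
      · refine (norm_sum_le _ _).trans (Finset.sum_le_sum fun n _ => ?_)
        rw [norm_mul]
        gcongr
        exact hbc n
      · have := Finset.mem_range.mp hl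
        calc ‖s‖ ^ l ≤ (1 + ‖s‖) ^ l := by gcongr; linarith
          _ ≤ _ := pow_le_pow_right₀ hone (this.le.trans (le_max_right _ _))
    have h3 : 1 ≤ ‖s‖ ^ N / ε ^ N := by
      rw [one_le_div (by positivity)]
      gcongr
    calc _ ≤ ‖borel a s‖ + ‖∑ n ∈ Finset.range N, MvPolynomial.eval a (taylorPoly n) * s ^ n‖ :=
          norm_sub_le _ _
      _ ≤ (S + D) * 1 * (1 + ‖s‖) ^ (max (m + 1) N) := by linarith
      _ ≤ (S + D) * (‖s‖ ^ N / ε ^ N) * (1 + ‖s‖) ^ (max (m + 1) N) := by gcongr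
      _ = (S + D) / ε ^ N * ‖s‖ ^ N * (1 + ‖s‖) ^ (max (m + 1) N) := by ring
      _ ≤ _ := by
          gcongr
          linarith

end StokesSibuya

namespace StokesSibuya

open MeasureTheory Set

/-! ### Laplace integrals -/

/-- Continuous functions of polynomial growth on the positive half-line. -/
structure PolyGrowth (f : ℝ → ℂ) : Prop where
  cont : ContinuousOn f (Ioi 0)
  bound : ∃ (C : ℝ) (M : ℕ), 0 ≤ C ∧ ∀ r > 0, ‖f r‖ ≤ C * (1 + r) ^ M

theorem one_add_pow_le_exp {δ : ℝ} (hδ : 0 < δ) (M : ℕ) {r : ℝ} (hr : 0 ≤ r) :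
    (1 + r) ^ M ≤ M.factorial / δ ^ M * Real.exp δ * Real.exp (δ * r) := by
  have h := Real.pow_div_factorial_le_exp (δ * (1 + r)) (by positivity) M
  have hf : (0 : ℝ) < M.factorial := by exact_mod_cast M.factorial_pos
  rw [div_le_iff₀ hf, mul_pow] at h
  have e : Real.exp (δ * (1 + r)) = Real.exp δ * Real.exp (δ * r) := by
    rw [← Real.exp_add]; ring_nf
  rw [e] at h
  rw [mul_assoc, div_mul_eq_mul_div, le_div_iff₀ (by positivity)]
  linarith

theorem one_add_pow_mul_exp_le {δ : ℝ} (hδ : 0 < δ) (M : ℕ) {r : ℝ} (hr : 0 ≤ r) :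
    (1 + r) ^ M * Real.exp (-(δ * r)) ≤
      M.factorial / (δ / 2) ^ M * Real.exp (δ / 2) * Real.exp (-((δ / 2) * r)) := by
  have h := one_add_pow_le_exp (half_pos hδ) M hr
  have e : Real.exp (-(δ / 2 * r)) = Real.exp (δ / 2 * r) * Real.exp (-(δ * r)) := by
    rw [← Real.exp_add]; ring_nf
  rw [e, ← mul_assoc]
  gcongr

theorem integrableOn_exp_neg_mul {δ : ℝ} (hδ : 0 < δ) :
    IntegrableOn (fun r : ℝ => Real.exp (-(δ * r))) (Ioi 0) := by
  simpa using exp_neg_integrableOn_Ioi 0 hδ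

theorem integrableOn_one_add_pow_mul_exp {δ : ℝ} (hδ : 0 < δ) (M : ℕ) :
    IntegrableOn (fun r : ℝ => (1 + r) ^ M * Real.exp (-(δ * r))) (Ioi 0) := by
  refine Integrable.mono' ((integrableOn_exp_neg_mul (half_pos hδ)).const_mul
    (M.factorial / (δ / 2) ^ M * Real.exp (δ / 2))) ?_ ?_
  · exact (by fun_prop : Continuous fun r : ℝ =>
      (1 + r) ^ M * Real.exp (-(δ * r))).aestronglyMeasurable
  · filter_upwards [ae_restrict_mem measurableSet_Ioi] with r hr
    have hr' : (0 : ℝ) < r := hr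
    rw [Real.norm_of_nonneg (by positivity)]
    exact one_add_pow_mul_exp_le hδ M hr'.le

theorem norm_exp_neg_mul (z : ℂ) (r : ℝ) : ‖exp (-(z * r))‖ = Real.exp (-(z.re * r)) := by
  rw [Complex.norm_exp]; simp

theorem PolyGrowth.integrableOn {f : ℝ → ℂ} (hf : PolyGrowth f) {z : ℂ} (hz : 0 < z.re) :
    IntegrableOn (fun r : ℝ => exp (-(z * r)) * f r) (Ioi 0) := by
  obtain ⟨C, M, hC, hb⟩ := hf.bound
  refine Integrable.mono' ((integrableOn_one_add_pow_mul_exp hz M).const_mul C) ?_ ?_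
  · refine ContinuousOn.aestronglyMeasurable ?_ measurableSet_Ioi
    exact (by fun_prop : Continuous fun r : ℝ => exp (-(z * r))).continuousOn.mul hf.cont
  · filter_upwards [ae_restrict_mem measurableSet_Ioi] with r hr
    rw [norm_mul, norm_exp_neg_mul]
    calc _ ≤ Real.exp (-(z.re * r)) * (C * (1 + r) ^ M) := by gcongr; exact hb r hr
      _ = _ := by ring

theorem PolyGrowth.mul {f g : ℝ → ℂ} (hf : PolyGrowth f) (hg : PolyGrowth g) :
    PolyGrowth fun r => f r * g r := by
  obtain ⟨C, M, hC, hb⟩ := hf.bound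
  obtain ⟨D, N, hD, hd⟩ := hg.bound
  refine ⟨hf.cont.mul hg.cont, C * D, M + N, by positivity, fun r hr => ?_⟩
  have : (0 : ℝ) < r := hr
  rw [norm_mul, pow_add]
  calc _ ≤ (C * (1 + r) ^ M) * (D * (1 + r) ^ N) := by
        gcongr
        · exact hb r hr
        · exact hd r hr
    _ = _ := by ring

theorem PolyGrowth.add {f g : ℝ → ℂ} (hf : PolyGrowth f) (hg : PolyGrowth g) :
    PolyGrowth fun r => f r + g r := by
  obtain ⟨C, M, hC, hb⟩ := hf.bound
  obtain ⟨D, N, hD, hd⟩ := hg.bound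
  refine ⟨hf.cont.add hg.cont, C + D, M + N, by positivity, fun r hr => ?_⟩
  have h0 : (0 : ℝ) < r := hr
  have h1 : (1 : ℝ) ≤ 1 + r := by linarith
  rw [add_mul]
  refine (norm_add_le _ _).trans (add_le_add ((hb r hr).trans ?_) ((hd r hr).trans ?_))
  · gcongr
    omega
  · gcongr
    omega

theorem polyGrowth_const (c : ℂ) : PolyGrowth fun _ => c :=
  ⟨continuousOn_const, ‖c‖, 0, norm_nonneg _, fun r _ => by simp⟩

theorem polyGrowth_id : PolyGrowth fun r => (r : ℂ) := by
  refine ⟨by fun_prop, 1, 1, zero_le_one, fun r hr => ?_⟩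
  have : (0 : ℝ) < r := hr
  rw [Complex.norm_real, Real.norm_of_nonneg this.le]
  linarith

theorem PolyGrowth.tendsto_zero {f : ℝ → ℂ} (hf : PolyGrowth f) {z : ℂ} (hz : 0 < z.re) :
    Tendsto (fun r : ℝ => exp (-(z * r)) * f r) atTop (𝓝 0) := by
  obtain ⟨C, M, hC, hb⟩ := hf.bound
  have h1 : Tendsto (fun r : ℝ => C * (M.factorial / (z.re / 2) ^ M * Real.exp (z.re / 2) *
      Real.exp (-((z.re / 2) * r)))) atTop (𝓝 0) := by
    have h2 : Tendsto (fun r : ℝ => Real.exp (-((z.re / 2) * r))) atTop (𝓝 0) :=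
      Real.tendsto_exp_neg_atTop_nhds_zero.comp (tendsto_id.const_mul_atTop (half_pos hz))
    simpa using (h2.const_mul (M.factorial / (z.re / 2) ^ M * Real.exp (z.re / 2))).const_mul C
  refine squeeze_zero_norm' ?_ h1
  filter_upwards [eventually_gt_atTop 0] with r hr
  rw [norm_mul, norm_exp_neg_mul]
  calc _ ≤ Real.exp (-(z.re * r)) * (C * (1 + r) ^ M) := by gcongr; exact hb r hr
    _ = C * ((1 + r) ^ M * Real.exp (-(z.re * r))) := by ring
    _ ≤ _ := mul_le_mul_of_nonneg_left (one_add_pow_mul_exp_le hz M hr.le) hC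

/-- The Laplace transform. -/
noncomputable def laplace (f : ℝ → ℂ) (z : ℂ) : ℂ := ∫ r in Ioi (0 : ℝ), exp (-(z * r)) * f r

theorem PolyGrowth.hasDerivAt_laplace {f : ℝ → ℂ} (hf : PolyGrowth f) {z : ℂ} (hz : 0 < z.re) :
    HasDerivAt (laplace f) (-laplace (fun r => r * f r) z) z := by
  have hf1 := polyGrowth_id.mul hf
  obtain ⟨C, M, hC, hb⟩ := hf1.bound
  have hs : {w : ℂ | z.re / 2 < w.re} ∈ 𝓝 z :=
    (isOpen_lt continuous_const continuous_re).mem_nhds (half_lt_self hz)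
  have h := hasDerivAt_integral_of_dominated_loc_of_deriv_le (𝕜 := ℂ)
    (μ := volume.restrict (Ioi (0 : ℝ)))
    (F := fun (w : ℂ) (r : ℝ) => exp (-(w * r)) * f r)
    (F' := fun (w : ℂ) (r : ℝ) => exp (-(w * r)) * (-(r * f r)))
    (bound := fun r : ℝ => C * ((1 + r) ^ M * Real.exp (-((z.re / 2) * r)))) hs ?_
    (hf.integrableOn hz) ?_ ?_ ((integrableOn_one_add_pow_mul_exp (half_pos hz) M).const_mul C) ?_
  · have h2 := h.2
    simp only [mul_neg, integral_neg] at h2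
    exact h2
  · filter_upwards [hs] with w hw
    exact (hf.integrableOn ((half_pos hz).trans hw)).aestronglyMeasurable
  · have := (hf1.integrableOn hz).neg.aestronglyMeasurable
    refine this.congr (Eventually.of_forall fun r => ?_)
    simp
  · filter_upwards [ae_restrict_mem measurableSet_Ioi] with r hr w hw
    have hr0 : (0 : ℝ) < r := hr
    rw [norm_mul, norm_neg, norm_exp_neg_mul]
    calc _ ≤ Real.exp (-(z.re / 2 * r)) * (C * (1 + r) ^ M) := by
          gcongr
          exact hb r hr
      _ = _ := by ring
  · refine Eventually.of_forall fun r w _ => ?_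
    have h1 : HasDerivAt (fun w : ℂ => exp (-(w * r))) (exp (-(w * r)) * (-(1 * r))) w :=
      (((hasDerivAt_id w).mul_const (r : ℂ)).neg).cexp
    exact (h1.mul_const (f r)).congr_deriv (by ring)

/-- The integral of a derivative with vanishing boundary values. -/
theorem integral_deriv_eq_zero {K k : ℝ → ℂ} (h0 : ContinuousWithinAt K (Ici 0) 0) (hK0 : K 0 = 0)
    (hd : ∀ r > 0, HasDerivAt K (k r) r) (hi : IntegrableOn k (Ioi 0))
    (ht : Tendsto K atTop (𝓝 0)) : ∫ r in Ioi (0 : ℝ), k r = 0 := by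
  rw [integral_Ioi_of_hasDerivAt_of_tendsto h0 (fun r hr => hd r hr) hi ht, hK0, sub_zero]

/-! ### Solutions of exponential type -/

/-- The change of the dependent variable `F = x ^ μ e ^ (-x) V(x)`. -/
theorem solPair_of_exp {a : Fin 2 → ℂ} {μ : ℂ} {X : Set ℂ} {V V' V'' : ℂ → ℂ}
    (h1 : ∀ x ∈ X, HasDerivAt V (V' x) x) (h2 : ∀ x ∈ X, HasDerivAt V' (V'' x) x)
    (h3 : ∀ x ∈ X, x ^ 2 * V'' x + 2 * (μ - x) * x * V' x +
      (μ ^ 2 - μ - a 1 - (2 * μ + a 0) * x) * V x = 0) :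
    SolPair a {t | exp t ∈ X} (fun t => exp (μ * t - exp t) * V (exp t))
      (fun t => exp (μ * t - exp t) * ((μ - exp t) * V (exp t) + exp t * V' (exp t))) := by
  have hE : ∀ t : ℂ, HasDerivAt (fun t => exp (μ * t - exp t))
      (exp (μ * t - exp t) * (μ * 1 - exp t)) t := fun t =>
    (((hasDerivAt_id t).const_mul μ).sub (Complex.hasDerivAt_exp t)).cexp
  refine ⟨fun t ht => ?_, fun t ht => ?_⟩
  · have hV := (h1 _ ht).comp t (Complex.hasDerivAt_exp t)
    refine ((hE t).mul hV).congr_deriv ?_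
    simp only [Function.comp_def]
    ring
  · have hV := (h1 _ ht).comp t (Complex.hasDerivAt_exp t)
    have hV' := (h2 _ ht).comp t (Complex.hasDerivAt_exp t)
    have hx := Complex.hasDerivAt_exp t
    have h4 := (((hasDerivAt_const t μ).sub hx).mul hV).add (hx.mul hV')
    refine ((hE t).mul h4).congr_deriv ?_
    simp only [Function.comp_def, Pi.mul_apply, Pi.add_apply, Pi.sub_apply, pot]
    linear_combination exp (μ * t - exp t) * h3 _ ht

/-! ### The Laplace integral of the Borel transform along a ray -/

/-- `η` is the direction of a ray of the sector with constant `k`. -/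
structure RayIn (k : ℝ) (η : ℂ) : Prop where
  nonneg : 0 ≤ k
  lt_one : k < 1
  norm_eq : ‖η‖ = 1
  le_re : -k ≤ η.re

theorem RayIn.norm_mul {k : ℝ} {η : ℂ} (h : RayIn k η) {r : ℝ} (hr : 0 ≤ r) : ‖η * r‖ = r := by
  rw [_root_.norm_mul, h.norm_eq, one_mul, Complex.norm_real, Real.norm_of_nonneg hr]

theorem RayIn.inSector {k : ℝ} {η : ℂ} (h : RayIn k η) {r : ℝ} (hr : 0 ≤ r) :
    InSector k (η * r) := by
  rw [InSector, h.norm_mul hr]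
  have := mul_le_mul_of_nonneg_right h.le_re hr
  simp
  linarith

theorem RayIn.mem {k : ℝ} {η : ℂ} (h : RayIn k η) {r : ℝ} (hr : 0 ≤ r) :
    1 + η * r / 2 ∈ slitPlane := (h.inSector hr).mem_slitPlane h.nonneg h.lt_one

theorem RayIn.ne_zero {k : ℝ} {η : ℂ} (h : RayIn k η) : η ≠ 0 :=
  norm_pos_iff.1 (by rw [h.norm_eq]; exact one_pos)

theorem RayIn.continuousOn_slitVar {k : ℝ} {η : ℂ} (h : RayIn k η) :
    ContinuousOn (fun r : ℝ => slitVar (η * r)) (Ici 0) := by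
  intro r hr
  have h1 := (hasDerivAt_slitVar (h.mem hr)).continuousAt
  exact (h1.comp (f := fun r : ℝ => η * (r : ℂ)) (by fun_prop)).continuousWithinAt

theorem RayIn.continuousOn_psum {k : ℝ} {η : ℂ} (h : RayIn k η) {b : ℕ → ℂ} (hb : ConvOn b 1) :
    ContinuousOn (fun r : ℝ => psum b (slitVar (η * r))) (Ici 0) := by
  intro r hr
  have h1 := (hb.hasDerivAt (norm_slitVar_lt_one (h.mem hr))).continuousAt
  exact h1.comp_continuousWithinAt (f := fun r : ℝ => slitVar (η * r)) (h.continuousOn_slitVar r hr)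

theorem RayIn.polyGrowth_psum {k : ℝ} {η : ℂ} (h : RayIn k η) {b : ℕ → ℂ} (hb : ConvOn b 1)
    {m : ℕ} {C : ℝ} (hC : 0 ≤ C) (hle : ∀ n, ‖b n‖ ≤ C * (n + m).choose m) :
    PolyGrowth fun r => psum b (slitVar (η * r)) := by
  have := sectorConst_pos h.lt_one
  refine ⟨(h.continuousOn_psum hb).mono Ioi_subset_Ici_self, C * (sectorConst k ^ (m + 1))⁻¹,
    m + 1, by positivity, fun r hr => ?_⟩
  have h1 := (h.inSector hr.le).norm_borel_le h.nonneg h.lt_one hC hle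
  rwa [h.norm_mul hr.le] at h1

theorem RayIn.polyGrowth_borel {k : ℝ} {η : ℂ} (h : RayIn k η) (a : Fin 2 → ℂ) :
    PolyGrowth fun r => borel a (η * r) := by
  obtain ⟨m, hm⟩ := exists_parSize_le a
  exact h.polyGrowth_psum (convOn_borelCoeff a) zero_le_one
    fun n => by simpa using norm_borelCoeff_le hm n

theorem RayIn.polyGrowth_borelEuler {k : ℝ} {η : ℂ} (h : RayIn k η) (a : Fin 2 → ℂ) :
    PolyGrowth fun r => borelEuler a (η * r) := by
  obtain ⟨m, hm⟩ := exists_parSize_le a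
  exact h.polyGrowth_psum (convOn_borelCoeff a).nat_mul (by positivity)
    (norm_nat_mul_borelCoeff_le hm)

theorem RayIn.continuousOn_slitRoot {k : ℝ} {η : ℂ} (h : RayIn k η) :
    ContinuousOn (fun r : ℝ => slitRoot (η * r)) (Ici 0) := by
  intro r hr
  have h1 := (hasDerivAt_slitRoot (h.mem hr)).continuousAt
  exact (h1.comp (f := fun r : ℝ => η * (r : ℂ)) (by fun_prop)).continuousWithinAt

theorem RayIn.polyGrowth_slitRoot {k : ℝ} {η : ℂ} (h : RayIn k η) :
    PolyGrowth fun r => slitRoot (η * r) := by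
  refine ⟨h.continuousOn_slitRoot.mono Ioi_subset_Ici_self, 1, 1, zero_le_one, fun r hr => ?_⟩
  have hr0 : (0 : ℝ) < r := hr
  have h2 : ‖slitRoot (η * r)‖ ^ 2 ≤ 1 + r / 2 := by
    rw [← norm_pow, slitRoot_sq]
    refine (norm_add_le _ _).trans ?_
    rw [norm_div, h.norm_mul hr0.le]
    simp
  nlinarith [sq_nonneg (‖slitRoot (η * r)‖ - 1)]

/-- The Laplace integral of the Borel transform along the ray with direction `η`. -/
noncomputable def rayLaplace (a : Fin 2 → ℂ) (η x : ℂ) : ℂ :=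
  η * laplace (fun r => borel a (η * r)) (x * η)

/-- The integrand is a total derivative by the equation in the Borel plane, and its primitive
vanishes at both ends of the ray. This is the integration by parts that turns the equation for `G`
into the one for its Laplace integral. -/
theorem RayIn.laplace_identity {k : ℝ} {η : ℂ} (h : RayIn k η) (a : Fin 2 → ℂ) {x : ℂ}
    (hx : 0 < (x * η).re) :
    ∫ r in Ioi (0 : ℝ), exp (-(x * η * r)) * (η * ((x ^ 2 * ((η * r) ^ 2 + 2 * (η * r)) -
      2 * x * (η * r + 1) + a 0 * (x * (η * r) - 1) + borelD a / 4) * borel a (η * r))) = 0 := by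
  -- The first term is `s(s+2)G'`; the multiple of `G` is chosen so that the terms with `borelEuler`
  -- cancel after differentiation. Both terms vanish at `s = 0`.
  set P : ℝ → ℂ := fun r => 2 * slitRoot (η * r) * borelEuler a (η * r) +
    (a 0 * (η * r) + x * ((η * r) ^ 2 + 2 * (η * r))) * borel a (η * r) with hP
  have hηr : PolyGrowth fun r : ℝ => η * r := (polyGrowth_const η).mul polyGrowth_id
  have hsq : PolyGrowth fun r : ℝ => (η * r) ^ 2 := by simpa only [pow_two] using hηr.mul hηr
  have hPg : PolyGrowth P :=
    (((polyGrowth_const 2).mul h.polyGrowth_slitRoot).mul (h.polyGrowth_borelEuler a)).add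
      ((((polyGrowth_const (a 0)).mul hηr).add ((polyGrowth_const x).mul
        (hsq.add ((polyGrowth_const 2).mul hηr)))).mul (h.polyGrowth_borel a))
  have hzero : slitVar (η * (0 : ℝ)) = 0 := by simp [slitVar, slitRoot]
  refine integral_deriv_eq_zero (K := fun r : ℝ => -(exp (-(x * η * r)) * P r)) ?_ ?_ ?_ ?_ ?_
  · have h1 := (h.continuousOn_psum (convOn_borelCoeff a).nat_mul) 0 self_mem_Ici
    have h2 := (h.continuousOn_psum (convOn_borelCoeff a)) 0 self_mem_Ici
    have h3 := h.continuousOn_slitRoot 0 self_mem_Ici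
    have h4 : ContinuousWithinAt (fun r : ℝ => exp (-(x * η * r))) (Ici 0) 0 :=
      Continuous.continuousWithinAt (by fun_prop)
    have h5 : ContinuousWithinAt (fun r : ℝ => a 0 * (η * r) + x * ((η * r) ^ 2 + 2 * (η * r)))
      (Ici 0) 0 := Continuous.continuousWithinAt (by fun_prop)
    exact (h4.mul (((continuousWithinAt_const.mul h3).mul h1).add (h5.mul h2))).neg
  · simp [hP, borelEuler, slitVar, slitRoot, psum_zero]
  · intro r hr
    have hr0 : (r : ℂ) ≠ 0 := by exact_mod_cast hr.ne'
    have hs0 : η * r ≠ 0 := mul_ne_zero h.ne_zero hr0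
    have hl : HasDerivAt (fun r : ℝ => η * (r : ℂ)) η r := by
      simpa using (Complex.ofRealCLM.hasDerivAt (x := r)).const_mul η
    have hG := (hasDerivAt_borel a (h.mem hr.le) hs0).comp r hl
    have hH := (hasDerivAt_borelEuler a (h.mem hr.le) hs0).comp r hl
    have hE : HasDerivAt (fun r : ℝ => exp (-(x * η * r))) (exp (-(x * η * r)) * (-(x * η))) r := by
      have : HasDerivAt (fun r : ℝ => -(x * η * (r : ℂ))) (-(x * η)) r := by
        have h1 := ((Complex.ofRealCLM.hasDerivAt (x := r)).const_mul (x * η)).neg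
        simp only [Complex.ofRealCLM_apply, Complex.ofReal_one, mul_one] at h1
        exact h1
      exact this.cexp
    have hQ : HasDerivAt (fun r : ℝ => a 0 * (η * r) + x * ((η * r) ^ 2 + 2 * (η * r)))
        (a 0 * η + x * (2 * (η * r) * η + 2 * η)) r := by
      refine ((hl.const_mul (a 0)).add (((hl.pow 2).add (hl.const_mul 2)).const_mul x)).congr_deriv ?_
      simp
    refine (hE.mul (hH.add (hQ.mul hG))).neg.congr_deriv ?_
    have hq := slitRoot_ne_zero (h.mem hr.le)
    have hq2 := slitRoot_sq (η * r)
    simp only [Function.comp_def, Pi.mul_apply, Pi.add_apply]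
    set q := slitRoot (η * r)
    set s := η * (r : ℂ)
    have hs : s = 2 * q ^ 2 - 2 := by linear_combination (-2) * hq2
    set G := borel a s
    set H := borelEuler a s
    set E := exp (-(x * η * r))
    have key : (a 0 * s + x * (s ^ 2 + 2 * s)) * (H / (s * q)) = (a 0 + x * (2 * q ^ 2)) * H / q := by
      have : s + 2 = 2 * q ^ 2 := by rw [hs]; ring
      rw [← this]
      field_simp
    have key2 : (a 0 * s + x * (s ^ 2 + 2 * s)) * (H / (s * q) * η) =
        a 0 * H / q * η + 2 * x * q * H * η := by
      rw [← mul_assoc, key]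
      field_simp
    rw [key2]
    field_simp
    ring
  · have hpoly : PolyGrowth fun r : ℝ => (η * ((x ^ 2 * ((η * r) ^ 2 + 2 * (η * r)) -
      2 * x * (η * r + 1) + a 0 * (x * (η * r) - 1) + borelD a / 4) * borel a (η * r))) := by
      have h1 : PolyGrowth fun r : ℝ => x ^ 2 * ((η * r) ^ 2 + 2 * (η * r)) +
          (-(2 * x)) * (η * r + 1) + a 0 * (x * (η * r) + (-1)) + borelD a / 4 :=
        ((((polyGrowth_const (x ^ 2)).mul (hsq.add ((polyGrowth_const 2).mul hηr))).add
          ((polyGrowth_const (-(2 * x))).mul (hηr.add (polyGrowth_const 1)))).add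
          ((polyGrowth_const (a 0)).mul (((polyGrowth_const x).mul hηr).add
          (polyGrowth_const (-1))))).add (polyGrowth_const (borelD a / 4))
      have h2 := (polyGrowth_const η).mul (h1.mul (h.polyGrowth_borel a))
      have e : (fun r : ℝ => η * ((x ^ 2 * ((η * r) ^ 2 + 2 * (η * r)) -
          2 * x * (η * r + 1) + a 0 * (x * (η * r) - 1) + borelD a / 4) * borel a (η * r))) =
          fun r : ℝ => η * ((x ^ 2 * ((η * r) ^ 2 + 2 * (η * r)) +
          (-(2 * x)) * (η * r + 1) + a 0 * (x * (η * r) + (-1)) + borelD a / 4) *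
          borel a (η * r)) := by
        funext r; ring
      rw [e]
      exact h2
    exact hpoly.integrableOn hx
  · simpa using (hPg.tendsto_zero hx).neg

end StokesSibuya

namespace StokesSibuya

open MeasureTheory Set

/-! ### The Laplace integral solves the equation -/

/-- The solution given by the Laplace integral along the ray with direction `η`. -/
noncomputable def rayF (a : Fin 2 → ℂ) (η t : ℂ) : ℂ :=
  exp ((1 - a 0 / 2) * t - exp t) * rayLaplace a η (exp t)

/-- Differentiation under the integral brings down factors `-ηr`, so the equation for `V` is exactly
`RayIn.laplace_identity`. The exponent `μ = 1 - a₁/2` makes `2μ + a₁ = 2`; the extra `1` compensates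
the factor `1/x` produced by the integral. -/
theorem RayIn.exists_solPair {k : ℝ} {η : ℂ} (h : RayIn k η) (a : Fin 2 → ℂ) :
    ∃ F', SolPair a {t | 0 < (exp t * η).re} (rayF a η) F' := by
  set f : ℝ → ℂ := fun r => borel a (η * r) with hfdef
  have hf : PolyGrowth f := h.polyGrowth_borel a
  have hf1 := polyGrowth_id.mul hf
  have hf2 := polyGrowth_id.mul hf1
  have hd : ∀ {g : ℝ → ℂ}, PolyGrowth g → ∀ x : ℂ, 0 < (x * η).re →
      HasDerivAt (fun x => laplace g (x * η)) (-laplace (fun r => r * g r) (x * η) * η) x := by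
    intro g hg x hx
    have h1 : HasDerivAt (fun x : ℂ => x * η) η x := by
      simpa using (hasDerivAt_id x).mul_const η
    exact (hg.hasDerivAt_laplace hx).comp x h1
  refine ⟨_, solPair_of_exp (a := a) (μ := 1 - a 0 / 2) (X := {x | 0 < (x * η).re})
    (V := rayLaplace a η) (V' := fun x => η * (-laplace (fun r => r * f r) (x * η) * η))
    (V'' := fun x => η * (laplace (fun r => r * (r * f r)) (x * η) * η * η)) ?_ ?_ ?_⟩
  · intro x hx
    exact (hd hf x hx).const_mul η
  · intro x hx
    refine ((((hd hf1 x hx).neg).mul_const η).const_mul η).congr_deriv ?_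
    ring
  · intro x hx
    have hx' : 0 < (x * η).re := hx
    have hid := h.laplace_identity a hx'
    have i0 := hf.integrableOn hx'
    have i1 := hf1.integrableOn hx'
    have i2 := hf2.integrableOn hx'
    have hlin : ∀ u v w : ℂ, ∫ r in Ioi (0 : ℝ), exp (-(x * η * r)) *
        (u * (r * (r * f r)) + v * (r * f r) + w * f r) =
        u * laplace (fun r => r * (r * f r)) (x * η) + v * laplace (fun r => r * f r) (x * η) +
          w * laplace f (x * η) := by
      intro u v w
      have i3 := integral_add (f := fun r : ℝ => u * (exp (-(x * η * r)) * (r * (r * f r))) +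
        v * (exp (-(x * η * r)) * (r * f r))) ((i2.const_mul u).add (i1.const_mul v))
        (i0.const_mul w)
      rw [laplace, laplace, laplace, ← integral_const_mul, ← integral_const_mul,
        ← integral_const_mul, ← integral_add (i2.const_mul u) (i1.const_mul v), ← i3]
      congr 1
      funext r
      ring
    have e : (fun r : ℝ => exp (-(x * η * r)) * (η * ((x ^ 2 * ((η * r) ^ 2 + 2 * (η * r)) -
        2 * x * (η * r + 1) + a 0 * (x * (η * r) - 1) + borelD a / 4) * borel a (η * r)))) =
        fun r : ℝ => exp (-(x * η * r)) * (η ^ 3 * x ^ 2 * (r * (r * f r)) +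
          η ^ 2 * (2 * x ^ 2 - 2 * x + a 0 * x) * (r * f r) +
          η * (borelD a / 4 - a 0 - 2 * x) * f r) := by
      funext r
      rw [hfdef]
      ring
    rw [e, hlin] at hid
    rw [rayLaplace]
    change _ + _ + _ * (η * laplace f (x * η)) = 0
    rw [borelD] at hid
    linear_combination hid

/-! ### Watson's lemma -/

theorem laplace_pow {z : ℂ} (hz : 0 < z.re) (n : ℕ) :
    laplace (fun r => (r : ℂ) ^ n) z = n.factorial / z ^ (n + 1) := by
  have hz0 : z ≠ 0 := fun h => by simp [h] at hz
  have hp : ∀ n : ℕ, PolyGrowth fun r : ℝ => (r : ℂ) ^ n := by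
    intro n
    induction n with
    | zero => simpa using polyGrowth_const 1
    | succ n ih => simpa only [pow_succ] using ih.mul polyGrowth_id
  have hE : ∀ r : ℝ, HasDerivAt (fun r : ℝ => exp (-(z * r))) (exp (-(z * r)) * (-z)) r := by
    intro r
    have h1 := ((Complex.ofRealCLM.hasDerivAt (x := r)).const_mul z).neg
    simp only [Complex.ofRealCLM_apply, Complex.ofReal_one, mul_one] at h1
    exact h1.cexp
  induction n with
  | zero =>
    have h1 := integral_Ioi_of_hasDerivAt_of_tendsto' (a := (0 : ℝ)) (m := (0 : ℂ))
      (f := fun r : ℝ => exp (-(z * r))) (fun r _ => hE r)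
      ((polyGrowth_const (-z)).integrableOn hz) (by simpa using (hp 0).tendsto_zero hz)
    rw [integral_mul_const] at h1
    simp only [ofReal_zero, mul_zero, neg_zero, exp_zero, zero_sub] at h1
    have h2 : laplace (fun r => (r : ℂ) ^ 0) z = ∫ r in Ioi (0 : ℝ), exp (-(z * r)) := by
      simp [laplace]
    rw [h2, zero_add, pow_one, Nat.factorial_zero, Nat.cast_one, eq_div_iff hz0]
    linear_combination -h1
  | succ n ih =>
    have hd : ∀ r ∈ Ici (0 : ℝ), HasDerivAt (fun r : ℝ => exp (-(z * r)) * (r : ℂ) ^ (n + 1))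
        (exp (-(z * r)) * ((n + 1 : ℂ) * (r : ℂ) ^ n + (-z) * (r : ℂ) ^ (n + 1))) r := by
      intro r _
      have h1 := ((hasDerivAt_pow (n + 1) (r : ℂ)).comp_ofReal)
      refine ((hE r).mul h1).congr_deriv ?_
      push_cast
      ring
    have h1 := integral_Ioi_of_hasDerivAt_of_tendsto' (a := (0 : ℝ)) (m := (0 : ℂ)) hd
      ((((polyGrowth_const _).mul (hp n)).add ((polyGrowth_const _).mul (hp (n + 1)))).integrableOn
        hz) ((hp (n + 1)).tendsto_zero hz)
    have i0 := ((hp n).integrableOn hz).const_mul ((n : ℂ) + 1)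
    have i1 := ((hp (n + 1)).integrableOn hz).const_mul (-z)
    have h2 : ∫ r in Ioi (0 : ℝ), exp (-(z * r)) * ((n + 1 : ℂ) * (r : ℂ) ^ n +
        (-z) * (r : ℂ) ^ (n + 1)) =
        (n + 1) * laplace (fun r => (r : ℂ) ^ n) z - z * laplace (fun r => (r : ℂ) ^ (n + 1)) z := by
      rw [sub_eq_add_neg, ← neg_mul, laplace, laplace, ← integral_const_mul, ← integral_const_mul,
        ← integral_add i0 i1]
      congr 1
      funext r
      ring
    rw [h2, ih] at h1
    simp only [ofReal_zero, ne_eq, Nat.add_eq_zero_iff, one_ne_zero, and_false, not_false_eq_true,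
      zero_pow, mul_zero, sub_zero] at h1
    rw [Nat.factorial_succ, eq_div_iff (pow_ne_zero _ hz0)]
    push_cast
    field_simp at h1 ⊢
    linear_combination (-1 : ℂ) * h1

theorem pow_mul_exp_neg_le {c : ℝ} (hc : 0 < c) (N : ℕ) {r : ℝ} (hr : 0 ≤ r) :
    r ^ N * Real.exp (-(c * r)) ≤ N.factorial / (c / 2) ^ N * Real.exp (-((c / 2) * r)) := by
  have h := Real.pow_div_factorial_le_exp ((c / 2) * r) (by positivity) N
  have hf : (0 : ℝ) < N.factorial := by exact_mod_cast N.factorial_pos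
  rw [div_le_iff₀ hf, mul_pow] at h
  have e : Real.exp (-(c / 2 * r)) = Real.exp (c / 2 * r) * Real.exp (-(c * r)) := by
    rw [← Real.exp_add]; ring_nf
  rw [e, ← mul_assoc]
  gcongr
  rw [div_mul_eq_mul_div, le_div_iff₀ (by positivity)]
  linarith

/-- Watson's lemma for the Borel transform along a ray, uniform in the ray. -/
theorem rayLaplace_expansion {k δ : ℝ} (hk0 : 0 ≤ k) (hk1 : k < 1) (hδ : 0 < δ) (m N : ℕ) :
    ∃ C : ℝ, 0 ≤ C ∧ ∀ a, parSize a ≤ m + 1 → ∀ η, RayIn k η → ∀ x : ℂ, 1 ≤ ‖x‖ →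
      δ * ‖x‖ ≤ (x * η).re →
      ‖x * rayLaplace a η x - ∑ n ∈ Finset.range N,
        (n.factorial * MvPolynomial.eval a (taylorPoly n)) * x⁻¹ ^ n‖ ≤ C * ‖x⁻¹ ^ N‖ := by
  obtain ⟨C, M, hC, hrem⟩ := borel_remainder hk0 hk1 m N
  set D : ℝ := M.factorial / (δ / 2) ^ M * Real.exp (δ / 2) with hD
  have hD0 : 0 ≤ D := by positivity
  -- Half of the exponential decay is split off, one part absorbing `(1 + r)^M`; of the remaining
  -- rate `δ‖x‖/2`, half absorbs `r ^ N` and the rate `δ‖x‖/4` is integrated.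
  refine ⟨C * D * (N.factorial / (δ / 4) ^ N) * (4 / δ), by positivity,
    fun a ha η hη x hx1 hxre => ?_⟩
  have hx0 : x ≠ 0 := norm_pos_iff.1 (by linarith)
  have hxpos : 0 < ‖x‖ := by linarith
  have hz : 0 < (x * η).re := lt_of_lt_of_le (by positivity) hxre
  have hη0 := hη.ne_zero
  set g : ℕ → ℂ := fun n => MvPolynomial.eval a (taylorPoly n) with hg
  have hrpow : ∀ n : ℕ, PolyGrowth fun r : ℝ => (r : ℂ) ^ n := by
    intro n
    induction n with
    | zero => simpa using polyGrowth_const 1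
    | succ n ih => simpa only [pow_succ] using ih.mul polyGrowth_id
  have hint := (hη.polyGrowth_borel a).integrableOn hz
  have hintn : ∀ n ∈ Finset.range N, IntegrableOn (fun r : ℝ => exp (-(x * η * r)) *
      (g n * η ^ n * (r : ℂ) ^ n)) (Ioi 0) :=
    fun n _ => ((polyGrowth_const _).mul (hrpow n)).integrableOn hz
  have hterm : ∀ n : ℕ, x * η * ∫ r in Ioi (0 : ℝ), exp (-(x * η * r)) *
      (g n * η ^ n * (r : ℂ) ^ n) = (n.factorial * g n) * x⁻¹ ^ n := by
    intro n
    have h1 := laplace_pow hz n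
    rw [laplace] at h1
    have h2 : ∫ r in Ioi (0 : ℝ), exp (-(x * η * r)) * (g n * η ^ n * (r : ℂ) ^ n) =
        g n * η ^ n * ∫ r in Ioi (0 : ℝ), exp (-(x * η * r)) * (r : ℂ) ^ n := by
      rw [← integral_const_mul]
      congr 1
      funext r
      ring
    rw [h2, h1, inv_pow, mul_pow]
    field_simp
    ring
  have heq : x * rayLaplace a η x - ∑ n ∈ Finset.range N, (n.factorial * g n) * x⁻¹ ^ n =
      x * η * ∫ r in Ioi (0 : ℝ), exp (-(x * η * r)) *
        (borel a (η * r) - ∑ n ∈ Finset.range N, g n * (η * r) ^ n) := by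
    have h1 : ∫ r in Ioi (0 : ℝ), exp (-(x * η * r)) *
        (borel a (η * r) - ∑ n ∈ Finset.range N, g n * (η * r) ^ n) =
        (∫ r in Ioi (0 : ℝ), exp (-(x * η * r)) * borel a (η * r)) -
        ∑ n ∈ Finset.range N, ∫ r in Ioi (0 : ℝ), exp (-(x * η * r)) *
          (g n * η ^ n * (r : ℂ) ^ n) := by
      rw [← integral_finsetSum _ hintn, ← integral_sub hint (integrable_finsetSum _ hintn)]
      congr 1
      funext r
      rw [mul_sub, Finset.mul_sum]
      congr 1
      refine Finset.sum_congr rfl fun n _ => ?_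
      rw [mul_pow]
      ring
    rw [h1, mul_sub, Finset.mul_sum]
    congr 1
    · rw [rayLaplace, laplace]; ring
    · exact Finset.sum_congr rfl fun n _ => (hterm n).symm
  rw [heq, norm_mul, norm_mul, hη.norm_eq, mul_one]
  have hc : 0 < δ * ‖x‖ / 4 := by positivity
  have hbound : ‖∫ r in Ioi (0 : ℝ), exp (-(x * η * r)) *
        (borel a (η * r) - ∑ n ∈ Finset.range N, g n * (η * r) ^ n)‖ ≤
      ∫ r in Ioi (0 : ℝ), C * D * (N.factorial / (δ * ‖x‖ / 4) ^ N) *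
        Real.exp (-((δ * ‖x‖ / 4) * r)) := by
    refine norm_integral_le_of_norm_le ((integrableOn_exp_neg_mul hc).const_mul _) ?_
    filter_upwards [ae_restrict_mem measurableSet_Ioi] with r hr
    have hr0 : (0 : ℝ) < r := hr
    have h1 := hrem a ha _ (hη.inSector hr0.le)
    rw [hη.norm_mul hr0.le] at h1
    have h2 := one_add_pow_le_exp (half_pos hδ) M hr0.le
    have h3 := pow_mul_exp_neg_le (c := δ * ‖x‖ / 2) (by positivity) N hr0.le
    have e1 : δ * ‖x‖ / 2 / 2 = δ * ‖x‖ / 4 := by ring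
    rw [e1] at h3
    -- The hypothesis `1 ≤ ‖x‖` frees the decay `e^(-δr/2)`, independent of `x`, that absorbs the
    -- polynomial growth.
    have h4 : Real.exp (-((x * η).re * r)) ≤
        Real.exp (-(δ * ‖x‖ / 2 * r)) * Real.exp (-(δ / 2 * r)) := by
      rw [← Real.exp_add, Real.exp_le_exp]
      nlinarith [mul_nonneg hδ.le hr0.le]
    rw [norm_mul, norm_exp_neg_mul]
    calc _ ≤ (Real.exp (-(δ * ‖x‖ / 2 * r)) * Real.exp (-(δ / 2 * r))) *
          (C * r ^ N * (D * Real.exp (δ / 2 * r))) := by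
          refine mul_le_mul h4 (h1.trans ?_) (norm_nonneg _) (by positivity)
          gcongr
      _ = C * D * (r ^ N * Real.exp (-(δ * ‖x‖ / 2 * r))) *
          (Real.exp (-(δ / 2 * r)) * Real.exp (δ / 2 * r)) := by ring
      _ = C * D * (r ^ N * Real.exp (-(δ * ‖x‖ / 2 * r))) := by
          rw [← Real.exp_add]; simp
      _ ≤ C * D * (N.factorial / (δ * ‖x‖ / 4) ^ N * Real.exp (-(δ * ‖x‖ / 4 * r))) := by gcongr
      _ = _ := by ring
  have hexp : ∫ r in Ioi (0 : ℝ), Real.exp (-((δ * ‖x‖ / 4) * r)) = (δ * ‖x‖ / 4)⁻¹ := by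
    have := integral_exp_neg_mul_rpow (p := 1) (b := δ * ‖x‖ / 4) one_pos hc
    simpa [Real.rpow_neg_one, Real.Gamma_two, one_add_one_eq_two] using this
  rw [integral_const_mul, hexp] at hbound
  calc _ ≤ ‖x‖ * (C * D * (N.factorial / (δ * ‖x‖ / 4) ^ N) * (δ * ‖x‖ / 4)⁻¹) := by gcongr
    _ = _ := by
      rw [norm_pow, norm_inv, inv_pow]
      have : δ * ‖x‖ / 4 = (δ / 4) * ‖x‖ := by ring
      rw [this, mul_pow]
      field_simp

end StokesSibuya

namespace StokesSibuya

open MeasureTheory Set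

/-! ### The subdominant solution: rotation of the ray, existence and uniqueness -/

theorem prefactor_ne_zero (a : Fin 2 → ℂ) (t : ℂ) : prefactor a t ≠ 0 :=
  mul_ne_zero (exp_ne_zero _) (exp_ne_zero _)

theorem rayF_eq (a : Fin 2 → ℂ) (η t : ℂ) :
    rayF a η t = prefactor a t * (exp t * rayLaplace a η (exp t)) := by
  rw [rayF, prefactor, ← mul_assoc, ← exp_add, ← exp_add]
  congr 2
  ring

/-- `F` is asymptotic to the prefactor at the end of the strip `|im t - y| ≤ δ`. -/
def HasLead (a : Fin 2 → ℂ) (y δ : ℝ) (F : ℂ → ℂ) : Prop :=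
  ∃ C R : ℝ, ∀ t : ℂ, |t.im - y| ≤ δ → R ≤ ‖exp t‖ →
    ‖F t - prefactor a t‖ ≤ C * ‖prefactor a t * (exp t)⁻¹‖

theorem tendsto_re_stripEnd (y δ : ℝ) : Tendsto re (stripEnd y δ) atTop :=
  tendsto_comap.mono_left inf_le_left

theorem tendsto_norm_exp_stripEnd (y δ : ℝ) :
    Tendsto (fun t => ‖exp t‖) (stripEnd y δ) atTop := by
  simp only [Complex.norm_exp]
  exact Real.tendsto_exp_atTop.comp (tendsto_re_stripEnd y δ)

theorem eventually_mem_stripEnd (y δ : ℝ) : ∀ᶠ t in stripEnd y δ, |t.im - y| ≤ δ :=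
  eventually_stripEnd.2 ⟨0, fun _ _ h => h⟩

theorem tendsto_line_stripEnd (y : ℝ) {δ : ℝ} (hδ : 0 ≤ δ) :
    Tendsto (fun x : ℝ => (x : ℂ) + y * I) atTop (stripEnd y δ) := by
  refine tendsto_inf.2 ⟨tendsto_comap_iff.2 ?_, tendsto_principal.2 (Eventually.of_forall ?_)⟩
  · have e : re ∘ (fun x : ℝ => (x : ℂ) + y * I) = id := by ext x; simp
    rw [e]
    exact tendsto_id
  · intro x; simp [hδ]

/-- Exponentials which are dominated by `exp (-exp t)` in a half-strip. -/
theorem tendsto_exp_sub_exp {y δ : ℝ} (hδ : 0 ≤ δ) (hyδ : |y| + δ < Real.pi / 2) (μ : ℂ) :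
    Tendsto (fun t => exp (μ * t - exp t)) (stripEnd y δ) (𝓝 0) := by
  set c := Real.cos (|y| + δ) with hc
  have hc0 : 0 < c := Real.cos_pos_of_mem_Ioo
    ⟨by linarith [abs_nonneg y, Real.pi_pos], hyδ⟩
  have hlim : Tendsto (fun t : ℂ => Real.exp (-t.re + ‖μ‖ * (Real.pi / 2))) (stripEnd y δ) (𝓝 0) := by
    have h1 : Tendsto (fun t : ℂ => -t.re + ‖μ‖ * (Real.pi / 2)) (stripEnd y δ) atBot :=
      tendsto_atBot_add_const_right _ _ (tendsto_neg_atTop_atBot.comp (tendsto_re_stripEnd y δ))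
    exact Real.tendsto_exp_atBot.comp h1
  refine squeeze_zero_norm' ?_ hlim
  have hbig := (tendsto_re_stripEnd y δ).eventually_ge_atTop (2 * (‖μ‖ + 1) / c)
  filter_upwards [hbig, eventually_mem_stripEnd y δ] with t ht him
  have hre0 : 0 ≤ t.re := le_trans (by positivity) ht
  rw [Complex.norm_exp, Real.exp_le_exp, Complex.sub_re, Complex.exp_re]
  have h1 : |t.im| ≤ |y| + δ := by
    have : |t.im| ≤ |t.im - y| + |y| := by simpa using abs_add_le (t.im - y) y
    linarith
  have h2 : c ≤ Real.cos t.im := by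
    rw [← Real.cos_abs t.im]
    exact Real.cos_le_cos_of_nonneg_of_le_pi (abs_nonneg _) (by linarith [Real.pi_pos]) h1
  have h3 : (μ * t).re ≤ ‖μ‖ * t.re + ‖μ‖ * (Real.pi / 2) := by
    have h4 := (re_le_norm (μ * t)).trans_eq (norm_mul μ t)
    have h5 := Complex.norm_le_abs_re_add_abs_im t
    rw [abs_of_nonneg hre0] at h5
    nlinarith [norm_nonneg μ, mul_le_mul_of_nonneg_left h5 (norm_nonneg μ),
      mul_le_mul_of_nonneg_left (h1.trans hyδ.le) (norm_nonneg μ)]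
  have h6 : t.re ^ 2 / 2 ≤ Real.exp t.re := by
    linarith [Real.quadratic_le_exp_of_nonneg hre0]
  have h7 : (‖μ‖ + 1) * t.re ≤ Real.exp t.re * Real.cos t.im := by
    rw [div_le_iff₀ hc0] at ht
    calc (‖μ‖ + 1) * t.re ≤ t.re ^ 2 / 2 * c := by nlinarith
      _ ≤ _ := by gcongr
  linarith

theorem tendsto_prefactor {y δ : ℝ} (hδ : 0 ≤ δ) (hyδ : |y| + δ < Real.pi / 2) (a : Fin 2 → ℂ) :
    Tendsto (prefactor a) (stripEnd y δ) (𝓝 0) := by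
  refine (tendsto_exp_sub_exp hδ hyδ (-(a 0) / 2)).congr fun t => ?_
  rw [prefactor, ← exp_add, sub_eq_add_neg]

theorem HasLead.tendsto_div {a : Fin 2 → ℂ} {y δ : ℝ} {F : ℂ → ℂ} (h : HasLead a y δ F) :
    Tendsto (fun t => F t / prefactor a t) (stripEnd y δ) (𝓝 1) := by
  obtain ⟨C, R, hCR⟩ := h
  have h0 : Tendsto (fun t => C * ‖exp t‖⁻¹) (stripEnd y δ) (𝓝 0) := by
    simpa using (tendsto_norm_exp_stripEnd y δ).inv_tendsto_atTop.const_mul C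
  rw [tendsto_iff_norm_sub_tendsto_zero]
  refine squeeze_zero' (Eventually.of_forall fun _ => norm_nonneg _) ?_ h0
  filter_upwards [eventually_mem_stripEnd y δ,
    (tendsto_norm_exp_stripEnd y δ).eventually_ge_atTop R] with t h1 h2
  have hp := prefactor_ne_zero a t
  have hp' : 0 < ‖prefactor a t‖ := norm_pos_iff.2 hp
  have h3 := hCR t h1 h2
  have e : F t / prefactor a t - 1 = (F t - prefactor a t) / prefactor a t := by field_simp
  rw [e, norm_div, div_le_iff₀ hp']
  rw [norm_mul, norm_inv] at h3
  linarith

theorem HasLead.tendsto_zero {a : Fin 2 → ℂ} {y δ : ℝ} {F : ℂ → ℂ} (h : HasLead a y δ F)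
    (hδ : 0 ≤ δ) (hyδ : |y| + δ < Real.pi / 2) : Tendsto F (stripEnd y δ) (𝓝 0) := by
  have := h.tendsto_div.mul (tendsto_prefactor hδ hyδ a)
  rw [mul_zero] at this
  exact this.congr fun t => div_mul_cancel₀ _ (prefactor_ne_zero a t)

/-- Entire solutions which are asymptotic to the prefactor in the same strip are equal. -/
theorem SolPair.eq_of_hasLead {a : Fin 2 → ℂ} {F F' G G' : ℂ → ℂ} (hF : SolPair a Set.univ F F')
    (hG : SolPair a Set.univ G G') {y δ : ℝ} (hδ : 0 < δ) (hyδ : |y| + δ < Real.pi / 2)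
    (hF1 : HasLead a y δ F) (hG1 : HasLead a y δ G) : F = G := by
  have hline := tendsto_line_stripEnd y hδ.le
  have hFl := hF1.tendsto_div.comp hline
  have hGl := hG1.tendsto_div.comp hline
  obtain ⟨x, hx⟩ := (hGl.eventually_ne one_ne_zero).exists
  have hne : G ((x : ℂ) + y * I) ≠ 0 := fun h => hx (by simp [h])
  obtain ⟨c, hc⟩ := hF.proportional_of_recessive hG hδ (hF1.tendsto_zero hδ.le hyδ)
    (hG1.tendsto_zero hδ.le hyδ) hne
  have h1 : Tendsto (fun x : ℝ => c * (G (x + y * I) / prefactor a (x + y * I))) atTop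
      (𝓝 (c * 1)) := hGl.const_mul c
  have h2 : c * 1 = 1 := by
    refine tendsto_nhds_unique h1 (hFl.congr fun x => ?_)
    simp only [Function.comp_def]
    rw [hc, mul_div_assoc]
  funext t
  rw [hc t, show c = 1 by simpa using h2, one_mul]

theorem exp_mul_exp_re (t : ℂ) (ψ : ℝ) :
    (exp t * exp (ψ * I)).re = ‖exp t‖ * Real.cos (t.im + ψ) := by
  rw [← exp_add, exp_re, Complex.norm_exp]
  simp

theorem rayIn_exp {k ψ : ℝ} (hk0 : 0 ≤ k) (hk1 : k < 1) (h : -k ≤ Real.cos ψ) :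
    RayIn k (exp (ψ * I)) := by
  refine ⟨hk0, hk1, Complex.norm_exp_ofReal_mul_I ψ, ?_⟩
  rw [exp_re]
  simpa using h

/-- One constant `k` serves all rays of argument at most `θ`, which makes Watson's lemma uniform
while the ray turns. -/
theorem exists_rayIn {θ : ℝ} (hθ0 : 0 ≤ θ) (hθ : θ < Real.pi) :
    ∃ k : ℝ, 0 ≤ k ∧ k < 1 ∧ ∀ ψ : ℝ, |ψ| ≤ θ → RayIn k (exp (ψ * I)) := by
  have h1 : -1 < Real.cos θ := by
    rw [← Real.cos_pi]
    exact Real.cos_lt_cos_of_nonneg_of_le_pi hθ0 le_rfl hθ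
  refine ⟨max 0 (-Real.cos θ), le_max_left _ _, max_lt one_pos (by linarith), fun ψ hψ =>
    rayIn_exp (le_max_left _ _) (max_lt one_pos (by linarith)) ?_⟩
  have h2 : Real.cos θ ≤ Real.cos ψ := by
    rw [← Real.cos_abs ψ]
    exact Real.cos_le_cos_of_nonneg_of_le_pi (abs_nonneg _) hθ.le hψ
  have := le_max_right 0 (-Real.cos θ)
  linarith

/-- The open strip on which the Laplace integral along the ray of argument `ψ` converges. -/
def rayStrip (ψ : ℝ) : Set ℂ := {t | |t.im + ψ| < Real.pi / 2}

theorem isOpen_rayStrip (ψ : ℝ) : IsOpen (rayStrip ψ) :=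
  isOpen_lt (by fun_prop) continuous_const

theorem convex_rayStrip (ψ : ℝ) : Convex ℝ (rayStrip ψ) := by
  have e : rayStrip ψ = Complex.imLm ⁻¹' (Ioo (-(Real.pi / 2) - ψ) (Real.pi / 2 - ψ)) := by
    ext t
    simp only [rayStrip, mem_ofPred_eq, abs_lt, mem_preimage, mem_Ioo, Complex.imLm_coe]
    constructor <;> rintro ⟨h1, h2⟩ <;> constructor <;> linarith
  rw [e]
  exact (convex_Ioo _ _).linear_preimage _

theorem pos_of_mem_rayStrip {ψ : ℝ} {t : ℂ} (ht : t ∈ rayStrip ψ) :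
    0 < (exp t * exp (ψ * I)).re := by
  rw [exp_mul_exp_re]
  have h := abs_lt.1 (show |t.im + ψ| < Real.pi / 2 from ht)
  exact mul_pos (norm_pos_iff.2 (exp_ne_zero t)) (Real.cos_pos_of_mem_Ioo ⟨h.1, h.2⟩)

theorem exists_entire_rayF (a : Fin 2 → ℂ) {ψ : ℝ} (hψ : |ψ| < Real.pi) :
    ∃ E E', SolPair a univ E E' ∧ ∀ t ∈ rayStrip ψ, E t = rayF a (exp (ψ * I)) t := by
  obtain ⟨k, hk0, hk1, hk⟩ := exists_rayIn (abs_nonneg ψ) hψ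
  obtain ⟨F', hF'⟩ := (hk ψ le_rfl).exists_solPair a
  obtain ⟨E, E', hE, hEF⟩ := (hF'.mono fun t ht => pos_of_mem_rayStrip ht).exists_extension
    (isOpen_rayStrip ψ) (convex_rayStrip ψ).isPreconnected
  exact ⟨E, E', hE, fun t ht => (hEF t ht).1⟩

theorem eval_taylorPoly_zero (a : Fin 2 → ℂ) : MvPolynomial.eval a (taylorPoly 0) = 1 := by
  rw [eval_taylorPoly]
  simp [quotCoeff_zero, borelCoeff_zero]

/-- The case `N = 1` of Watson's lemma; the condition keeps `re (xη)` above a fixed multiple of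
`‖x‖` throughout the strip. -/
theorem hasLead_rayF (a : Fin 2 → ℂ) {ψ : ℝ} (hψ : |ψ| < Real.pi) {y δ : ℝ} (hδ : 0 ≤ δ)
    (h : |y + ψ| + δ < Real.pi / 2) : HasLead a y δ (rayF a (exp (ψ * I))) := by
  obtain ⟨k, hk0, hk1, hk⟩ := exists_rayIn (abs_nonneg ψ) hψ
  obtain ⟨m, hm⟩ := exists_parSize_le a
  have hc : 0 < Real.cos (|y + ψ| + δ) := Real.cos_pos_of_mem_Ioo
    ⟨by linarith [abs_nonneg (y + ψ), Real.pi_pos], h⟩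
  obtain ⟨C, hC, hexp⟩ := rayLaplace_expansion hk0 hk1 hc m 1
  refine ⟨C, 1, fun t ht hR => ?_⟩
  have h1 := hexp a hm _ (hk ψ le_rfl) (exp t) hR (by
    rw [exp_mul_exp_re, mul_comm, ← Real.cos_abs (t.im + ψ)]
    refine mul_le_mul_of_nonneg_left ?_ (norm_nonneg _)
    refine Real.cos_le_cos_of_nonneg_of_le_pi (abs_nonneg _) (by linarith [Real.pi_pos]) ?_
    have : |t.im + ψ| ≤ |t.im - y| + |y + ψ| := by
      have := abs_add_le (t.im - y) (y + ψ)
      rwa [show t.im - y + (y + ψ) = t.im + ψ by ring] at this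
    linarith)
  simp only [Finset.range_one, Finset.sum_singleton, Nat.factorial_zero, Nat.cast_one,
    pow_zero, mul_one, eval_taylorPoly_zero, pow_one] at h1
  rw [rayF_eq, ← mul_sub_one, norm_mul, norm_mul, mul_left_comm]
  gcongr

theorem HasLead.congr {a : Fin 2 → ℂ} {y δ : ℝ} {F G : ℂ → ℂ} (h : HasLead a y δ F)
    (he : ∀ t : ℂ, |t.im - y| ≤ δ → F t = G t) : HasLead a y δ G := by
  obtain ⟨C, R, hCR⟩ := h
  exact ⟨C, R, fun t h1 h2 => he t h1 ▸ hCR t h1 h2⟩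

/-- The Laplace integrals along all rays define the same entire solution. -/
theorem exists_subdominant (a : Fin 2 → ℂ) : ∃ E : ℂ → ℂ, IsSolution a E ∧
    ∀ ψ : ℝ, |ψ| < Real.pi → ∀ t ∈ rayStrip ψ, E t = rayF a (exp (ψ * I)) t := by
  obtain ⟨E, E', hE, hEF⟩ := exists_entire_rayF a (ψ := 0) (by simpa using Real.pi_pos)
  refine ⟨E, hE.isSolution, fun ψ hψ t ht => ?_⟩
  obtain ⟨G, G', hG, hGF⟩ := exists_entire_rayF a hψ
  -- On `arg x = -ψ/2` the integrals along the rays of arguments `0` and `ψ` both converge, and the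
  -- prefactor decays, so the two solutions can be compared there.
  have hψ2 : |ψ| / 2 < Real.pi / 2 := by linarith
  obtain ⟨δ, hδ0, hδ1⟩ := exists_between (sub_pos.2 hψ2)
  have e1 : |-ψ / 2| = |ψ| / 2 := by rw [abs_div, abs_neg, abs_two]
  have e2 : |-ψ / 2 + ψ| = |ψ| / 2 := by
    rw [show -ψ / 2 + ψ = ψ / 2 by ring, abs_div, abs_two]
  have h1 : HasLead a (-ψ / 2) δ E := by
    refine (hasLead_rayF a (ψ := 0) (by simpa using Real.pi_pos) hδ0.le
      (by rw [add_zero, e1]; linarith)).congr fun t ht => (hEF t ?_).symm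
    change |t.im + 0| < _
    have := abs_add_le (t.im - -ψ / 2) (-ψ / 2)
    rw [e1, sub_add_cancel] at this
    rw [add_zero]
    linarith
  have h2 : HasLead a (-ψ / 2) δ G := by
    refine (hasLead_rayF a hψ hδ0.le (by rw [e2]; linarith)).congr fun t ht => (hGF t ?_).symm
    change |t.im + ψ| < _
    have := abs_add_le (t.im - -ψ / 2) (-ψ / 2 + ψ)
    rw [e2, show t.im - -ψ / 2 + (-ψ / 2 + ψ) = t.im + ψ by ring] at this
    linarith
  have := hE.eq_of_hasLead hG hδ0 (by rw [e1]; linarith) h1 h2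
  rw [this]
  exact hGF t ht

/-- The subdominant solution, continued to the universal covering. -/
noncomputable def subdominant (t : ℂ) (a : Fin 2 → ℂ) : ℂ :=
  Classical.choose (exists_subdominant a) t

theorem isSolution_subdominant (a : Fin 2 → ℂ) : IsSolution a fun t => subdominant t a :=
  (Classical.choose_spec (exists_subdominant a)).1

theorem subdominant_eq (a : Fin 2 → ℂ) {ψ : ℝ} (hψ : |ψ| < Real.pi) {t : ℂ} (ht : t ∈ rayStrip ψ) :
    subdominant t a = rayF a (exp (ψ * I)) t :=
  (Classical.choose_spec (exists_subdominant a)).2 ψ hψ t ht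

/-- Termwise Laplace transformation sends `s ^ n` to `n! / x ^ (n+1)`, which explains the factorials
in the formal series. The sector of opening `3π` is covered by letting the ray depend on `arg x`. -/
theorem isPhi0_subdominant : IsPhi0 subdominant := by
  refine ⟨isSolution_subdominant,
    PowerSeries.mk fun n => MvPolynomial.C (n.factorial : ℂ) * taylorPoly n, ?_, ?_⟩
  · rw [← PowerSeries.coeff_zero_eq_constantCoeff_apply, PowerSeries.coeff_mk, taylorPoly]
    simp [quotCoeff_zero, borelPoly]
  · intro θ hθ K hK N
    rcases lt_or_ge θ 0 with hneg | hθ0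
    · exact ⟨0, 0, fun a _ t ht => absurd ((abs_nonneg _).trans ht) (not_le.2 hneg)⟩
    obtain ⟨B, hB⟩ := (hK.image continuous_parSize).bddAbove
    obtain ⟨m, hm⟩ := exists_nat_ge B
    obtain ⟨k, hk0, hk1, hk⟩ := exists_rayIn (θ := 2 * θ / 3) (by linarith) (by linarith)
    have hc : 0 < Real.cos (θ / 3) := Real.cos_pos_of_mem_Ioo
      ⟨by linarith [Real.pi_pos], by linarith⟩
    obtain ⟨C, hC, hexp⟩ := rayLaplace_expansion hk0 hk1 hc m N
    refine ⟨C, 1, fun a ha t ht hR => ?_⟩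
    have hpar : parSize a ≤ m + 1 := by linarith [hB (mem_image_of_mem parSize ha)]
    -- The ray of argument `-2 arg x / 3` leaves `arg (xη) = arg x / 3`. For `|arg x| ≤ θ < 3π/2`
    -- the ray stays away from the cut and `arg (xη)` stays away from `±π/2`, with uniform margins.
    have hψ : |-(2 * t.im / 3)| ≤ 2 * θ / 3 := by
      rw [abs_neg, abs_div, abs_mul, abs_two, abs_of_pos (three_pos : (0 : ℝ) < 3)]
      linarith
    have him : t.im + -(2 * t.im / 3) = t.im / 3 := by ring
    have him3 : |t.im / 3| ≤ θ / 3 := by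
      rw [abs_div, abs_of_pos (three_pos : (0 : ℝ) < 3)]
      linarith
    have hmem : t ∈ rayStrip (-(2 * t.im / 3)) := by
      change |t.im + -(2 * t.im / 3)| < _
      rw [him]
      linarith
    have h1 := hexp a hpar _ (hk _ hψ) (exp t) hR (by
      rw [exp_mul_exp_re, mul_comm, him, ← Real.cos_abs (t.im / 3)]
      exact mul_le_mul_of_nonneg_left (Real.cos_le_cos_of_nonneg_of_le_pi (abs_nonneg _)
        (by linarith [Real.pi_pos]) him3) (norm_nonneg _))
    rw [subdominant_eq a (by linarith) hmem, rayF_eq, ← mul_sub, norm_mul, norm_mul,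
      mul_left_comm]
    simp only [PowerSeries.coeff_mk, map_mul, MvPolynomial.eval_C]
    gcongr

theorem IsPhi0.hasLead {Φ : ℂ → (Fin 2 → ℂ) → ℂ} (h : IsPhi0 Φ) (a : Fin 2 → ℂ) {y δ : ℝ}
    (hyδ : |y| + δ < 3 * Real.pi / 2) : HasLead a y δ fun t => Φ t a := by
  obtain ⟨_, φ, h1, h2⟩ := h
  obtain ⟨C, R, hCR⟩ := h2 _ hyδ {a} isCompact_singleton 1
  refine ⟨C, R, fun t ht hR => ?_⟩
  have h3 := hCR a rfl t (by
    have := abs_add_le (t.im - y) y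
    rw [sub_add_cancel] at this
    linarith) hR
  rw [← PowerSeries.coeff_zero_eq_constantCoeff_apply] at h1
  simpa [h1] using h3

/-- Uniqueness of the subdominant solution. -/
theorem IsPhi0.eq_subdominant {Φ : ℂ → (Fin 2 → ℂ) → ℂ} (h : IsPhi0 Φ) : Φ = subdominant := by
  have key : ∀ a, (fun t => Φ t a) = fun t => subdominant t a := fun a =>
    ((isSolution_iff a _).1 (h.1 a)).eq_of_hasLead ((isSolution_iff a _).1
      (isSolution_subdominant a)) (y := 0) (δ := 1) one_pos
      (by rw [abs_zero]; linarith [Real.pi_gt_three])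
      (h.hasLead a (by rw [abs_zero]; linarith [Real.pi_gt_three]))
      (isPhi0_subdominant.hasLead a (by rw [abs_zero]; linarith [Real.pi_gt_three]))
  funext t a
  exact congrFun (key a) t

end StokesSibuya

namespace StokesSibuya

open MeasureTheory Set

/-! ### Holomorphic dependence on the parameter -/

theorem differentiable_eval {f : ℂ → Fin 2 → ℂ} (hf : ∀ i, Differentiable ℂ fun p => f p i)
    (P : MvPolynomial (Fin 2) ℂ) : Differentiable ℂ fun p => MvPolynomial.eval (f p) P := by
  induction P using MvPolynomial.induction_on with
  | C c => simp
  | add P Q hP hQ => simp only [map_add]; exact hP.add hQ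
  | mul_X P i hP => simp only [map_mul, MvPolynomial.eval_X]; exact hP.mul (hf i)

/-- Summing under the integral produces `(1 - |w|)^(-(m+1))`, which has polynomial growth along the
ray and is integrable against `e^(-cr)`. -/
theorem RayIn.summable_moments {k : ℝ} {η : ℂ} (h : RayIn k η) {c : ℝ} (hc : 0 < c) (m : ℕ) :
    Summable fun n : ℕ => ((n + m).choose m : ℝ) *
      ∫ r in Ioi (0 : ℝ), Real.exp (-(c * r)) * ‖slitVar (η * r)‖ ^ n := by
  have hsc := sectorConst_pos h.lt_one
  have hcont : ContinuousOn (fun r : ℝ => ‖slitVar (η * r)‖) (Ioi 0) :=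
    (h.continuousOn_slitVar.mono Ioi_subset_Ici_self).norm
  have hlt : ∀ r ∈ Ioi (0 : ℝ), ‖slitVar (η * r)‖ < 1 := fun r hr =>
    norm_slitVar_lt_one (h.mem (le_of_lt hr))
  have hint : ∀ n : ℕ, IntegrableOn (fun r : ℝ => Real.exp (-(c * r)) * ‖slitVar (η * r)‖ ^ n)
      (Ioi 0) := by
    intro n
    refine Integrable.mono' (integrableOn_exp_neg_mul hc) ?_ ?_
    · refine ContinuousOn.aestronglyMeasurable ?_ measurableSet_Ioi
      exact (by fun_prop : Continuous fun r : ℝ => Real.exp (-(c * r))).continuousOn.mul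
        (hcont.pow n)
    · filter_upwards [ae_restrict_mem measurableSet_Ioi] with r hr
      rw [Real.norm_of_nonneg (by positivity)]
      exact mul_le_of_le_one_right (Real.exp_pos _).le (pow_le_one₀ (norm_nonneg _) (hlt r hr).le)
  refine summable_of_sum_range_le (c := ∫ r in Ioi (0 : ℝ), (sectorConst k ^ (m + 1))⁻¹ *
    ((1 + r) ^ (m + 1) * Real.exp (-(c * r)))) (fun n => ?_) (fun N => ?_)
  · exact mul_nonneg (Nat.cast_nonneg _) (integral_nonneg fun r => by positivity)
  · simp_rw [← integral_const_mul]
    rw [← integral_finsetSum _ fun n _ => (hint n).const_mul _]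
    refine setIntegral_mono_on (integrable_finsetSum _ fun n _ => (hint n).const_mul _)
      ((integrableOn_one_add_pow_mul_exp hc (m + 1)).const_mul _) measurableSet_Ioi fun r hr => ?_
    have hr0 : (0 : ℝ) < r := hr
    have h1 := (h.inSector hr0.le).one_sub_norm_slitVar h.nonneg h.lt_one
    rw [h.norm_mul hr0.le] at h1
    have h2 : ∑ n ∈ Finset.range N, ((n + m).choose m : ℝ) * ‖slitVar (η * r)‖ ^ n ≤
        ((1 - ‖slitVar (η * r)‖) ^ (m + 1))⁻¹ := by
      rw [← tsum_choose_mul_pow m (norm_nonneg _) (hlt r hr)]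
      exact (summable_choose_mul_pow m (norm_nonneg _) (hlt r hr)).sum_le_tsum _
        fun n _ => by positivity
    have h3 : ((1 - ‖slitVar (η * r)‖) ^ (m + 1))⁻¹ ≤ ((sectorConst k / (1 + r)) ^ (m + 1))⁻¹ := by
      gcongr
    calc _ = (∑ n ∈ Finset.range N, ((n + m).choose m : ℝ) * ‖slitVar (η * r)‖ ^ n) *
          Real.exp (-(c * r)) := by
          rw [Finset.sum_mul]
          exact Finset.sum_congr rfl fun n _ => by ring
      _ ≤ ((sectorConst k / (1 + r)) ^ (m + 1))⁻¹ * Real.exp (-(c * r)) := by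
          gcongr
          exact h2.trans h3
      _ = _ := by
          rw [div_pow, inv_div]
          ring

/-- Sum and integral can be exchanged because the moments are absolutely summable. In this form the
parameters enter only through the polynomial coefficients. -/
theorem RayIn.laplace_borel_eq {k : ℝ} {η : ℂ} (h : RayIn k η) (a : Fin 2 → ℂ) {z : ℂ}
    (hz : 0 < z.re) : laplace (fun r => borel a (η * r)) z = ∑' n : ℕ, borelCoeff a n *
      ∫ r in Ioi (0 : ℝ), exp (-(z * r)) * slitVar (η * r) ^ n := by
  obtain ⟨m, hm⟩ := exists_parSize_le a
  have hcont := h.continuousOn_slitVar.mono Ioi_subset_Ici_self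
  have hlt : ∀ r ∈ Ioi (0 : ℝ), ‖slitVar (η * r)‖ < 1 := fun r hr =>
    norm_slitVar_lt_one (h.mem (le_of_lt hr))
  have hpg : ∀ n : ℕ, PolyGrowth fun r => slitVar (η * r) ^ n := by
    intro n
    refine ⟨hcont.pow n, 1, 0, zero_le_one, fun r hr => ?_⟩
    rw [norm_pow]
    simpa using pow_le_one₀ (norm_nonneg _) (hlt r hr).le
  have hint := fun n => ((hpg n).integrableOn hz).const_mul (borelCoeff a n)
  have hsum : Summable fun n : ℕ => ∫ r in Ioi (0 : ℝ),
      ‖borelCoeff a n * (exp (-(z * r)) * slitVar (η * r) ^ n)‖ := by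
    refine Summable.of_nonneg_of_le (fun n => integral_nonneg fun r => norm_nonneg _) (fun n => ?_)
      (h.summable_moments hz m)
    simp only [_root_.norm_mul, norm_pow, norm_exp_neg_mul]
    rw [integral_const_mul]
    exact mul_le_mul_of_nonneg_right (norm_borelCoeff_le hm n)
      (integral_nonneg fun r => by positivity)
  have := (hasSum_integral_of_summable_integral_norm hint hsum).tsum_eq
  simp only [integral_const_mul] at this
  rw [this, laplace]
  congr 1
  funext r
  rw [borel, psum, ← tsum_mul_left]
  congr 1
  funext n
  ring

/-- A locally uniformly convergent series of holomorphic functions: on the open set where the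
parameter bound is less than `m + 1`, one binomial majorant controls all terms. -/
theorem differentiable_laplace_borel {f : ℂ → Fin 2 → ℂ} (hf : ∀ i, Differentiable ℂ fun p => f p i)
    {k : ℝ} {η : ℂ} (h : RayIn k η) {z : ℂ} (hz : 0 < z.re) :
    Differentiable ℂ fun p => laplace (fun r => borel (f p) (η * r)) z := by
  intro p₀
  have hcts : Continuous fun p => parSize (f p) :=
    continuous_parSize.comp (continuous_pi fun i => (hf i).continuous)
  obtain ⟨m, hm⟩ := exists_nat_ge (parSize (f p₀))
  set U : Set ℂ := {p | parSize (f p) < m + 1} with hU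
  have hUo : IsOpen U := isOpen_lt hcts continuous_const
  have hp₀ : p₀ ∈ U := by
    change parSize (f p₀) < m + 1
    linarith
  have e : (fun p => laplace (fun r => borel (f p) (η * r)) z) = fun p => ∑' n : ℕ,
      borelCoeff (f p) n * ∫ r in Ioi (0 : ℝ), exp (-(z * r)) * slitVar (η * r) ^ n :=
    funext fun p => h.laplace_borel_eq (f p) hz
  rw [e]
  refine (differentiableOn_tsum_of_summable_norm (h.summable_moments hz m) (fun n => ?_) hUo
    (fun n p hp => ?_)).differentiableAt (hUo.mem_nhds hp₀)
  · exact ((differentiable_eval hf _).mul_const _).differentiableOn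
  · rw [norm_mul]
    have hp' : parSize (f p) < m + 1 := hp
    refine mul_le_mul (norm_borelCoeff_le hp'.le n) ?_ (norm_nonneg _) (Nat.cast_nonneg _)
    refine (norm_integral_le_integral_norm _).trans_eq ?_
    simp only [norm_mul, norm_pow, norm_exp_neg_mul]

/-- The parameter with given `a₁` and exponents `(1 ± p) / 2` at the origin. -/
noncomputable def expPar (a₁ p : ℂ) : Fin 2 → ℂ := ![a₁, (p ^ 2 - 1) / 4]

/-- For each such `t` a fixed ray represents `Φ₀` at all parameters. The restriction on `arg x` is
harmless later, since only arguments in this range are used to continue in `p`. -/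
theorem differentiable_subdominant (a₁ : ℂ) {t : ℂ} (ht : |t.im| < 3 * Real.pi / 2) :
    Differentiable ℂ fun p => subdominant t (expPar a₁ p) := by
  have hψ : |-(2 * t.im / 3)| < Real.pi := by
    rw [abs_neg, abs_div, abs_mul, abs_two, abs_of_pos (three_pos : (0 : ℝ) < 3)]
    linarith
  have hmem : t ∈ rayStrip (-(2 * t.im / 3)) := by
    change |t.im + -(2 * t.im / 3)| < _
    rw [show t.im + -(2 * t.im / 3) = t.im / 3 by ring, abs_div,
      abs_of_pos (three_pos : (0 : ℝ) < 3)]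
    linarith
  obtain ⟨k, hk0, hk1, hk⟩ := exists_rayIn (abs_nonneg _) hψ
  have hf : ∀ i, Differentiable ℂ fun p => expPar a₁ p i := by
    intro i
    fin_cases i
    · simp [expPar]
    · simp only [expPar]
      exact ((differentiable_id.pow 2).sub_const 1).div_const 4
  have h1 := differentiable_laplace_borel hf (hk _ le_rfl) (pos_of_mem_rayStrip hmem)
  have e : (fun p => subdominant t (expPar a₁ p)) = fun p =>
      exp ((1 - a₁ / 2) * t - exp t) * (exp ((-(2 * t.im / 3) : ℝ) * I) *
        laplace (fun r => borel (expPar a₁ p) (exp ((-(2 * t.im / 3) : ℝ) * I) * r))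
          (exp t * exp ((-(2 * t.im / 3) : ℝ) * I))) := by
    funext p
    rw [subdominant_eq _ hψ hmem]
    rfl
  rw [e]
  exact (h1.const_mul _).const_mul _

end StokesSibuya

namespace StokesSibuya

/-! ### Frobenius solutions at the origin -/

/-- The complement of the integers. -/
def nonInt : Set ℂ := (Set.range fun n : ℤ => (n : ℂ))ᶜ

theorem mem_nonInt {p : ℂ} : p ∈ nonInt ↔ ∀ n : ℤ, p ≠ n := by
  simp [nonInt, eq_comm]

theorem isOpen_nonInt : IsOpen nonInt := Complex.isOpen_compl_range_intCast

theorem neg_mem_nonInt {p : ℂ} (hp : p ∈ nonInt) : -p ∈ nonInt := by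
  rw [mem_nonInt] at hp ⊢
  intro n hn
  exact hp (-n) (by rw [← neg_neg p, hn]; push_cast; rfl)

/-- A lower bound, uniform for `q` near `p`, for the denominators of the Frobenius recursion. -/
theorem exists_dist_nonInt {p : ℂ} (hp : p ∈ nonInt) : ∃ δ > 0,
    ∀ q ∈ Metric.ball p δ, ∀ n : ℕ, δ ≤ ‖(n : ℂ) + q‖ := by
  obtain ⟨ε, hε, hball⟩ := Metric.isOpen_iff.1 isOpen_nonInt p hp
  refine ⟨ε / 2, half_pos hε, fun q hq n => ?_⟩
  by_contra! hlt
  have h1 : ((-n : ℤ) : ℂ) ∈ Metric.ball p ε := by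
    rw [Metric.mem_ball, dist_eq_norm] at hq ⊢
    calc ‖((-n : ℤ) : ℂ) - p‖ = ‖-((n : ℂ) + q) + (q - p)‖ := by congr 1; push_cast; ring
      _ ≤ ‖(n : ℂ) + q‖ + ‖q - p‖ := by
        exact (norm_add_le _ _).trans_eq (by rw [norm_neg])
      _ < ε := by linarith
  exact hball h1 ⟨-n, rfl⟩

/-- The coefficients of the Frobenius solution with exponent `(1 + p) / 2`. -/
noncomputable def frobCoeff (a₁ p : ℂ) : ℕ → ℂ
  | 0 => 1
  | 1 => a₁ / (1 + p)
  | n + 2 => (a₁ * frobCoeff a₁ p (n + 1) + frobCoeff a₁ p n) / ((n + 2) * (n + 2 + p))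

/-- The recursion loses at most a factor of order `1/n`. The value of `M` is exposed because it
depends on `p` only through `δ`, which gives the uniformity needed for holomorphy in `p`. -/
theorem norm_frobCoeff_le {a₁ p : ℂ} {δ : ℝ} (hδ : 0 < δ) (hp : ∀ n : ℕ, δ ≤ ‖(n : ℂ) + p‖) {r : ℝ}
    (hr : 0 ≤ r) : ∃ M : ℝ, M = (1 + (‖a₁‖ * r + r ^ 2) / δ) ^ ⌈1 + (‖a₁‖ * r + r ^ 2) / δ⌉₊ ∧
      ∀ n, ‖frobCoeff a₁ p n‖ * r ^ n ≤ M := by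
  refine ⟨_, rfl, fun n => ?_⟩
  have hc : 1 ≤ 1 + (‖a₁‖ * r + r ^ 2) / δ := le_add_of_nonneg_right (by positivity)
  rw [← mul_one ((1 + (‖a₁‖ * r + r ^ 2) / δ) ^ _)]
  refine le_of_recursive_bound (x := fun n => ‖frobCoeff a₁ p n‖ * r ^ n) hc zero_le_one
    (by simp [frobCoeff]) ?_ n
  intro n hn B hB1 hB
  have hB0 : 0 ≤ B := zero_le_one.trans hB1
  match n, hn, hB with
  | 1, _, _ =>
    have h1 := hp 1
    rw [Nat.cast_one] at h1
    simp only [frobCoeff, norm_div, pow_one, Nat.cast_one, div_one]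
    have h2 : ‖a₁‖ / ‖1 + p‖ * r ≤ ‖a₁‖ * r / δ := by
      rw [div_mul_eq_mul_div]
      gcongr
    have h3 : ‖a₁‖ * r / δ ≤ (‖a₁‖ * r + r ^ 2) / δ := by
      gcongr
      linarith [sq_nonneg r]
    nlinarith
  | n + 2, _, hB =>
    have h1 := hp (n + 2)
    have h2 := hB (n + 1) (by omega)
    have h3 := hB n (by omega)
    have hn2 : (0 : ℝ) < (n : ℝ) + 2 := by positivity
    have e1 : ‖(n : ℂ) + 2‖ = (n : ℝ) + 2 := by exact_mod_cast Complex.norm_natCast (n + 2)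
    push_cast at h1 ⊢
    simp only [frobCoeff]
    rw [norm_div, norm_mul, e1]
    have hden : ((n : ℝ) + 2) * δ ≤ (n + 2) * ‖(n : ℂ) + 2 + p‖ := by gcongr
    calc ‖a₁ * frobCoeff a₁ p (n + 1) + frobCoeff a₁ p n‖ /
          ((n + 2) * ‖(n : ℂ) + 2 + p‖) * r ^ (n + 2)
        ≤ (‖a₁‖ * ‖frobCoeff a₁ p (n + 1)‖ + ‖frobCoeff a₁ p n‖) / ((n + 2) * δ) *
          r ^ (n + 2) := by
          gcongr
          exact (norm_add_le _ _).trans_eq (by rw [norm_mul])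
      _ = (‖a₁‖ * r * (‖frobCoeff a₁ p (n + 1)‖ * r ^ (n + 1)) +
          r ^ 2 * (‖frobCoeff a₁ p n‖ * r ^ n)) / ((n + 2) * δ) := by
          rw [pow_succ, pow_succ]; ring
      _ ≤ (‖a₁‖ * r * B + r ^ 2 * B) / ((n + 2) * δ) := by gcongr
      _ = (‖a₁‖ * r + r ^ 2) / δ / (n + 2) * B := by field_simp
      _ ≤ (1 + (‖a₁‖ * r + r ^ 2) / δ) / (n + 2) * B := by
          gcongr
          linarith

theorem convOn_frobCoeff (a₁ : ℂ) {p : ℂ} (hp : p ∈ nonInt) (R : ℝ) :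
    ConvOn (frobCoeff a₁ p) R := by
  obtain ⟨δ, hδ, h⟩ := exists_dist_nonInt hp
  refine convOn_of_bounded fun r hr _ => ?_
  obtain ⟨M, -, hM⟩ := norm_frobCoeff_le (a₁ := a₁) hδ (h p (Metric.mem_ball_self hδ)) hr.le
  exact ⟨M, hM⟩

/-- The Frobenius solution with exponent `(1 + p) / 2`. -/
noncomputable def frob (a₁ p t : ℂ) : ℂ := exp ((1 + p) / 2 * t) * psum (frobCoeff a₁ p) (exp t)

theorem nonInt_add_ne_zero {p : ℂ} (hp : p ∈ nonInt) (n : ℕ) : (n : ℂ) + p ≠ 0 := fun h =>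
  mem_nonInt.1 hp (-n) (by push_cast; linear_combination h)

theorem hasDerivAt_psum_exp {b : ℕ → ℂ} (hb : ∀ R, ConvOn b R) (t : ℂ) :
    HasDerivAt (fun t => psum b (exp t)) (psum (fun n => n * b n) (exp t)) t := by
  have hlt : ‖exp t‖ < ‖exp t‖ + 1 := lt_add_one _
  have h := ((hb _).hasSum_deriv hlt).1.hasDerivAt.comp t (Complex.hasDerivAt_exp t)
  refine h.congr_deriv ?_
  rw [mul_comm, (hb _).mul_deriv hlt]

/-- Writing `f = x^((1+p)/2) g`, the term `a₂` cancels against the indicial polynomial and leaves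
`(θ² + pθ)g = (x² + a₁x)g` with `θ = x d/dx`; the recursion is its coefficient form. -/
theorem frobCoeff_ode (a₁ : ℂ) {p : ℂ} (hp : p ∈ nonInt) (x : ℂ) :
    psum (fun n => n * (n * frobCoeff a₁ p n)) x + p * psum (fun n => n * frobCoeff a₁ p n) x =
      (x ^ 2 + a₁ * x) * psum (frobCoeff a₁ p) x := by
  set g := frobCoeff a₁ p with hg
  have hlt : ‖x‖ < ‖x‖ + 1 := lt_add_one _
  have hb := convOn_frobCoeff a₁ hp (‖x‖ + 1)
  have s0 : Summable fun n => g n * x ^ n := hb.summable hlt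
  have s0' : Summable fun n => g (n + 1) * x ^ (n + 1) := (summable_nat_add_iff 1).2 s0
  have s1 := (hb.nat_mul.summable hlt).mul_left p
  have s2 := hb.nat_mul.nat_mul.summable hlt
  have h1 : (∑ n ∈ Finset.range 2, ((n : ℂ) * (n * g n) * x ^ n + p * (n * g n * x ^ n))) +
      ∑' n : ℕ, (((n + 2 : ℕ) : ℂ) * ((n + 2 : ℕ) * g (n + 2)) * x ^ (n + 2) +
        p * ((n + 2 : ℕ) * g (n + 2) * x ^ (n + 2))) =
      ∑' n : ℕ, ((n : ℂ) * (n * g n) * x ^ n + p * (n * g n * x ^ n)) :=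
    (s2.add s1).sum_add_tsum_nat_add 2
  have h2 : ∀ n : ℕ, (↑(n + 2) * (↑(n + 2) * g (n + 2)) * x ^ (n + 2) +
      p * (↑(n + 2) * g (n + 2) * x ^ (n + 2))) =
      a₁ * x * (g (n + 1) * x ^ (n + 1)) + x ^ 2 * (g n * x ^ n) := by
    intro n
    have e : ((n : ℂ) + 2) * (n + 2 + p) * g (n + 2) = a₁ * g (n + 1) + g n := by
      rw [hg, frobCoeff]
      have hn2 : (n : ℂ) + 2 ≠ 0 := by exact_mod_cast (n + 1).succ_ne_zero
      have := nonInt_add_ne_zero hp (n + 2)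
      push_cast at this
      field_simp
    push_cast
    calc _ = (((n : ℂ) + 2) * (n + 2 + p) * g (n + 2)) * x ^ (n + 2) := by ring
      _ = _ := by rw [e]; ring
  have h3 := s0.sum_add_tsum_nat_add 1
  have e1 : (1 + p) * g 1 = a₁ := by
    rw [hg, frobCoeff]
    have := nonInt_add_ne_zero hp 1
    push_cast at this
    field_simp
  have e0 : g 0 = 1 := by rw [hg, frobCoeff]
  rw [psum, psum, psum, ← tsum_mul_left, ← s2.tsum_add s1, ← h1, tsum_congr h2,
    (s0'.mul_left (a₁ * x)).tsum_add (s0.mul_left (x ^ 2)),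
    tsum_mul_left, tsum_mul_left]
  simp only [Finset.sum_range_succ, Finset.range_zero, Finset.sum_empty, Nat.cast_zero,
    mul_zero, zero_add, add_zero, Nat.cast_one, one_mul, pow_one, pow_zero, mul_one, e0] at h3 ⊢
  linear_combination x * e1 + a₁ * x * h3

/-- The Frobenius function solves the equation. -/
theorem solPair_frob (a₁ : ℂ) {p : ℂ} (hp : p ∈ nonInt) :
    SolPair (expPar a₁ p) Set.univ (frob a₁ p) (fun t => exp ((1 + p) / 2 * t) *
      ((1 + p) / 2 * psum (frobCoeff a₁ p) (exp t) + psum (fun n => n * frobCoeff a₁ p n) (exp t))) := by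
  have hb := convOn_frobCoeff a₁ hp
  have hE : ∀ t : ℂ, HasDerivAt (fun t => exp ((1 + p) / 2 * t))
      (exp ((1 + p) / 2 * t) * ((1 + p) / 2 * 1)) t := fun t =>
    ((hasDerivAt_id t).const_mul _).cexp
  refine ⟨fun t _ => ?_, fun t _ => ?_⟩
  · refine ((hE t).mul (hasDerivAt_psum_exp hb t)).congr_deriv ?_
    ring
  · refine ((hE t).mul (((hasDerivAt_psum_exp hb t).const_mul ((1 + p) / 2)).add
      (hasDerivAt_psum_exp (fun R => (hb R).nat_mul) t))).congr_deriv ?_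
    have := frobCoeff_ode a₁ hp (exp t)
    simp only [pot, expPar, frob, Pi.add_apply, Matrix.cons_val_zero, Matrix.cons_val_one]
    linear_combination exp ((1 + p) / 2 * t) * this

theorem continuous_psum {b : ℕ → ℂ} (hb : ∀ R, ConvOn b R) : Continuous (psum b) :=
  continuous_iff_continuousAt.2 fun w =>
    ((hb (‖w‖ + 1)).hasDerivAt (lt_add_one _)).continuousAt

theorem tendsto_exp_ofReal_atBot : Tendsto (fun x : ℝ => exp (x : ℂ)) atBot (𝓝 0) := by
  rw [tendsto_zero_iff_norm_tendsto_zero]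
  simpa [Complex.norm_exp] using Real.tendsto_exp_atBot

theorem tendsto_psum_exp {b : ℕ → ℂ} (hb : ∀ R, ConvOn b R) :
    Tendsto (fun x : ℝ => psum b (exp (x : ℂ))) atBot (𝓝 (b 0)) := by
  have := (continuous_psum hb).tendsto 0
  rw [psum_zero] at this
  exact this.comp tendsto_exp_ofReal_atBot

/-- The quotient of the Wronskian by `e^t` is constant, and its limit as `x → 0` is `(1-p)/2 -
(1+p)/2 = -p`. -/
theorem wronskian_frob (a₁ : ℂ) {p : ℂ} (hp : p ∈ nonInt) (t : ℂ) :
    frob a₁ p t * (exp ((1 + -p) / 2 * t) * ((1 + -p) / 2 * psum (frobCoeff a₁ (-p)) (exp t) +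
      psum (fun n => n * frobCoeff a₁ (-p) n) (exp t))) -
    exp ((1 + p) / 2 * t) * ((1 + p) / 2 * psum (frobCoeff a₁ p) (exp t) +
      psum (fun n => n * frobCoeff a₁ p n) (exp t)) * frob a₁ (-p) t = -p * exp t := by
  have hp' := neg_mem_nonInt hp
  have e : expPar a₁ (-p) = expPar a₁ p := by simp [expPar]
  obtain ⟨c, hc⟩ := (solPair_frob a₁ hp).wronskian (e ▸ solPair_frob a₁ hp') isOpen_univ
    isPreconnected_univ
  have hb := convOn_frobCoeff a₁ hp
  have hb' := convOn_frobCoeff a₁ hp'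
  have h1 := tendsto_psum_exp hb
  have h2 := tendsto_psum_exp hb'
  have h3 := tendsto_psum_exp fun R => (hb R).nat_mul
  have h4 := tendsto_psum_exp fun R => (hb' R).nat_mul
  have h5 := (h1.mul ((h2.const_mul ((1 + -p) / 2)).add h4)).sub
    (((h1.const_mul ((1 + p) / 2)).add h3).mul h2)
  simp only [Nat.cast_zero, add_zero, frobCoeff, mul_one, one_mul] at h5
  have hcp : c = -p := by
    have h6 : (1 + -p) / 2 - (1 + p) / 2 = -p := by ring
    rw [h6] at h5
    refine tendsto_nhds_unique (tendsto_const_nhds.congr fun x : ℝ => ?_) h5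
    have h7 := hc x trivial
    have h8 : exp ((1 + p) / 2 * (x : ℂ)) * exp ((1 + -p) / 2 * (x : ℂ)) = exp x := by
      rw [← exp_add]; ring_nf
    apply mul_right_cancel₀ (exp_ne_zero (x : ℂ))
    rw [← h7, frob, frob]
    set A := psum (frobCoeff a₁ p) (exp (x : ℂ))
    set B := psum (frobCoeff a₁ (-p)) (exp (x : ℂ))
    set A' := psum (fun n => n * frobCoeff a₁ p n) (exp (x : ℂ))
    set B' := psum (fun n => n * frobCoeff a₁ (-p) n) (exp (x : ℂ))
    linear_combination (A * ((1 + -p) / 2 * B + B') - ((1 + p) / 2 * A + A') * B) * h8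
  rw [hc t trivial, hcp]

theorem tendsto_frob (a₁ : ℂ) {p : ℂ} (hp : p ∈ nonInt) :
    Tendsto (fun x : ℝ => exp (-((1 + p) / 2 * x)) * frob a₁ p x) atBot (𝓝 1) := by
  have h := tendsto_psum_exp (convOn_frobCoeff a₁ hp)
  simp only [frobCoeff] at h
  refine h.congr fun x => ?_
  rw [frob, ← mul_assoc, ← exp_add]
  simp

theorem exists_frob_ne_zero (a₁ : ℂ) {p : ℂ} (hp : p ∈ nonInt) : ∃ x : ℝ, frob a₁ p x ≠ 0 := by
  obtain ⟨x, hx⟩ := ((tendsto_frob a₁ hp).eventually_ne one_ne_zero).exists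
  exact ⟨x, fun h => hx (by simp [h])⟩

theorem expPar_eq {a : Fin 2 → ℂ} {p : ℂ} (h : p ^ 2 = 1 + 4 * a 1) : a = expPar (a 0) p := by
  funext i
  fin_cases i
  · simp [expPar]
  · simp [expPar, h]

theorem isFrobenius_frob (a₁ : ℂ) {p : ℂ} (hp : p ∈ nonInt) :
    IsFrobenius (expPar a₁ p) p (frob a₁ p) :=
  ⟨(solPair_frob a₁ hp).isSolution, psum (frobCoeff a₁ p),
    fun w => ((convOn_frobCoeff a₁ hp (‖w‖ + 1)).hasDerivAt (lt_add_one _)).differentiableAt,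
    by rw [psum_zero, frobCoeff], fun _ => rfl⟩

/-- Every solution is a combination of the two Frobenius solutions. -/
theorem eq_lin_frob {a₁ p : ℂ} (hp : p ∈ nonInt) {F : ℂ → ℂ} (hF : IsSolution (expPar a₁ p) F) :
    ∃ c d, ∀ t, F t = c * frob a₁ p t + d * frob a₁ (-p) t := by
  have e : expPar a₁ (-p) = expPar a₁ p := by simp [expPar]
  have hp0 : -p ≠ 0 := neg_ne_zero.2 fun h => mem_nonInt.1 hp 0 (by simpa using h)
  obtain ⟨c, d, h⟩ := SolPair.eq_lin hp0 (solPair_frob a₁ hp)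
    (e ▸ solPair_frob a₁ (neg_mem_nonInt hp)) (fun t _ => wronskian_frob a₁ hp t)
    ((isSolution_iff _ _).1 hF) isOpen_univ isPreconnected_univ
  exact ⟨c, d, fun t => (h t trivial).1⟩

/-- The two monodromy eigenvalues `e^(iπ(1±p))` differ exactly because `p` is not an integer. Hence
one turn around `0` separates the two Frobenius components of a solution. -/
theorem exp_monodromy_ne {p : ℂ} (hp : p ∈ nonInt) :
    exp ((1 + -p) / 2 * (2 * Real.pi * I)) ≠ exp ((1 + p) / 2 * (2 * Real.pi * I)) := by
  intro h
  obtain ⟨n, hn⟩ := Complex.exp_eq_exp_iff_exists_int.1 h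
  have hπ : (Real.pi : ℂ) * I ≠ 0 :=
    mul_ne_zero (by exact_mod_cast Real.pi_ne_zero) I_ne_zero
  refine mem_nonInt.1 hp (-n) ?_
  push_cast
  apply mul_right_cancel₀ hπ
  linear_combination (-1 / 2 : ℂ) * hn

theorem frob_add_two_pi (a₁ p t : ℂ) :
    frob a₁ p (t + 2 * Real.pi * I) = exp ((1 + p) / 2 * (2 * Real.pi * I)) * frob a₁ p t := by
  rw [frob, frob, mul_add, exp_add, exp_add t, Complex.exp_two_pi_mul_I, mul_one]
  ring

theorem linear_independent_frob {a₁ p : ℂ} (hp : p ∈ nonInt) {c d : ℂ}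
    (h : ∀ t, c * frob a₁ p t + d * frob a₁ (-p) t = 0) : c = 0 ∧ d = 0 := by
  have hp' := neg_mem_nonInt hp
  have hd : d = 0 := by
    obtain ⟨x, hx⟩ := exists_frob_ne_zero a₁ hp'
    have h1 := h (x + 2 * Real.pi * I)
    rw [frob_add_two_pi, frob_add_two_pi] at h1
    have h2 : d * (exp ((1 + -p) / 2 * (2 * Real.pi * I)) -
        exp ((1 + p) / 2 * (2 * Real.pi * I))) * frob a₁ (-p) x = 0 := by
      linear_combination h1 - exp ((1 + p) / 2 * (2 * Real.pi * I)) * h x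
    exact (mul_eq_zero.1 ((mul_eq_zero.1 h2).resolve_right hx)).resolve_right
      (sub_ne_zero.2 (exp_monodromy_ne hp))
  obtain ⟨x, hx⟩ := exists_frob_ne_zero a₁ hp
  have h1 := h x
  rw [hd, zero_mul, add_zero] at h1
  exact ⟨(mul_eq_zero.1 h1).resolve_right hx, hd⟩

/-- The monodromy of `f` kills its component along the other exponent, and `g(0) = 1` fixes the
remaining constant. -/
theorem IsFrobenius.eq_frob {a₁ p : ℂ} (hp : p ∈ nonInt) {f : ℂ → ℂ}
    (hf : IsFrobenius (expPar a₁ p) p f) : f = frob a₁ p := by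
  obtain ⟨hsol, g, hg, hg0, hfg⟩ := hf
  obtain ⟨c, d, h⟩ := eq_lin_frob hp hsol
  have hmono : ∀ t, f (t + 2 * Real.pi * I) = exp ((1 + p) / 2 * (2 * Real.pi * I)) * f t := by
    intro t
    rw [hfg, hfg, mul_add, exp_add, exp_add t, Complex.exp_two_pi_mul_I, mul_one]
    ring
  have hd : d = 0 := by
    obtain ⟨x, hx⟩ := exists_frob_ne_zero a₁ (neg_mem_nonInt hp)
    have h1 := hmono x
    rw [h, h, frob_add_two_pi, frob_add_two_pi] at h1
    have h2 : d * (exp ((1 + -p) / 2 * (2 * Real.pi * I)) -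
        exp ((1 + p) / 2 * (2 * Real.pi * I))) * frob a₁ (-p) x = 0 := by
      linear_combination h1
    exact (mul_eq_zero.1 ((mul_eq_zero.1 h2).resolve_right hx)).resolve_right
      (sub_ne_zero.2 (exp_monodromy_ne hp))
  have hc : c = 1 := by
    have h1 : Tendsto (fun x : ℝ => exp (-((1 + p) / 2 * x)) * f x) atBot (𝓝 1) := by
      have := (hg.continuous.tendsto 0).comp tendsto_exp_ofReal_atBot
      rw [hg0] at this
      refine this.congr fun x => ?_
      rw [hfg, ← mul_assoc, ← exp_add]
      simp
    have h2 := (tendsto_frob a₁ hp).const_mul c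
    rw [mul_one] at h2
    refine tendsto_nhds_unique h2 (h1.congr fun x => ?_)
    rw [h, hd]
    ring
  funext t
  rw [h, hc, hd]
  ring

theorem frobCoeff_neg (a₁ p : ℂ) (n : ℕ) : frobCoeff (-a₁) p n = (-1) ^ n * frobCoeff a₁ p n := by
  induction n using Nat.twoStepInduction with
  | zero => simp [frobCoeff]
  | one => simp [frobCoeff, neg_div]
  | more n h1 h2 =>
    simp only [frobCoeff]
    rw [h1, h2]
    ring

/-- The equation is invariant under `(x, a₁) ↦ (-x, -a₁)`; on the covering, turning by an odd
multiple of `π` only multiplies the power of `x` by a constant. -/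
theorem frob_neg (a₁ p t : ℂ) {ω : ℂ} (hω : exp ω = -1) :
    frob (-a₁) p (ω + t) = exp ((1 + p) / 2 * ω) * frob a₁ p t := by
  have h : psum (frobCoeff (-a₁) p) (-exp t) = psum (frobCoeff a₁ p) (exp t) := by
    rw [psum, psum]
    congr 1
    funext n
    rw [frobCoeff_neg, neg_pow (exp t)]
    have : (-1 : ℂ) ^ n * (-1) ^ n = 1 := by rw [← mul_pow]; simp
    linear_combination (frobCoeff a₁ p n * exp t ^ n) * this
  rw [frob, frob, mul_add, exp_add, exp_add ω, hω, neg_one_mul, h]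
  ring

theorem differentiableOn_frobCoeff (a₁ : ℂ) (n : ℕ) :
    DifferentiableOn ℂ (fun p => frobCoeff a₁ p n) nonInt := by
  induction n using Nat.twoStepInduction with
  | zero => simp [frobCoeff]
  | one =>
    simp only [frobCoeff]
    refine DifferentiableOn.div (by fun_prop) (by fun_prop) fun p hp => ?_
    simpa using nonInt_add_ne_zero hp 1
  | more n h1 h2 =>
    simp only [frobCoeff]
    refine DifferentiableOn.div ((h2.const_mul a₁).add h1) (by fun_prop) fun p hp => ?_
    have := nonInt_add_ne_zero hp (n + 2)
    push_cast at this
    exact mul_ne_zero (by exact_mod_cast (n + 1).succ_ne_zero) this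

theorem differentiableOn_frob (a₁ t : ℂ) : DifferentiableOn ℂ (fun p => frob a₁ p t) nonInt := by
  intro p hp
  obtain ⟨δ, hδ, h⟩ := exists_dist_nonInt hp
  set U := Metric.ball p δ ∩ nonInt with hU
  have hUo : IsOpen U := Metric.isOpen_ball.inter isOpen_nonInt
  have hpU : p ∈ U := ⟨Metric.mem_ball_self hδ, hp⟩
  -- Bounding the coefficients at twice the radius gives a geometric majorant of ratio `1/2`,
  -- uniform near `p`.
  set r : ℝ := 2 * ‖exp t‖ with hr
  have hpos : 0 < ‖exp t‖ := norm_pos_iff.2 (exp_ne_zero t)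
  set M : ℝ := (1 + (‖a₁‖ * r + r ^ 2) / δ) ^ ⌈1 + (‖a₁‖ * r + r ^ 2) / δ⌉₊ with hM
  have hsum : Summable fun n : ℕ => M * (1 / 2 : ℝ) ^ n :=
    (summable_geometric_of_lt_one (by norm_num) (by norm_num)).mul_left M
  have h1 : DifferentiableOn ℂ (fun q => ∑' n, frobCoeff a₁ q n * exp t ^ n) U := by
    refine differentiableOn_tsum_of_summable_norm hsum (fun n => ?_) hUo (fun n q hq => ?_)
    · exact ((differentiableOn_frobCoeff a₁ n).mono Set.inter_subset_right).mul_const _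
    · obtain ⟨M', rfl, hM'⟩ := norm_frobCoeff_le (a₁ := a₁) hδ (h q hq.1)
        (r := r) (by positivity)
      rw [norm_mul, norm_pow]
      have e : ‖exp t‖ ^ n = r ^ n * (1 / 2) ^ n := by rw [← mul_pow, hr]; ring
      rw [e, ← mul_assoc]
      exact mul_le_mul_of_nonneg_right (hM' n) (by positivity)
  have h2 : DifferentiableAt ℂ (fun q => frob a₁ q t) p := by
    have h3 : DifferentiableAt ℂ (fun q : ℂ => exp ((1 + q) / 2 * t)) p := by fun_prop
    exact h3.mul (h1.differentiableAt (hUo.mem_nhds hpU))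
  exact h2.differentiableWithinAt

end StokesSibuya

namespace StokesSibuya

open MeasureTheory Set

/-! ### Euler's integral -/

/-- The density of Euler's integral. -/
noncomputable def eulerDensity (α β : ℂ) (r : ℝ) : ℂ := (r : ℂ) ^ (α - 1) * (2 + (r : ℂ)) ^ (-β)

/-- The integrals which appear after a change of scale in Euler's integral. -/
noncomputable def eulerInt (α β : ℂ) (y z : ℝ) : ℂ :=
  ∫ σ in Ioi (0 : ℝ), ((Real.exp (-σ) : ℝ) : ℂ) * (σ : ℂ) ^ (α - 1) * ((y + z * σ : ℝ) : ℂ) ^ (-β)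

theorem norm_cpow_add_le {β : ℂ} (hβ : β.re ≤ 0) {y z σ : ℝ} (hy : y ≤ 2)
    (hz : z ≤ 1) (hσ : 0 < σ) (hpos : 0 < y + z * σ) :
    ‖((y + z * σ : ℝ) : ℂ) ^ (-β)‖ ≤ (2 + σ) ^ (-β.re) := by
  rw [Complex.norm_cpow_eq_rpow_re_of_pos hpos, neg_re]
  have : y + z * σ ≤ 2 + σ := by nlinarith
  exact Real.rpow_le_rpow hpos.le this (by linarith)

theorem integrable_eulerBound {α : ℂ} (β : ℂ) (hα : 1 < α.re) :
    IntegrableOn (fun σ : ℝ => Real.exp (-σ) * σ ^ (α.re - 1) * (2 + σ) ^ (-β.re)) (Ioi 0) := by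
  obtain ⟨M, hM⟩ := exists_nat_ge (α.re - 1 - β.re)
  have h1 := (integrableOn_one_add_pow_mul_exp one_pos M).const_mul ((2 : ℝ) ^ M)
  refine Integrable.mono' h1 ?_ ?_
  · refine ContinuousOn.aestronglyMeasurable (fun σ hσ => ?_) measurableSet_Ioi
    have hσ0 : (0 : ℝ) < σ := hσ
    refine ContinuousAt.continuousWithinAt ?_
    refine ((Continuous.continuousAt (by fun_prop)).mul
      (Real.continuousAt_rpow_const _ _ (Or.inl hσ0.ne'))).mul ?_
    exact ContinuousAt.rpow_const (by fun_prop) (Or.inl (by positivity))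
  · filter_upwards [ae_restrict_mem measurableSet_Ioi] with σ hσ
    have hσ0 : (0 : ℝ) < σ := hσ
    rw [Real.norm_of_nonneg (by positivity)]
    have h2 : σ ^ (α.re - 1) ≤ (2 + σ) ^ (α.re - 1) :=
      Real.rpow_le_rpow hσ0.le (by linarith) (by linarith)
    have h3 : (2 + σ) ^ (α.re - 1) * (2 + σ) ^ (-β.re) ≤ (2 * (1 + σ)) ^ M := by
      rw [← Real.rpow_add (by positivity), ← Real.rpow_natCast]
      calc (2 + σ) ^ (α.re - 1 + -β.re) ≤ (2 + σ) ^ (M : ℝ) :=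
            Real.rpow_le_rpow_of_exponent_le (by linarith) (by linarith)
        _ ≤ (2 * (1 + σ)) ^ (M : ℝ) := Real.rpow_le_rpow (by positivity) (by linarith) (by positivity)
    calc Real.exp (-σ) * σ ^ (α.re - 1) * (2 + σ) ^ (-β.re)
        ≤ Real.exp (-σ) * (2 + σ) ^ (α.re - 1) * (2 + σ) ^ (-β.re) := by gcongr
      _ = Real.exp (-σ) * ((2 + σ) ^ (α.re - 1) * (2 + σ) ^ (-β.re)) := by ring
      _ ≤ Real.exp (-σ) * (2 * (1 + σ)) ^ M := by gcongr
      _ = _ := by rw [mul_pow, one_mul]; ring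

/-- Dominated convergence. The conditions `re β ≤ 0`, `y ≤ 2` and `z ≤ 1` give the common bound `(2
+ σ)^(-re β)`. Both limits needed, `x → ∞` at `(2, 0)` and `x → 0` at `(0, 1)`, are instances. -/
theorem tendsto_eulerInt {α β : ℂ} (hα : 1 < α.re) (hβ : β.re ≤ 0) {l : Filter ℝ}
    [l.IsCountablyGenerated] {y z : ℝ → ℝ} {y₀ z₀ : ℝ} (hy : Tendsto y l (𝓝 y₀))
    (hz : Tendsto z l (𝓝 z₀)) (h : ∀ᶠ x in l, 0 ≤ y x ∧ y x ≤ 2 ∧ 0 ≤ z x ∧ z x ≤ 1 ∧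
      0 < y x + z x) (h0 : 0 ≤ y₀) (h0' : 0 ≤ z₀) (h0'' : 0 < y₀ + z₀) :
    Tendsto (fun x => eulerInt α β (y x) (z x)) l (𝓝 (eulerInt α β y₀ z₀)) := by
  have hpos : ∀ {y z σ : ℝ}, 0 ≤ y → 0 ≤ z → 0 < y + z → 0 < σ → 0 < y + z * σ := by
    intro y z σ h1 h2 h3 h4
    rcases h1.eq_or_lt with rfl | h5
    · rw [zero_add] at h3 ⊢
      positivity
    · positivity
  refine tendsto_integral_filter_of_dominated_convergence _ ?_ ?_ (integrable_eulerBound β hα) ?_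
  · filter_upwards [h] with x hx
    refine ContinuousOn.aestronglyMeasurable (fun σ hσ => ?_) measurableSet_Ioi
    have hσ0 : (0 : ℝ) < σ := hσ
    refine ContinuousAt.continuousWithinAt ?_
    refine ((Continuous.continuousAt (by fun_prop)).mul ?_).mul ?_
    · exact (continuousAt_ofReal_cpow_const _ _ (Or.inr hσ0.ne'))
    · exact (continuousAt_ofReal_cpow_const _ _ (Or.inr (hpos hx.1 hx.2.2.1 hx.2.2.2.2 hσ0).ne')).comp
        (f := fun σ : ℝ => y x + z x * σ) (by fun_prop)
  · filter_upwards [h] with x hx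
    filter_upwards [ae_restrict_mem measurableSet_Ioi] with σ hσ
    have hσ0 : (0 : ℝ) < σ := hσ
    rw [norm_mul, norm_mul, Complex.norm_real, Real.norm_of_nonneg (Real.exp_pos _).le,
      Complex.norm_cpow_eq_rpow_re_of_pos hσ0, sub_re, one_re]
    gcongr
    exact norm_cpow_add_le hβ hx.2.1 hx.2.2.2.1 hσ0
      (hpos hx.1 hx.2.2.1 hx.2.2.2.2 hσ0)
  · filter_upwards [ae_restrict_mem measurableSet_Ioi] with σ hσ
    have hσ0 : (0 : ℝ) < σ := hσ
    refine Tendsto.const_mul _ ?_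
    exact (continuousAt_ofReal_cpow_const _ _ (Or.inr (hpos h0 h0' h0'' hσ0).ne')).tendsto.comp
      (hy.add (hz.mul_const σ))

theorem eulerInt_two_zero {α β : ℂ} (hα : 0 < α.re) :
    eulerInt α β 2 0 = 2 ^ (-β) * Gamma α := by
  rw [eulerInt, Complex.Gamma_eq_integral hα, Complex.GammaIntegral, ← integral_const_mul]
  congr 1
  funext σ
  simp only [zero_mul, add_zero, ofReal_ofNat]
  ring

theorem eulerInt_zero_one {α β : ℂ} (h : 0 < (α - β).re) :
    eulerInt α β 0 1 = Gamma (α - β) := by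
  rw [eulerInt, Complex.Gamma_eq_integral h, Complex.GammaIntegral]
  refine setIntegral_congr_fun measurableSet_Ioi fun σ hσ => ?_
  have hσ0 : (σ : ℂ) ≠ 0 := by exact_mod_cast (ne_of_gt hσ)
  simp only [zero_add, one_mul]
  rw [mul_assoc, ← cpow_add _ _ hσ0]
  ring_nf

/-- The substitution `σ = xr`, which puts the integral in a form with a limit as `x → ∞`. -/
theorem laplace_eulerDensity (α β : ℂ) {x : ℝ} (hx : 0 < x) :
    (x : ℂ) ^ α * laplace (eulerDensity α β) x = eulerInt α β 2 x⁻¹ := by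
  have h1 := integral_comp_mul_left_Ioi (fun σ : ℝ => ((Real.exp (-σ) : ℝ) : ℂ) *
    (σ : ℂ) ^ (α - 1) * ((2 + x⁻¹ * σ : ℝ) : ℂ) ^ (-β)) 0 hx
  rw [mul_zero] at h1
  have hx0 : (x : ℂ) ≠ 0 := by exact_mod_cast hx.ne'
  have h2 : ∫ r in Ioi (0 : ℝ), ((Real.exp (-(x * r)) : ℝ) : ℂ) *
      ((x * r : ℝ) : ℂ) ^ (α - 1) * ((2 + x⁻¹ * (x * r) : ℝ) : ℂ) ^ (-β) =
      (x : ℂ) ^ (α - 1) * laplace (eulerDensity α β) x := by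
    rw [laplace, ← integral_const_mul]
    refine setIntegral_congr_fun measurableSet_Ioi fun r hr => ?_
    have hr0 : (0 : ℝ) < r := hr
    simp only [eulerDensity]
    rw [inv_mul_cancel_left₀ hx.ne', ofReal_mul, mul_cpow_ofReal_nonneg hx.le hr0.le]
    push_cast
    ring
  rw [h2] at h1
  rw [eulerInt]
  have h3 : (x : ℂ) ^ α = x * (x : ℂ) ^ (α - 1) := by
    rw [cpow_sub _ _ hx0, cpow_one]
    field_simp
  rw [h3, mul_assoc, h1, real_smul]
  push_cast
  field_simp

/-- Taking `x^(-β)` out of `(2x + σ)^(-β)` gives the form with a limit as `x → 0`. -/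
theorem eulerInt_scale (α β : ℂ) {x : ℝ} (hx : 0 < x) :
    eulerInt α β 2 x⁻¹ = (x : ℂ) ^ β * eulerInt α β (2 * x) 1 := by
  rw [eulerInt, eulerInt, ← integral_const_mul]
  refine setIntegral_congr_fun measurableSet_Ioi fun σ hσ => ?_
  have hσ0 : (0 : ℝ) < σ := hσ
  have hx0 : (x : ℂ) ≠ 0 := by exact_mod_cast hx.ne'
  have e : 2 * x + 1 * σ = x * (2 + x⁻¹ * σ) := by field_simp
  rw [e, ofReal_mul, mul_cpow_ofReal_nonneg hx.le (by positivity), cpow_neg (x : ℂ)]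
  have : (x : ℂ) ^ β ≠ 0 := by simp [cpow_eq_zero_iff, hx0]
  field_simp

theorem polyGrowth_eulerDensity {α : ℂ} (β : ℂ) (hα : 1 < α.re) :
    PolyGrowth (eulerDensity α β) := by
  obtain ⟨M, hM⟩ := exists_nat_ge (α.re - 1 - β.re)
  refine ⟨fun r hr => ?_, 2 ^ M, M, by positivity, fun r hr => ?_⟩
  · have hr0 : (0 : ℝ) < r := hr
    refine ContinuousAt.continuousWithinAt ?_
    refine (continuousAt_ofReal_cpow_const _ _ (Or.inr hr0.ne')).mul ?_
    have h1 : ContinuousAt (fun r : ℝ => ((2 + r : ℝ) : ℂ) ^ (-β)) r :=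
      (continuousAt_ofReal_cpow_const _ _ (Or.inr (by positivity))).comp
        (f := fun r : ℝ => 2 + r) (by fun_prop)
    simpa using h1
  · have h1 : ((2 : ℂ) + r) = ((2 + r : ℝ) : ℂ) := by push_cast; rfl
    rw [eulerDensity, norm_mul, Complex.norm_cpow_eq_rpow_re_of_pos hr, h1,
      Complex.norm_cpow_eq_rpow_re_of_pos (by positivity), sub_re, one_re, neg_re, ← mul_pow]
    calc r ^ (α.re - 1) * (2 + r) ^ (-β.re) ≤ (2 + r) ^ (α.re - 1) * (2 + r) ^ (-β.re) := by
          gcongr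
          linarith
      _ = (2 + r) ^ (α.re - 1 + -β.re) := by rw [← Real.rpow_add (by positivity)]
      _ ≤ (2 + r) ^ (M : ℝ) := Real.rpow_le_rpow_of_exponent_le (by linarith) (by linarith)
      _ ≤ (2 * (1 + r)) ^ (M : ℝ) :=
          Real.rpow_le_rpow (by positivity) (by linarith) (by positivity)
      _ = _ := by rw [Real.rpow_natCast]

theorem hasDerivAt_eulerDensity (α β : ℂ) {r : ℝ} (hr : 0 < r) :
    HasDerivAt (eulerDensity α β)
      ((2 * (α - 1) + (α - 1 - β) * r) / (r * (2 + r)) * eulerDensity α β r) r := by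
  have h1 : HasDerivAt (fun s : ℂ => s ^ (α - 1) * (2 + s) ^ (-β))
      (((α - 1) * (r : ℂ) ^ (α - 1 - 1) * 1) * (2 + (r : ℂ)) ^ (-β) +
        (r : ℂ) ^ (α - 1) * ((-β) * (2 + (r : ℂ)) ^ (-β - 1) * 1)) r := by
    have hs1 : (r : ℂ) ∈ slitPlane := ofReal_mem_slitPlane.2 hr
    have hs2 : (2 + (r : ℂ)) ∈ slitPlane := by
      have : ((2 : ℂ) + r) = ((2 + r : ℝ) : ℂ) := by push_cast; rfl
      rw [this]
      exact ofReal_mem_slitPlane.2 (by positivity)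
    exact ((hasDerivAt_id (r : ℂ)).cpow_const hs1).mul
      (((hasDerivAt_id (r : ℂ)).const_add 2).cpow_const hs2)
  refine h1.comp_ofReal.congr_deriv ?_
  have hr0 : (r : ℂ) ≠ 0 := by exact_mod_cast hr.ne'
  have hr2 : (2 : ℂ) + r ≠ 0 := by
    have : (2 + r : ℝ) ≠ 0 := by positivity
    exact_mod_cast this
  rw [cpow_sub (α - 1) 1 hr0, cpow_sub (-β) 1 hr2, cpow_one, cpow_one, eulerDensity]
  field_simp
  ring

/-- The integrand is the derivative of `-e^(-xr) r(r+2)` times the density. The logarithmic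
derivative of the density has denominator `r(r+2)`, which the factor clears, and the same factor
kills the boundary term at `0`. -/
theorem laplace_eulerDensity_identity {α x : ℂ} (β : ℂ) (hα : 1 < α.re)
    (hx : 0 < x.re) : ∫ r in Ioi (0 : ℝ), exp (-(x * r)) *
      ((x * ((r : ℂ) ^ 2 + 2 * r) - (α - β + 1) * r - 2 * α) * eulerDensity α β r) = 0 := by
  have hh := polyGrowth_eulerDensity β hα
  have hsq : PolyGrowth fun r : ℝ => (r : ℂ) ^ 2 := by
    simpa only [pow_two] using polyGrowth_id.mul polyGrowth_id
  have hq : PolyGrowth fun r : ℝ => ((r : ℂ) ^ 2 + 2 * r) * eulerDensity α β r :=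
    (hsq.add ((polyGrowth_const 2).mul polyGrowth_id)).mul hh
  refine integral_deriv_eq_zero
    (K := fun r : ℝ => -(exp (-(x * r)) * (((r : ℂ) ^ 2 + 2 * r) * eulerDensity α β r)))
    ?_ (by simp) ?_ ?_ (by simpa using (hq.tendsto_zero hx).neg)
  · obtain ⟨C, M, hC, hb⟩ := hh.bound
    have h1 : Tendsto (fun r : ℝ => Real.exp (-(x.re * r)) * ((r ^ 2 + 2 * r) * (C * (1 + r) ^ M)))
        (𝓝[≥] 0) (𝓝 0) := by
      have : Continuous fun r : ℝ => Real.exp (-(x.re * r)) * ((r ^ 2 + 2 * r) * (C * (1 + r) ^ M)) := by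
        fun_prop
      simpa using (this.tendsto 0).mono_left (nhdsWithin_le_nhds (s := Ici 0))
    have h2 : Tendsto (fun r : ℝ => -(exp (-(x * r)) * (((r : ℂ) ^ 2 + 2 * r) *
        eulerDensity α β r))) (𝓝[≥] 0) (𝓝 0) := by
      refine squeeze_zero_norm' ?_ h1
      filter_upwards [self_mem_nhdsWithin] with r hr
      rcases (show (0 : ℝ) ≤ r from hr).eq_or_lt with rfl | hr0
      · simp
      · have e : ((r : ℂ) ^ 2 + 2 * r) = ((r ^ 2 + 2 * r : ℝ) : ℂ) := by push_cast; rfl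
        rw [norm_neg, norm_mul, norm_mul, norm_exp_neg_mul, e, Complex.norm_real,
          Real.norm_of_nonneg (by positivity)]
        gcongr
        exact hb r hr0
    simpa [ContinuousWithinAt] using h2
  · intro r hr
    have hE : HasDerivAt (fun r : ℝ => exp (-(x * r))) (exp (-(x * r)) * (-x)) r := by
      have h1 := ((Complex.ofRealCLM.hasDerivAt (x := r)).const_mul x).neg
      simp only [Complex.ofRealCLM_apply, Complex.ofReal_one, mul_one] at h1
      exact h1.cexp
    have hQ : HasDerivAt (fun r : ℝ => ((r : ℂ) ^ 2 + 2 * (r : ℂ) : ℂ)) (2 * (r : ℂ) + 2 : ℂ) r := by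
      have h1 : HasDerivAt (fun s : ℂ => s ^ 2 + 2 * s) (2 * (r : ℂ) + 2) r := by
        refine ((hasDerivAt_pow 2 (r : ℂ)).add ((hasDerivAt_id (r : ℂ)).const_mul 2)).congr_deriv ?_
        simp
      exact h1.comp_ofReal
    refine (hE.mul (hQ.mul (hasDerivAt_eulerDensity α β hr))).neg.congr_deriv ?_
    have hr0 : (r : ℂ) ≠ 0 := by exact_mod_cast hr.ne'
    have hr2 : (2 : ℂ) + r ≠ 0 := by
      have : (2 + r : ℝ) ≠ 0 := by positivity
      exact_mod_cast this
    simp only [Pi.mul_apply]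
    have key : ((r : ℂ) ^ 2 + 2 * r) * ((2 * (α - 1) + (α - 1 - β) * r) / (r * (2 + r)) *
        eulerDensity α β r) = (2 * (α - 1) + (α - 1 - β) * r) * eulerDensity α β r := by
      field_simp
      ring
    rw [key]
    ring
  · have h1 : PolyGrowth fun r : ℝ => (x * ((r : ℂ) ^ 2 + 2 * r) + (-(α - β + 1)) * r + (-(2 * α))) *
        eulerDensity α β r :=
      ((((polyGrowth_const x).mul (hsq.add ((polyGrowth_const 2).mul polyGrowth_id))).add
        ((polyGrowth_const (-(α - β + 1))).mul polyGrowth_id)).add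
        (polyGrowth_const (-(2 * α)))).mul hh
    have e : (fun r : ℝ => (x * ((r : ℂ) ^ 2 + 2 * r) - (α - β + 1) * r - 2 * α) *
        eulerDensity α β r) = fun r : ℝ => (x * ((r : ℂ) ^ 2 + 2 * r) + (-(α - β + 1)) * r +
        (-(2 * α))) * eulerDensity α β r := by
      funext r; ring
    exact (e ▸ h1).integrableOn hx

end StokesSibuya

namespace StokesSibuya

open MeasureTheory Set

/-! ### The connection coefficient between the origin and infinity -/

/-- With `μ = (1+p)/2` an exponent at `0`, the constant term in the equation for `V` vanishes. What
remains is `x` times `laplace_eulerDensity_identity`. -/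
theorem exists_eulerSolution {a₁ p : ℂ} (hp : 1 < ((1 + p + a₁) / 2).re) :
    ∃ E E', SolPair (expPar a₁ p) univ E E' ∧ ∀ t ∈ rayStrip 0, E t =
      exp ((1 + p) / 2 * t - exp t) *
        laplace (eulerDensity ((1 + p + a₁) / 2) ((1 - p + a₁) / 2)) (exp t) := by
  set α : ℂ := (1 + p + a₁) / 2 with hα
  set β : ℂ := (1 - p + a₁) / 2 with hβ
  set f := eulerDensity α β with hfdef
  have hf : PolyGrowth f := polyGrowth_eulerDensity β hp
  have hf1 := polyGrowth_id.mul hf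
  have hf2 := polyGrowth_id.mul hf1
  have hsol : SolPair (expPar a₁ p) {t | exp t ∈ {x : ℂ | 0 < x.re}} _ _ :=
    solPair_of_exp (a := expPar a₁ p) (μ := (1 + p) / 2) (X := {x | 0 < x.re})
      (V := laplace f) (V' := fun x => -laplace (fun r => r * f r) x)
      (V'' := fun x => laplace (fun r => r * (r * f r)) x)
      (fun x hx => hf.hasDerivAt_laplace hx)
      (fun x hx => (hf1.hasDerivAt_laplace hx).neg.congr_deriv (neg_neg _)) (by
        intro x hx
        have hx' : 0 < x.re := hx
        have hid := laplace_eulerDensity_identity β hp hx'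
        have i0 := hf.integrableOn hx'
        have i1 := hf1.integrableOn hx'
        have i2 := hf2.integrableOn hx'
        have hlin : ∀ u v w : ℂ, ∫ r in Ioi (0 : ℝ), exp (-(x * r)) *
            (u * (r * (r * f r)) + v * (r * f r) + w * f r) =
            u * laplace (fun r => r * (r * f r)) x + v * laplace (fun r => r * f r) x +
              w * laplace f x := by
          intro u v w
          have i3 := integral_add (f := fun r : ℝ => u * (exp (-(x * r)) * (r * (r * f r))) +
            v * (exp (-(x * r)) * (r * f r))) ((i2.const_mul u).add (i1.const_mul v))
            (i0.const_mul w)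
          rw [laplace, laplace, laplace, ← integral_const_mul, ← integral_const_mul,
            ← integral_const_mul, ← integral_add (i2.const_mul u) (i1.const_mul v), ← i3]
          congr 1
          funext r
          ring
        have e : (fun r : ℝ => exp (-(x * r)) *
            ((x * ((r : ℂ) ^ 2 + 2 * r) - (α - β + 1) * r - 2 * α) * eulerDensity α β r)) =
            fun r : ℝ => exp (-(x * r)) * (x * (r * (r * f r)) +
              (2 * x - (α - β + 1)) * (r * f r) + (-(2 * α)) * f r) := by
          funext r
          rw [hfdef]
          ring
        rw [e, hlin] at hid
        simp only [expPar, Matrix.cons_val_zero, Matrix.cons_val_one]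
        rw [hα, hβ] at hid
        linear_combination x * hid)
  have hpos : ∀ t ∈ rayStrip 0, 0 < (exp t).re := fun t ht => by
    simpa using pos_of_mem_rayStrip ht
  obtain ⟨E, E', hE, hEF⟩ := (hsol.mono fun t ht => hpos t ht).exists_extension
    (isOpen_rayStrip 0) (convex_rayStrip 0).isPreconnected
  exact ⟨E, E', hE, fun t ht => (hEF t ht).1⟩

theorem PolyGrowth.norm_laplace_le {f : ℝ → ℂ} (hf : PolyGrowth f) {z : ℂ} (hz : 1 ≤ z.re) :
    ‖laplace f z‖ ≤ ∫ r in Ioi (0 : ℝ), ‖exp (-((1 : ℂ) * r)) * f r‖ := by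
  refine norm_integral_le_of_norm_le (hf.integrableOn (by simp)).norm ?_
  filter_upwards [ae_restrict_mem measurableSet_Ioi] with r hr
  have hr0 : (0 : ℝ) < r := hr
  rw [norm_mul, norm_mul, norm_exp_neg_mul, norm_exp_neg_mul, one_re]
  gcongr

theorem tendsto_exp_mul_laplace {f : ℝ → ℂ} (hf : PolyGrowth f) (μ : ℂ) :
    Tendsto (fun t => exp (μ * t - exp t) * laplace f (exp t)) (stripEnd 0 1) (𝓝 0) := by
  have h1 := (tendsto_exp_sub_exp (y := 0) zero_le_one
    (by rw [abs_zero]; linarith [Real.pi_gt_three]) μ).norm.mul_const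
    (∫ r in Ioi (0 : ℝ), ‖exp (-((1 : ℂ) * r)) * f r‖)
  rw [norm_zero, zero_mul] at h1
  refine squeeze_zero_norm' ?_ h1
  filter_upwards [eventually_mem_stripEnd 0 1,
    (tendsto_norm_exp_stripEnd 0 1).eventually_ge_atTop (Real.cos 1)⁻¹] with t h2 h3
  rw [norm_mul]
  gcongr
  refine hf.norm_laplace_le ?_
  have h4 : Real.cos 1 ≤ Real.cos t.im := by
    rw [← Real.cos_abs t.im]
    exact Real.cos_le_cos_of_nonneg_of_le_pi (abs_nonneg _) (by linarith [Real.pi_gt_three])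
      (by simpa using h2)
  have h5 : (exp t).re = ‖exp t‖ * Real.cos t.im := by rw [Complex.exp_re, Complex.norm_exp]
  rw [h5]
  calc (1 : ℝ) = (Real.cos 1)⁻¹ * Real.cos 1 := (inv_mul_cancel₀ Real.cos_one_pos.ne').symm
    _ ≤ _ := mul_le_mul h3 h4 Real.cos_one_pos.le (norm_nonneg _)

/-- The coefficient of the Frobenius solution with exponent `(1 - p) / 2` in the subdominant
solution. -/
noncomputable def connCoeff (a₁ p : ℂ) : ℂ :=
  2 ^ ((1 - p + a₁) / 2) * Gamma p * (Gamma ((1 + p + a₁) / 2))⁻¹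

theorem ofReal_mem_rayStrip (x : ℝ) : (x : ℂ) ∈ rayStrip 0 := by
  simp [rayStrip, Real.pi_pos]

theorem cpow_ofReal_exp (x : ℝ) (s : ℂ) : ((Real.exp x : ℝ) : ℂ) ^ s = exp (s * x) := by
  rw [cpow_def_of_ne_zero (by exact_mod_cast (Real.exp_pos x).ne'), ← ofReal_log (Real.exp_pos x).le,
    Real.log_exp, mul_comm]

/-- Euler's solution `E` is recessive, hence `E = k Φ₀`. Its limit at infinity gives `k = 2^(-β)
Γ(α)`, and its leading term at `0` gives `k d = Γ(α - β) = Γ(p)`. -/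
theorem subdominant_eq_of_large {a₁ p : ℂ} (hp : p ∈ nonInt) (h1 : 1 < ((1 + p + a₁) / 2).re)
    (h2 : ((1 - p + a₁) / 2).re ≤ 0) (h3 : 0 < p.re) {c d : ℂ}
    (h : ∀ t, subdominant t (expPar a₁ p) = c * frob a₁ p t + d * frob a₁ (-p) t) :
    d = connCoeff a₁ p := by
  obtain ⟨E, E', hE, hEF⟩ := exists_eulerSolution h1
  set α : ℂ := (1 + p + a₁) / 2 with hα
  set β : ℂ := (1 - p + a₁) / 2 with hβ
  have hf : PolyGrowth (eulerDensity α β) := polyGrowth_eulerDensity β h1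
  have hlead : HasLead (expPar a₁ p) 0 1 fun t => subdominant t (expPar a₁ p) :=
    isPhi0_subdominant.hasLead _ (by rw [abs_zero]; linarith [Real.pi_gt_three])
  have hE0 : Tendsto E (stripEnd 0 1) (𝓝 0) := by
    refine (tendsto_exp_mul_laplace hf ((1 + p) / 2)).congr' ?_
    filter_upwards [eventually_mem_stripEnd 0 1] with t ht
    refine (hEF t ?_).symm
    change |t.im + 0| < _
    rw [sub_zero] at ht
    rw [add_zero]
    linarith [Real.pi_gt_three]
  have hline : Tendsto (fun x : ℝ => (x : ℂ)) atTop (stripEnd 0 1) := by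
    simpa using tendsto_line_stripEnd 0 zero_le_one
  have hdiv := hlead.tendsto_div.comp hline
  obtain ⟨x₀, hx₀⟩ := (hdiv.eventually_ne one_ne_zero).exists
  obtain ⟨k, hk⟩ := hE.proportional_of_recessive
    ((isSolution_iff _ _).1 (isSolution_subdominant (expPar a₁ p))) one_pos hE0
    (hlead.tendsto_zero zero_le_one (by rw [abs_zero]; linarith [Real.pi_gt_three]))
    (t₀ := (x₀ : ℂ)) fun h0 => hx₀ (by simp [h0])
  have hEx : ∀ x : ℝ, E x = exp (-(a₁ / 2) * x - exp x) * eulerInt α β 2 (Real.exp x)⁻¹ := by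
    intro x
    rw [hEF x (ofReal_mem_rayStrip x), ← laplace_eulerDensity α β (Real.exp_pos x),
      cpow_ofReal_exp, ← mul_assoc, ← exp_add, ofReal_exp]
    congr 2
    rw [hα]
    ring
  -- Behaviour as `x → ∞` along the positive axis, where `Φ₀` divided by its prefactor tends to `1`.
  have hk1 : k = 2 ^ (-β) * Gamma α := by
    rw [← eulerInt_two_zero (by linarith)]
    have e1 : Tendsto (fun x : ℝ => (Real.exp x)⁻¹) atTop (𝓝 0) :=
      Real.tendsto_exp_atTop.inv_tendsto_atTop
    have e2 : Tendsto (fun x : ℝ => eulerInt α β 2 (Real.exp x)⁻¹) atTop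
        (𝓝 (eulerInt α β 2 0)) := by
      refine tendsto_eulerInt h1 h2 tendsto_const_nhds e1 ?_ zero_le_two le_rfl (by norm_num)
      filter_upwards [eventually_ge_atTop 0] with x hx
      have := Real.exp_pos x
      exact ⟨by norm_num, le_rfl, by positivity, inv_le_one_of_one_le₀ (Real.one_le_exp hx),
        by positivity⟩
    have e3 := hdiv.const_mul k
    rw [mul_one] at e3
    refine tendsto_nhds_unique (e3.congr fun x => ?_) e2
    rw [Function.comp_apply, ← mul_div_assoc, ← hk, hEx, div_eq_iff (prefactor_ne_zero _ _),
      mul_comm, prefactor, ← exp_add]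
    congr 2
    simp only [expPar, Matrix.cons_val_zero]
    ring
  -- Behaviour as `x → 0`: after multiplication by `x^(-(1-p)/2)` the term with exponent `(1+p)/2`
  -- disappears, since `re p > 0`.
  have hkd : k * d = Gamma p := by
    have hαβ : α - β = p := by rw [hα, hβ]; ring
    rw [← hαβ, ← eulerInt_zero_one (by rw [hαβ]; exact h3)]
    have e1 : Tendsto (fun x : ℝ => 2 * Real.exp x) atBot (𝓝 0) := by
      simpa using Real.tendsto_exp_atBot.const_mul 2
    have e2 : Tendsto (fun x : ℝ => eulerInt α β (2 * Real.exp x) 1) atBot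
        (𝓝 (eulerInt α β 0 1)) := by
      refine tendsto_eulerInt h1 h2 e1 tendsto_const_nhds ?_ le_rfl zero_le_one (by norm_num)
      filter_upwards [eventually_le_atBot 0] with x hx
      have h5 := Real.exp_pos x
      have h6 := Real.exp_le_one_iff.2 hx
      exact ⟨by positivity, by linarith, zero_le_one, le_rfl, by positivity⟩
    have e3 : Tendsto (fun x : ℝ => exp (-exp (x : ℂ))) atBot (𝓝 1) := by
      have := (Complex.continuous_exp.tendsto _).comp tendsto_exp_ofReal_atBot.neg
      simpa [Function.comp_def] using this
    have e4 := e3.mul e2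
    rw [one_mul] at e4
    have e5 : Tendsto (fun x : ℝ => exp (p * x)) atBot (𝓝 0) := by
      rw [tendsto_zero_iff_norm_tendsto_zero]
      simp only [Complex.norm_exp, re_mul_ofReal]
      exact Real.tendsto_exp_atBot.comp (tendsto_id.const_mul_atBot h3)
    have e6 := (((e5.mul (tendsto_frob a₁ hp)).const_mul c).add
      ((tendsto_frob a₁ (neg_mem_nonInt hp)).const_mul d)).const_mul k
    simp only [mul_zero, mul_one, zero_add] at e6
    refine tendsto_nhds_unique (e6.congr fun x => ?_) e4
    have h7 := hEx x
    rw [eulerInt_scale α β (Real.exp_pos x), cpow_ofReal_exp, ← mul_assoc, ← exp_add, hk, h] at h7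
    have e7 : exp (-exp (x : ℂ)) = exp (-((1 + -p) / 2 * x)) *
        exp (-(a₁ / 2) * x - exp x + β * x) := by
      rw [← exp_add]
      congr 1
      rw [hβ]
      ring
    have e8 : exp (p * (x : ℂ)) * exp (-((1 + p) / 2 * x)) = exp (-((1 + -p) / 2 * x)) := by
      rw [← exp_add]
      congr 1
      ring
    rw [e7, mul_assoc, ← h7]
    linear_combination (k * c * frob a₁ p x) * e8
  have hΓ : Gamma α ≠ 0 := Complex.Gamma_ne_zero_of_re_pos (by linarith)
  rw [hk1] at hkd
  have h8 : (2 : ℂ) ^ β * 2 ^ (-β) = 1 := by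
    rw [← cpow_add _ _ two_ne_zero, add_neg_cancel, cpow_zero]
  rw [connCoeff, ← hkd, ← hα, ← hβ, mul_assoc, mul_right_comm _ d, mul_inv_cancel_right₀ hΓ]
  linear_combination -d * h8

theorem differentiableOn_connCoeff (a₁ : ℂ) : DifferentiableOn ℂ (connCoeff a₁) nonInt := by
  intro p hp
  have h1 : DifferentiableAt ℂ Gamma p := Complex.differentiableAt_Gamma p fun m hm =>
    mem_nonInt.1 hp (-m) (by rw [hm]; push_cast; rfl)
  have h2 : DifferentiableAt ℂ (fun q : ℂ => (Gamma ((1 + q + a₁) / 2))⁻¹) p :=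
    (Complex.differentiable_one_div_Gamma _).comp p
      (by fun_prop : DifferentiableAt ℂ (fun q : ℂ => (1 + q + a₁) / 2) p)
  have h3 : DifferentiableAt ℂ (fun q : ℂ => (2 : ℂ) ^ ((1 - q + a₁) / 2)) p :=
    DifferentiableAt.const_cpow (by fun_prop) (Or.inl two_ne_zero)
  exact ((h3.mul h1).mul h2).differentiableWithinAt

theorem isPreconnected_nonInt : IsPreconnected nonInt :=
  (Set.Countable.isPathConnected_compl_of_one_lt_rank (by simp [Complex.rank_real_complex])
    (countable_range fun n : ℤ => (n : ℂ))).isConnected.isPreconnected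

/-- The rotation symmetry transfers nonvanishing from the real line to the line `im t = -π`, the
base line for the monodromy argument. -/
theorem exists_frob_sub_ne_zero (a₁ : ℂ) {p : ℂ} (hp : p ∈ nonInt) :
    ∃ x : ℝ, frob a₁ p (x - Real.pi * I) ≠ 0 := by
  obtain ⟨x, hx⟩ := exists_frob_ne_zero (-a₁) hp
  refine ⟨x, ?_⟩
  have h := frob_neg (-a₁) p x (ω := -(Real.pi * I)) (by rw [exp_neg, Complex.exp_pi_mul_I]; simp)
  rw [neg_neg, neg_add_eq_sub] at h
  rw [h]
  exact mul_ne_zero (exp_ne_zero _) hx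

/-- The monodromy of the subdominant solution in terms of the connection coefficient. -/
theorem subdominant_monodromy (a₁ : ℂ) {p : ℂ} (hp : p ∈ nonInt) (x : ℝ) :
    subdominant (x + Real.pi * I) (expPar a₁ p) =
      exp ((1 + p) / 2 * (2 * Real.pi * I)) * subdominant (x - Real.pi * I) (expPar a₁ p) +
      connCoeff a₁ p * (exp ((1 + -p) / 2 * (2 * Real.pi * I)) -
        exp ((1 + p) / 2 * (2 * Real.pi * I))) * frob a₁ (-p) (x - Real.pi * I) := by
  have him1 : |((x : ℂ) + Real.pi * I).im| < 3 * Real.pi / 2 := by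
    simp only [add_im, ofReal_im, mul_im, ofReal_re, I_im, mul_one, I_re, mul_zero, add_zero,
      zero_add]
    rw [abs_of_pos Real.pi_pos]
    linarith [Real.pi_pos]
  have him2 : |((x : ℂ) - Real.pi * I).im| < 3 * Real.pi / 2 := by
    simp only [sub_im, ofReal_im, mul_im, ofReal_re, I_im, mul_one, I_re, mul_zero, add_zero,
      zero_sub, abs_neg]
    rw [abs_of_pos Real.pi_pos]
    linarith [Real.pi_pos]
  have hneg : DifferentiableOn ℂ (fun q : ℂ => frob a₁ (-q) (x - Real.pi * I)) nonInt :=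
    (differentiableOn_frob a₁ (x - Real.pi * I)).comp (f := fun q : ℂ => -q) (by fun_prop)
      fun q hq => neg_mem_nonInt hq
  -- The coefficients in the Frobenius basis are not known to be holomorphic in `p`. The monodromy
  -- combination eliminates the unknown `c` and involves `Φ₀` only at arguments `±π`, where it is
  -- entire in `p`.
  have hd : DifferentiableOn ℂ (fun q : ℂ => subdominant (x + Real.pi * I) (expPar a₁ q) -
      (exp ((1 + q) / 2 * (2 * Real.pi * I)) * subdominant (x - Real.pi * I) (expPar a₁ q) +
      connCoeff a₁ q * (exp ((1 + -q) / 2 * (2 * Real.pi * I)) -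
        exp ((1 + q) / 2 * (2 * Real.pi * I))) * frob a₁ (-q) (x - Real.pi * I))) nonInt := by
    have e1 : Differentiable ℂ fun q : ℂ => exp ((1 + q) / 2 * (2 * Real.pi * I)) := by fun_prop
    have e2 : Differentiable ℂ fun q : ℂ => exp ((1 + -q) / 2 * (2 * Real.pi * I)) := by fun_prop
    exact (differentiable_subdominant a₁ him1).differentiableOn.sub
      ((e1.mul (differentiable_subdominant a₁ him2)).differentiableOn.add
        (((differentiableOn_connCoeff a₁).mul (e2.sub e1).differentiableOn).mul hneg))
  -- Large enough to give `re α > 1`, `re β ≤ 0` and `re q > 0`.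
  set B : ℝ := 3 + ‖a₁‖ with hB
  have hlarge : ∀ q ∈ nonInt, B < q.re → subdominant (x + Real.pi * I) (expPar a₁ q) -
      (exp ((1 + q) / 2 * (2 * Real.pi * I)) * subdominant (x - Real.pi * I) (expPar a₁ q) +
      connCoeff a₁ q * (exp ((1 + -q) / 2 * (2 * Real.pi * I)) -
        exp ((1 + q) / 2 * (2 * Real.pi * I))) * frob a₁ (-q) (x - Real.pi * I)) = 0 := by
    intro q hq hqB
    obtain ⟨c, d, h⟩ := eq_lin_frob hq (isSolution_subdominant (expPar a₁ q))
    have ha := abs_le.1 (Complex.abs_re_le_norm a₁)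
    have r1 : ((1 + q + a₁) / 2).re = (1 + q.re + a₁.re) / 2 := by
      simp
    have r2 : ((1 - q + a₁) / 2).re = (1 - q.re + a₁.re) / 2 := by
      simp
    have hdc := subdominant_eq_of_large hq (by rw [r1]; linarith) (by rw [r2]; linarith)
      (by linarith [norm_nonneg a₁]) h
    have e : (x : ℂ) + Real.pi * I = (x - Real.pi * I) + 2 * Real.pi * I := by ring
    rw [e, h, h, frob_add_two_pi, frob_add_two_pi, hdc]
    ring
  -- A half-integer beyond `B`: a base point for the identity theorem on the connected set `nonInt`.
  have hq₀ : ((⌈B⌉₊ + 1 : ℕ) + 1 / 2 : ℂ) ∈ nonInt := by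
    rw [mem_nonInt]
    intro n hn
    have : ((2 * (⌈B⌉₊ + 1) + 1 : ℤ) : ℂ) = ((2 * n : ℤ) : ℂ) := by
      push_cast at hn ⊢
      linear_combination 2 * hn
    have := Int.cast_injective this
    omega
  have hev : ∀ᶠ q in 𝓝 ((⌈B⌉₊ + 1 : ℕ) + 1 / 2 : ℂ), q ∈ nonInt ∧ B < q.re := by
    refine Eventually.and (isOpen_nonInt.mem_nhds hq₀)
      ((isOpen_lt continuous_const continuous_re).mem_nhds ?_)
    have := Nat.le_ceil B
    simp
    linarith
  have h0 := (hd.analyticOnNhd isOpen_nonInt).eqOn_zero_of_preconnected_of_eventuallyEq_zero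
    isPreconnected_nonInt hq₀ (hev.mono fun q hq => hlarge q hq.1 hq.2) hp
  exact sub_eq_zero.1 h0

/-- Since the eigenvalues differ and the Frobenius solution is nonzero somewhere, the monodromy
identity determines `d`. The parameter depends only on `p²`, so the same argument at `-p` determines
`c`. -/
theorem subdominant_eq_frob (a₁ : ℂ) {p : ℂ} (hp : p ∈ nonInt) (t : ℂ) :
    subdominant t (expPar a₁ p) =
      connCoeff a₁ (-p) * frob a₁ p t + connCoeff a₁ p * frob a₁ (-p) t := by
  have key : ∀ {q c d : ℂ}, q ∈ nonInt →
      (∀ t, subdominant t (expPar a₁ q) = c * frob a₁ q t + d * frob a₁ (-q) t) →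
      d = connCoeff a₁ q := by
    intro q c d hq h
    obtain ⟨x, hx⟩ := exists_frob_sub_ne_zero a₁ (neg_mem_nonInt hq)
    have h1 := subdominant_monodromy a₁ hq x
    have e : (x : ℂ) + Real.pi * I = (x - Real.pi * I) + 2 * Real.pi * I := by ring
    rw [e, h, h, frob_add_two_pi, frob_add_two_pi] at h1
    have h2 : (d - connCoeff a₁ q) * (exp ((1 + -q) / 2 * (2 * Real.pi * I)) -
        exp ((1 + q) / 2 * (2 * Real.pi * I))) * frob a₁ (-q) (x - Real.pi * I) = 0 := by
      linear_combination h1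
    exact sub_eq_zero.1 ((mul_eq_zero.1 ((mul_eq_zero.1 h2).resolve_right hx)).resolve_right
      (sub_ne_zero.2 (exp_monodromy_ne hq)))
  obtain ⟨c, d, h⟩ := eq_lin_frob hp (isSolution_subdominant (expPar a₁ p))
  have e : expPar a₁ (-p) = expPar a₁ p := by simp [expPar]
  have hc : c = connCoeff a₁ (-p) := key (c := d) (neg_mem_nonInt hp) fun t => by
    rw [e, h, neg_neg, add_comm]
  rw [h, hc, ← key hp h]

end StokesSibuya

namespace StokesSibuya

/-! ### The rotated solutions and the connection matrices -/

theorem Phi_zero (Φ : ℂ → (Fin 2 → ℂ) → ℂ) (t : ℂ) (a : Fin 2 → ℂ) : Phi Φ 0 t a = Φ t a := by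
  have e : ![a 0, a 1] = a := by
    funext i
    fin_cases i <;> rfl
  simp [Phi, e]

theorem exp_neg_pi_mul_I : exp (-(Real.pi * I)) = -1 := by
  rw [exp_neg, Complex.exp_pi_mul_I]
  simp

theorem Phi_one (Φ : ℂ → (Fin 2 → ℂ) → ℂ) (t a₁ p : ℂ) :
    Phi Φ 1 t (expPar a₁ p) = Φ (Real.pi * I + t) (expPar (-a₁) p) := by
  simp [Phi, expPar]

theorem Phi_neg_one (Φ : ℂ → (Fin 2 → ℂ) → ℂ) (t a₁ p : ℂ) :
    Phi Φ (-1) t (expPar a₁ p) = Φ (-(Real.pi * I) + t) (expPar (-a₁) p) := by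
  simp [Phi, expPar]

theorem subdominant_add_eq_frob (a₁ : ℂ) {p : ℂ} (hp : p ∈ nonInt) {ω : ℂ} (hω : exp ω = -1)
    (t : ℂ) : subdominant (ω + t) (expPar (-a₁) p) =
      connCoeff (-a₁) (-p) * exp ((1 + p) / 2 * ω) * frob a₁ p t +
      connCoeff (-a₁) p * exp ((1 - p) / 2 * ω) * frob a₁ (-p) t := by
  rw [subdominant_eq_frob (-a₁) hp, frob_neg a₁ p t hω, frob_neg a₁ (-p) t hω]
  ring_nf

/-! ### The Stokes multiplier -/

theorem pi_mul_inv_Gamma (s : ℂ) :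
    (Real.pi : ℂ) * (Gamma s)⁻¹ * (Gamma (1 - s))⁻¹ = sin (Real.pi * s) := by
  have hπ : (Real.pi : ℂ) ≠ 0 := by exact_mod_cast Real.pi_ne_zero
  rw [mul_assoc, ← mul_inv, Complex.Gamma_mul_Gamma_one_sub, inv_div, mul_div_cancel₀ _ hπ]

/-- The Stokes multiplier. -/
noncomputable def stokesCoeff (a₁ p : ℂ) : ℂ :=
  -2 * I * exp (-(I * Real.pi * (a₁ / 2))) * (2 : ℂ) ^ (-a₁) *
    (Real.pi * (Gamma ((1 - p - a₁) / 2))⁻¹ * (Gamma ((1 + p - a₁) / 2))⁻¹)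

theorem stokesCoeff_neg (a₁ p : ℂ) : stokesCoeff a₁ (-p) = stokesCoeff a₁ p := by
  rw [stokesCoeff, stokesCoeff, sub_neg_eq_add, ← sub_eq_add_neg]
  ring

theorem stokesFormula_eq (a₁ p : ℂ) :
    stokesFormula a₁ p = !![stokesCoeff a₁ p, exp (-(I * Real.pi * a₁)); 1, 0] := by
  have e1 : (1 : ℂ) / 2 - (p / 2 + a₁ / 2) = (1 - p - a₁) / 2 := by ring
  have e2 : p / 2 - a₁ / 2 + 1 / 2 = (1 + p - a₁) / 2 := by ring
  rw [stokesFormula, gammaCos_eq, stokesCoeff, e1, e2,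
    div_eq_mul_inv _ (Gamma ((1 + p - a₁) / 2))]

theorem differentiable_stokesCoeff (a₁ : ℂ) : Differentiable ℂ (stokesCoeff a₁) := by
  have h1 : Differentiable ℂ fun q : ℂ => (Gamma ((1 - q - a₁) / 2))⁻¹ :=
    Complex.differentiable_one_div_Gamma.comp
      (by fun_prop : Differentiable ℂ fun q : ℂ => (1 - q - a₁) / 2)
  have h2 : Differentiable ℂ fun q : ℂ => (Gamma ((1 + q - a₁) / 2))⁻¹ :=
    Complex.differentiable_one_div_Gamma.comp
      (by fun_prop : Differentiable ℂ fun q : ℂ => (1 + q - a₁) / 2)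
  exact ((h1.const_mul _).mul h2).const_mul _

/-- The coefficient of `frob a₁ q` in the Stokes relation. The reflection formula at `(1 + q -
a₁)/2` replaces a product of two `1/Γ` by `cos(π(q - a₁)/2)`, whose two exponentials match the two
rotated terms. The other coefficient is the case of `-q`, because the multiplier is even in `q`. -/
theorem connCoeff_stokes (a₁ q : ℂ) :
    connCoeff (-a₁) (-q) * exp ((1 + q) / 2 * -(Real.pi * I)) =
      stokesCoeff a₁ q * connCoeff a₁ (-q) + exp (-(I * Real.pi * a₁)) *
        (connCoeff (-a₁) (-q) * exp ((1 + q) / 2 * (Real.pi * I))) := by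
  have hG := pi_mul_inv_Gamma ((1 + q - a₁) / 2)
  have e1 : 1 - (1 + q - a₁) / 2 = (1 - q + a₁) / 2 := by ring
  have e2 : (Real.pi : ℂ) * ((1 + q - a₁) / 2) = Real.pi * (q - a₁) / 2 + Real.pi / 2 := by ring
  rw [e1, e2, Complex.sin_add_pi_div_two, Complex.cos] at hG
  have h2 : (2 : ℂ) ^ ((1 + q + a₁) / 2) * 2 ^ (-a₁) = 2 ^ ((1 + q - a₁) / 2) := by
    rw [← cpow_add _ _ two_ne_zero]
    ring_nf
  have hI : exp (Real.pi / 2 * I) = I := Complex.exp_pi_div_two_mul_I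
  have hI' : exp (-(Real.pi / 2 * I)) = -I := by rw [exp_neg, hI, Complex.inv_I]
  have x1 : exp ((1 + q) / 2 * -(Real.pi * I)) = -I * exp (-(Real.pi * q / 2 * I)) := by
    rw [← hI', ← exp_add]
    ring_nf
  have x2 : exp (-(I * Real.pi * a₁)) * exp ((1 + q) / 2 * (Real.pi * I)) =
      I * (exp (-(I * Real.pi * (a₁ / 2))) * exp (Real.pi * (q - a₁) / 2 * I)) := by
    nth_rewrite 3 [← hI]
    rw [← exp_add, ← exp_add, ← exp_add]
    ring_nf
  have x3 : exp (-(I * Real.pi * (a₁ / 2))) * exp (-(Real.pi * (q - a₁) / 2) * I) =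
      exp (-(Real.pi * q / 2 * I)) := by
    rw [← exp_add]
    ring_nf
  have c1 : connCoeff (-a₁) (-q) =
      2 ^ ((1 + q - a₁) / 2) * Gamma (-q) * (Gamma ((1 - q - a₁) / 2))⁻¹ := by
    rw [connCoeff]
    ring_nf
  have c2 : connCoeff a₁ (-q) =
      2 ^ ((1 + q + a₁) / 2) * Gamma (-q) * (Gamma ((1 - q + a₁) / 2))⁻¹ := by
    rw [connCoeff]
    ring_nf
  rw [c1, c2, stokesCoeff, x1, ← h2]
  set E := exp (-(I * Real.pi * (a₁ / 2)))
  set U := (2 : ℂ) ^ ((1 + q + a₁) / 2)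
  set V := (2 : ℂ) ^ (-a₁)
  set G₁ := (Gamma ((1 - q - a₁) / 2))⁻¹
  linear_combination (2 * I * E * V * U * Gamma (-q) * G₁) * hG -
    (U * V * Gamma (-q) * G₁) * x2 + (I * U * V * Gamma (-q) * G₁) * x3

theorem stokes_relation_of_nonInt (a₁ : ℂ) {p : ℂ} (hp : p ∈ nonInt) (t : ℂ) :
    subdominant (-(Real.pi * I) + t) (expPar (-a₁) p) =
      stokesCoeff a₁ p * subdominant t (expPar a₁ p) +
      exp (-(I * Real.pi * a₁)) * subdominant (Real.pi * I + t) (expPar (-a₁) p) := by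
  rw [subdominant_add_eq_frob a₁ hp exp_neg_pi_mul_I, subdominant_add_eq_frob a₁ hp
    Complex.exp_pi_mul_I, subdominant_eq_frob a₁ hp]
  have h1 := connCoeff_stokes a₁ p
  have h2 := connCoeff_stokes a₁ (-p)
  rw [neg_neg, ← sub_eq_add_neg, stokesCoeff_neg] at h2
  linear_combination frob a₁ p t * h1 + frob a₁ (-p) t * h2

theorem dense_nonInt : Dense nonInt := (Set.countable_range _).dense_compl ℂ

/-- Integer `p` is reached by continuity. This needs `s` and `s ± πi` to have arguments in `(-3π/2,
3π/2)`, hence `|im s| < π/2`; the identity theorem in `t` then removes that restriction. -/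
theorem stokes_relation (a₁ p t : ℂ) :
    subdominant (-(Real.pi * I) + t) (expPar (-a₁) p) =
      stokesCoeff a₁ p * subdominant t (expPar a₁ p) +
      exp (-(I * Real.pi * a₁)) * subdominant (Real.pi * I + t) (expPar (-a₁) p) := by
  have hstrip : ∀ s ∈ rayStrip 0, subdominant (-(Real.pi * I) + s) (expPar (-a₁) p) =
      stokesCoeff a₁ p * subdominant s (expPar a₁ p) +
      exp (-(I * Real.pi * a₁)) * subdominant (Real.pi * I + s) (expPar (-a₁) p) := by
    intro s hs
    have hs' : |s.im| < Real.pi / 2 := by simpa [rayStrip] using hs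
    have hpi := Real.pi_pos
    rw [abs_lt] at hs'
    have i1 : |(-(Real.pi * I) + s).im| < 3 * Real.pi / 2 := by
      simp only [add_im, neg_im, mul_im, ofReal_re, I_im, mul_one, ofReal_im, I_re, mul_zero,
        add_zero]
      rw [abs_lt]
      constructor <;> linarith
    have i2 : |s.im| < 3 * Real.pi / 2 := by
      rw [abs_lt]
      constructor <;> linarith
    have i3 : |(Real.pi * I + s).im| < 3 * Real.pi / 2 := by
      simp only [add_im, mul_im, ofReal_re, I_im, mul_one, ofReal_im, I_re, mul_zero, add_zero]
      rw [abs_lt]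
      constructor <;> linarith
    exact congrFun (Continuous.ext_on dense_nonInt (differentiable_subdominant (-a₁) i1).continuous
      (((differentiable_stokesCoeff a₁).mul (differentiable_subdominant a₁ i2)).add
        ((differentiable_subdominant (-a₁) i3).const_mul _)).continuous
      fun q hq => stokes_relation_of_nonInt a₁ hq s) p
  have hd : ∀ (a : Fin 2 → ℂ) (ω : ℂ), Differentiable ℂ fun s => subdominant (ω + s) a :=
    fun a ω => (isSolution_subdominant a).1.comp (f := fun s => ω + s) (by fun_prop)
  have hR : Differentiable ℂ fun s => stokesCoeff a₁ p * subdominant s (expPar a₁ p) +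
      exp (-(I * Real.pi * a₁)) * subdominant (Real.pi * I + s) (expPar (-a₁) p) :=
    ((isSolution_subdominant _).1.const_mul _).add ((hd _ _).const_mul _)
  refine congrFun (AnalyticOnNhd.eq_of_eventuallyEq (z₀ := (0 : ℝ))
    (fun s _ => (hd (expPar (-a₁) p) (-(Real.pi * I))).analyticAt s)
    (fun s _ => hR.analyticAt s) ?_) t
  exact Filter.mem_of_superset ((isOpen_rayStrip 0).mem_nhds (ofReal_mem_rayStrip 0)) hstrip

/-- On the positive axis the first solution is recessive and the second is dominant: its argument is
`π`, where the prefactor is of size `e^x` up to a power. Dividing by that prefactor isolates `d`. -/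
theorem linear_independent_subdominant {a₁ p c d : ℂ}
    (h : ∀ t, c * subdominant t (expPar a₁ p) +
      d * subdominant (Real.pi * I + t) (expPar (-a₁) p) = 0) : c = 0 ∧ d = 0 := by
  have hpi := Real.pi_gt_three
  have h1 : HasLead (expPar a₁ p) 0 1 fun t => subdominant t (expPar a₁ p) :=
    isPhi0_subdominant.hasLead _ (by rw [abs_zero]; linarith)
  have h2 : HasLead (expPar (-a₁) p) Real.pi 1 fun t => subdominant t (expPar (-a₁) p) :=
    isPhi0_subdominant.hasLead _ (by rw [abs_of_pos Real.pi_pos]; linarith)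
  have hline : Tendsto (fun x : ℝ => (x : ℂ)) atTop (stripEnd 0 1) := by
    simpa using tendsto_line_stripEnd 0 zero_le_one
  have l1 := (h1.tendsto_zero zero_le_one (by rw [abs_zero]; linarith)).comp hline
  have l2 := h2.tendsto_div.comp (tendsto_line_stripEnd Real.pi zero_le_one)
  -- This is the inverse of the prefactor of the rotated solution; it decays because `exp (x + πi) =
  -- -exp x`.
  have l3 := ((tendsto_exp_sub_exp (y := 0) zero_le_one (by rw [abs_zero]; linarith)
    (-(a₁ / 2))).comp hline).const_mul (exp (-(a₁ / 2 * (Real.pi * I))))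
  have l4 := ((l1.mul l3).const_mul c).add (l2.const_mul d)
  simp only [Function.comp_def, mul_zero, mul_one, zero_add] at l4
  have hd : d = 0 := by
    refine tendsto_nhds_unique l4 (tendsto_const_nhds.congr fun x : ℝ => ?_)
    have e : (prefactor (expPar (-a₁) p) (x + Real.pi * I))⁻¹ =
        exp (-(a₁ / 2 * (Real.pi * I))) * exp (-(a₁ / 2) * x - exp x) := by
      rw [prefactor, ← exp_add, ← exp_neg, ← exp_add, exp_add (x : ℂ), Complex.exp_pi_mul_I]
      simp only [expPar, Matrix.cons_val_zero]
      ring_nf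
    have h3 := h x
    rw [add_comm _ (x : ℂ)] at h3
    rw [div_eq_mul_inv (subdominant _ _), e]
    linear_combination
      (-(exp (-(a₁ / 2 * (Real.pi * I))) * exp (-(a₁ / 2) * x - exp x))) * h3
  obtain ⟨x, hx⟩ := ((h1.tendsto_div.comp hline).eventually_ne one_ne_zero).exists
  have h3 := h x
  rw [hd, zero_mul, add_zero] at h3
  refine ⟨(mul_eq_zero.1 h3).resolve_right fun h0 => hx ?_, hd⟩
  simp [h0]

/-! ### Identification of the two connection matrices -/

theorem isStokesSibuyaMatrix_iff (a₁ p : ℂ) (S : Matrix (Fin 2) (Fin 2) ℂ) :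
    IsStokesSibuyaMatrix subdominant 0 (expPar a₁ p) S ↔ S = stokesFormula a₁ p := by
  rw [stokesFormula_eq, IsStokesSibuyaMatrix]
  simp only [zero_sub, zero_add, Phi_zero, Phi_one, Phi_neg_one]
  constructor
  · rintro ⟨C, C', rfl, h⟩
    obtain ⟨h1, h2⟩ := linear_independent_subdominant (a₁ := a₁) (p := p)
      (c := C - stokesCoeff a₁ p) (d := C' - exp (-(I * Real.pi * a₁))) fun t => by
        linear_combination stokes_relation a₁ p t - h t
    rw [sub_eq_zero.1 h1, sub_eq_zero.1 h2]
  · rintro rfl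
    exact ⟨_, _, rfl, stokes_relation a₁ p⟩

/-- The factor `√2` in the stated matrix absorbs the half-integer shift of the exponent of `2`. -/
theorem connCoeff_eq_div (a₁ p : ℂ) : connCoeff a₁ p =
    2 ^ (a₁ / 2 - p / 2 + 1) * Gamma p / ((Real.sqrt 2 : ℂ) * Gamma (p / 2 + a₁ / 2 + 1 / 2)) := by
  have h1 : ((Real.sqrt 2 : ℝ) : ℂ) = 2 ^ (1 / 2 : ℂ) := by
    rw [Real.sqrt_eq_rpow, ofReal_cpow zero_le_two]
    norm_num
  have h2 : (2 : ℂ) ^ (a₁ / 2 - p / 2 + 1) = 2 ^ (1 / 2 : ℂ) * 2 ^ ((1 - p + a₁) / 2) := by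
    rw [← cpow_add _ _ two_ne_zero]
    ring_nf
  have h3 : (2 : ℂ) ^ (1 / 2 : ℂ) ≠ 0 := by simp [cpow_eq_zero_iff]
  have h4 : p / 2 + a₁ / 2 + 1 / 2 = (1 + p + a₁) / 2 := by ring
  rw [h1, h2, h4, connCoeff, mul_assoc (2 ^ (1 / 2 : ℂ) : ℂ), mul_div_mul_left _ _ h3,
    div_eq_mul_inv _ (Gamma _)]

theorem zeroInftyFormula_eq (a₁ p : ℂ) : zeroInftyFormula a₁ p =
    !![connCoeff (-a₁) (-p) * exp ((1 + p) / 2 * -(Real.pi * I)),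
      connCoeff (-a₁) p * exp ((1 - p) / 2 * -(Real.pi * I));
      connCoeff a₁ (-p), connCoeff a₁ p] := by
  have hI' : exp (-(Real.pi / 2 * I)) = -I := by
    rw [exp_neg, Complex.exp_pi_div_two_mul_I, Complex.inv_I]
  have x1 : ∀ q : ℂ, exp ((1 + q) / 2 * -(Real.pi * I)) = -I * exp (-(I * Real.pi * (q / 2))) := by
    intro q
    rw [← hI', ← exp_add]
    ring_nf
  have x2 := x1 (-p)
  rw [← sub_eq_add_neg, neg_div, mul_neg (I * (Real.pi : ℂ)), neg_neg] at x2
  rw [zeroInftyFormula, x1, x2]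
  simp only [connCoeff_eq_div, neg_div, sub_neg_eq_add]
  ring_nf

theorem isZeroInftyMatrix_iff {a₁ p : ℂ} (hp : p ∈ nonInt) (M : Matrix (Fin 2) (Fin 2) ℂ) :
    IsZeroInftyMatrix subdominant 0 (expPar a₁ p) (frob a₁ p) (frob a₁ (-p)) M ↔
      M = zeroInftyFormula a₁ p := by
  have key : ∀ M : Matrix (Fin 2) (Fin 2) ℂ,
      IsZeroInftyMatrix subdominant 0 (expPar a₁ p) (frob a₁ p) (frob a₁ (-p)) M ↔
      ∀ t, subdominant (-(Real.pi * I) + t) (expPar (-a₁) p) =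
          M 0 0 * frob a₁ p t + M 0 1 * frob a₁ (-p) t ∧
        subdominant t (expPar a₁ p) = M 1 0 * frob a₁ p t + M 1 1 * frob a₁ (-p) t := by
    intro M
    simp only [IsZeroInftyMatrix, zero_sub, Phi_zero, Phi_neg_one, Matrix.mulVec_eq_sum]
    refine forall_congr' fun t => ?_
    simp [funext_iff, Fin.forall_fin_two, mul_comm]
  have hform : IsZeroInftyMatrix subdominant 0 (expPar a₁ p) (frob a₁ p) (frob a₁ (-p))
      (zeroInftyFormula a₁ p) := by
    rw [key, zeroInftyFormula_eq]
    exact fun t => ⟨subdominant_add_eq_frob a₁ hp exp_neg_pi_mul_I t, subdominant_eq_frob a₁ hp t⟩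
  constructor
  · intro h
    rw [key] at h hform
    obtain ⟨h1, h2⟩ := linear_independent_frob (a₁ := a₁) hp
      (c := M 0 0 - zeroInftyFormula a₁ p 0 0) (d := M 0 1 - zeroInftyFormula a₁ p 0 1)
      fun t => by linear_combination (hform t).1 - (h t).1
    obtain ⟨h3, h4⟩ := linear_independent_frob (a₁ := a₁) hp
      (c := M 1 0 - zeroInftyFormula a₁ p 1 0) (d := M 1 1 - zeroInftyFormula a₁ p 1 1)
      fun t => by linear_combination (hform t).2 - (h t).2
    ext i j
    fin_cases i <;> fin_cases j
    exacts [sub_eq_zero.1 h1, sub_eq_zero.1 h2, sub_eq_zero.1 h3, sub_eq_zero.1 h4]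
  · rintro rfl
    exact hform

end StokesSibuya

theorem propositionA7 :
    -- `Φ₀` is well defined
    (∃! Φ₀ : ℂ → (Fin 2 → ℂ) → ℂ, StokesSibuya.IsPhi0 Φ₀) ∧
    ∀ Φ₀ : ℂ → (Fin 2 → ℂ) → ℂ, StokesSibuya.IsPhi0 Φ₀ →
      ∀ (a : Fin 2 → ℂ) (p : ℂ), p ^ 2 = 1 + 4 * a 1 →
        -- there is exactly one Stokes-Sibuya matrix `𝔖₀(a)`, and it is the stated one
        (∀ S : Matrix (Fin 2) (Fin 2) ℂ,
          StokesSibuya.IsStokesSibuyaMatrix Φ₀ 0 a S ↔ S = StokesSibuya.stokesFormula (a 0) p) ∧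
        -- the Frobenius solutions `f₁`, `f₂` are well defined, and there is exactly one
        -- matrix `M₀`, the stated one
        ((∀ n : ℤ, p ≠ n) →
          (∃! f₁ : ℂ → ℂ, StokesSibuya.IsFrobenius a p f₁) ∧
          (∃! f₂ : ℂ → ℂ, StokesSibuya.IsFrobenius a (-p) f₂) ∧
          ∀ f₁ f₂ : ℂ → ℂ, StokesSibuya.IsFrobenius a p f₁ → StokesSibuya.IsFrobenius a (-p) f₂ →
            ∀ M : Matrix (Fin 2) (Fin 2) ℂ,
              StokesSibuya.IsZeroInftyMatrix Φ₀ 0 a f₁ f₂ M ↔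
                M = StokesSibuya.zeroInftyFormula (a 0) p) := by
  refine ⟨⟨StokesSibuya.subdominant, StokesSibuya.isPhi0_subdominant,
    fun Φ h => h.eq_subdominant⟩, fun Φ₀ hΦ a p hap => ?_⟩
  obtain rfl := hΦ.eq_subdominant
  obtain ⟨a₁, ha₁⟩ : ∃ a₁, a 0 = a₁ := ⟨_, rfl⟩
  -- Either square root `p` recovers `a₂ = (p² - 1)/4`, so the choice of determination plays no
  -- role.
  obtain rfl : a = StokesSibuya.expPar a₁ p := ha₁ ▸ StokesSibuya.expPar_eq hap
  rw [ha₁]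
  refine ⟨StokesSibuya.isStokesSibuyaMatrix_iff a₁ p, fun hp => ?_⟩
  have hp' := StokesSibuya.mem_nonInt.2 hp
  have hn := StokesSibuya.neg_mem_nonInt hp'
  have e : StokesSibuya.expPar a₁ (-p) = StokesSibuya.expPar a₁ p := by
    simp [StokesSibuya.expPar]
  refine ⟨⟨_, StokesSibuya.isFrobenius_frob a₁ hp', fun f hf => hf.eq_frob hp'⟩,
    ⟨_, e ▸ StokesSibuya.isFrobenius_frob a₁ hn,
      fun f hf => StokesSibuya.IsFrobenius.eq_frob hn (e.symm ▸ hf)⟩, fun f₁ f₂ h₁ h₂ => ?_⟩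
  obtain rfl : f₁ = StokesSibuya.frob a₁ p := h₁.eq_frob hp'
  obtain rfl : f₂ = StokesSibuya.frob a₁ (-p) :=
    StokesSibuya.IsFrobenius.eq_frob hn (e.symm ▸ h₂)
  exact StokesSibuya.isZeroInftyMatrix_iff hp'
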